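/- Let $\pi : P \to M$ be a smooth principal $G$-bundle, where $M$, $G$, $P$ are smooth, second countable, Hausdorff manifolds of finite and nonzero dimension, and the structure group $G$ is a semisimple Lie group (its Lie algebra $\mathfrak g \neq 0$ has zero radical). Let $A = TP/G$ be the Atiyah algebroid of $P$, with anchor $A \to TM$, $[X_u] \mapsto T_u\pi(X_u)$, and kernel bundle $K = P\times_G \mathfrak g$. Let $\mathcal A = \Gamma(A)$ be the Lie algebra of smooth sections of $A$, identified with the Lie algebra of smooth $G$-invariant vector fields on $P$ with the bracket of vector fields. For $a\in\mathcal A$ denote by $a_m \in A_m$ its value at $m\in M$ and by $\hat a$ its anchor, and put $$\mathcal K = \Gamma(K)=\{a\in\mathcal A : \hat a = 0\},\quad \mathcal A(m) = \{a\in\mathcal A : a_m = 0\},\quad \mathcal K(m) = \{k\in\mathcal K : k_m = 0\},\quad \mathcal A_m = \{a\in\mathcal A : \hat a_m = 0\}.$$ A maximal finite-codimensional Lie subalgebra (respectively Lie ideal) is a maximal element of the set of all proper Lie subalgebras (respectively Lie ideals) of finite codimension. For a Lie subalgebra $T\subset\mathcal A$ let $\mathcal K^{T}$ be the intersection of all maximal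 finite-codimensional Lie ideals $J$ of $\mathcal K$ that are normalized by $T$, i.e. $[T,J]\subset J$. Then: 1. A Lie subalgebra $\mathcal A_0\subset\mathcal A$ is of the form $\mathcal A(m)$ for some $m\in M$ if and only if it is maximal in the class of all Lie subalgebras $S\subset\mathcal A$ such that $[S,\mathcal K]\subset\mathcal K(m)$ for some $m\in M$. 2. A Lie subalgebra $\mathcal A_0\subset\mathcal A$ is of the form $\mathcal A(m)$ for some $m\in M$ if and only if it is maximal in the class of all Lie subalgebras $S\subset\mathcal A$ such that $[S,\mathcal K]\subset\mathcal K^{T}$ for some maximal finite-codimensional Lie subalgebra $T$ of $\mathcal A$. 3. The subalgebra $T$ that corresponds to $\mathcal A(m)$ in 2 is $\mathcal A_m$: for every $m\in M$, $\mathcal A_m$ is a maximal finite-codimensional Lie subalgebra of $\mathcal A$, $\mathcal A(m)$ is maximal among the Lie subalgebras $S\subset\mathcal A$ with $[S,\mathcal K]\subset\mathcal K^{\mathcal A_m}$, and $\mathcal A_m$ is the only maximal finite-codimensional Lie subalgebra $T$ of $\mathcal A$ with $[\mathcal A(m),\mathcal K]\subset\mathcal K^{T}$. -/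

import Mathlib

open scoped Manifold ContDiff Bundle
open VectorField
noncomputable section

instance instLEInftyMinSmoothness : ENat.LEInfty (minSmoothness ℝ 3) :=
  ⟨by rw [minSmoothness_of_isRCLikeNormedField]; exact ENat.LEInfty.out⟩

/-- The smooth vector fields on a manifold `P` modelled on `E`. -/
abbrev SmoothVectorField (E P : Type*) [NormedAddCommGroup E] [NormedSpace ℝ E]
    [TopologicalSpace P] [ChartedSpace E P] [IsManifold 𝓘(ℝ, E) ∞ P] : Type _ :=
  ContMDiffSection 𝓘(ℝ, E) E ∞ (TangentSpace 𝓘(ℝ, E) : P → Type _)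

namespace SmoothVectorField
variable {E P : Type*} [NormedAddCommGroup E] [NormedSpace ℝ E]
    [TopologicalSpace P] [ChartedSpace E P] [IsManifold 𝓘(ℝ, E) ∞ P]


theorem mdifferentiableAt (X : SmoothVectorField E P) (u : P) :
    MDifferentiableAt 𝓘(ℝ, E) (𝓘(ℝ, E).prod 𝓘(ℝ, E))
      (fun x => (X x : TangentBundle 𝓘(ℝ, E) P)) u :=
  (X.contMDiff u).mdifferentiableAt (by simp)

theorem contMDiffAt_mvfderiv_apply {φ : P → ℝ} {u : P} (hφ : ContMDiffAt 𝓘(ℝ, E) 𝓘(ℝ, ℝ) ∞ φ u)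
    (X : SmoothVectorField E P) :
    ContMDiffAt 𝓘(ℝ, E) 𝓘(ℝ, ℝ) ∞ (fun y => mvfderiv 𝓘(ℝ, E) φ y (X y)) u := by
  have A := hφ.mfderiv_const (m := ∞) (by simp)
  have B := ContMDiffAt.clm_apply_of_inCoordinates (n := ∞) (E₁ := TangentSpace 𝓘(ℝ, E))
    (E₂ := TangentSpace 𝓘(ℝ, ℝ)) (ϕ := fun y => mfderiv 𝓘(ℝ, E) 𝓘(ℝ, ℝ) φ y) (v := fun y => X y) (b₁ := id) (b₂ := φ) A (X.contMDiff u) hφ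
  rw [Bundle.contMDiffAt_totalSpace] at B
  simpa using! B.2

variable [CompleteSpace E]

/-- The Lie bracket of smooth vector fields. -/
instance : Bracket (SmoothVectorField E P) (SmoothVectorField E P) where
  bracket X Y := ⟨mlieBracket 𝓘(ℝ, E) X Y, by
    have : IsManifold 𝓘(ℝ, E) ((⊤ : ℕ∞) + 1) P := by simpa using (inferInstance : IsManifold 𝓘(ℝ, E) ∞ P)
    exact ContDiff.mlieBracket_vectorField (n := ⊤) (m := ⊤) X.contMDiff Y.contMDiff (by simp)⟩

theorem bracket_apply (X Y : SmoothVectorField E P) (u : P) :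
    ⁅X, Y⁆ u = mlieBracket 𝓘(ℝ, E) X Y u := rfl

theorem coe_bracket (X Y : SmoothVectorField E P) :
    ⇑⁅X, Y⁆ = mlieBracket 𝓘(ℝ, E) X Y := rfl

instance : LieRing (SmoothVectorField E P) where
  add_lie X Y Z := by
    ext u
    simp only [bracket_apply, ContMDiffSection.coe_add, Pi.add_apply]
    exact mlieBracket_add_left (X.mdifferentiableAt u) (Y.mdifferentiableAt u)
  lie_add X Y Z := by
    ext u
    simp only [bracket_apply, ContMDiffSection.coe_add, Pi.add_apply]
    exact mlieBracket_add_right (Y.mdifferentiableAt u) (Z.mdifferentiableAt u)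
  lie_self X := by
    ext u
    simp [bracket_apply]
  leibniz_lie X Y Z := by
    ext u
    simp only [bracket_apply, coe_bracket, ContMDiffSection.coe_add, Pi.add_apply]
    have h : minSmoothness ℝ 2 ≤ ∞ := by
      rw [minSmoothness_of_isRCLikeNormedField]; exact ENat.LEInfty.out
    exact leibniz_identity_mlieBracket_apply ((X.contMDiff u).of_le h) ((Y.contMDiff u).of_le h)
      ((Z.contMDiff u).of_le h)

instance : LieAlgebra ℝ (SmoothVectorField E P) where
  lie_smul c X Y := by
    ext u
    simp only [bracket_apply, ContMDiffSection.coe_smul, Pi.smul_apply]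
    exact mlieBracket_const_smul_right (Y.mdifferentiableAt u)


/-- `[X, Y] φ = X (Y φ) - Y (X φ)`. -/
theorem mvfderiv_bracket {φ : P → ℝ} {u : P} (hφ : ContMDiffAt 𝓘(ℝ, E) 𝓘(ℝ, ℝ) ∞ φ u)
    (X Y : SmoothVectorField E P) :
    mvfderiv 𝓘(ℝ, E) φ u (⁅X, Y⁆ u) =
      mvfderiv 𝓘(ℝ, E) (fun y => mvfderiv 𝓘(ℝ, E) φ y (Y y)) u (X u) -
      mvfderiv 𝓘(ℝ, E) (fun y => mvfderiv 𝓘(ℝ, E) φ y (X y)) u (Y u) := by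
  rcases subsingleton_or_nontrivial E with hE | hE
  · have h (v : TangentSpace 𝓘(ℝ, E) u) : v = 0 := Subsingleton.elim (α := E) _ _
    rw [h (⁅X, Y⁆ u), h (X u), h (Y u)]; simp
  obtain ⟨z, hz⟩ := exists_ne (0 : E)
  let Z : ∀ y : P, TangentSpace 𝓘(ℝ, E) y :=
    FiberBundle.extend E (E := (TangentSpace 𝓘(ℝ, E) : P → Type _)) (x := u) z
  have hZ : ContMDiffAt 𝓘(ℝ, E) (𝓘(ℝ, E).prod 𝓘(ℝ, E)) ∞
      (fun y => (Z y : TangentBundle 𝓘(ℝ, E) P)) u :=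
    FiberBundle.contMDiffAt_extend 𝓘(ℝ, E) E (V := (TangentSpace 𝓘(ℝ, E) : P → Type _)) (x := u) z
  have hZu : Z u ≠ 0 := by
    have : Z u = z := FiberBundle.extend_apply_self E _
    rw [this]; exact hz
  have e1 : ∀ᶠ y in nhds u, ContMDiffAt 𝓘(ℝ, E) 𝓘(ℝ, ℝ) 1 φ y :=
    (contMDiffAt_iff_contMDiffAt_nhds (by simp)).1 (hφ.of_le (by simp))
  have e2 : ∀ᶠ y in nhds u, ContMDiffAt 𝓘(ℝ, E) (𝓘(ℝ, E).prod 𝓘(ℝ, E)) 1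
      (fun y => (Z y : TangentBundle 𝓘(ℝ, E) P)) y :=
    (contMDiffAt_iff_contMDiffAt_nhds (by simp)).1 (hZ.of_le (by simp))
  have : IsManifold 𝓘(ℝ, E) ((⊤ : ℕ∞) + 1) P := by
    simpa using (inferInstance : IsManifold 𝓘(ℝ, E) ∞ P)
  have hB (W : SmoothVectorField E P) : MDifferentiableAt 𝓘(ℝ, E) (𝓘(ℝ, E).prod 𝓘(ℝ, E))
      (fun y => (mlieBracket 𝓘(ℝ, E) W Z y : TangentBundle 𝓘(ℝ, E) P)) u :=
    (ContMDiffAt.mlieBracket_vectorField (n := ⊤) (m := ⊤) (W.contMDiff u) hZ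
      (by simp)).mdifferentiableAt (by simp)
  have hφ1 : MDifferentiableAt 𝓘(ℝ, E) 𝓘(ℝ, ℝ) φ u := hφ.mdifferentiableAt (by simp)
  have hZ1 := hZ.mdifferentiableAt (by simp : ∞ ≠ 0)
  have key (V W : SmoothVectorField E P) :
      mlieBracket 𝓘(ℝ, E) V (mlieBracket 𝓘(ℝ, E) W (φ • Z)) u =
        mvfderiv 𝓘(ℝ, E) (fun y => mvfderiv 𝓘(ℝ, E) φ y (W y)) u (V u) • Z u
        + mvfderiv 𝓘(ℝ, E) φ u (W u) • mlieBracket 𝓘(ℝ, E) V Z u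
        + (mvfderiv 𝓘(ℝ, E) φ u (V u) • mlieBracket 𝓘(ℝ, E) W Z u
        + φ u • mlieBracket 𝓘(ℝ, E) V (mlieBracket 𝓘(ℝ, E) W Z) u) := by
    have e : mlieBracket 𝓘(ℝ, E) W (φ • Z) =ᶠ[nhds u]
        ((fun y => mvfderiv 𝓘(ℝ, E) φ y (W y)) • Z + φ • mlieBracket 𝓘(ℝ, E) W Z) := by
      filter_upwards [e1, e2] with y h1 h2
      exact mlieBracket_smul_right (h1.mdifferentiableAt (by simp))
        (h2.mdifferentiableAt (by simp))
    have hd := contMDiffAt_mvfderiv_apply hφ W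
    have e' := Filter.EventuallyEq.mlieBracket_vectorField_eq
      (Filter.EventuallyEq.refl (nhds u) (V : ∀ y : P, TangentSpace 𝓘(ℝ, E) y)) e
    refine e'.trans ?_
    rw [mlieBracket_add_right, mlieBracket_smul_right, mlieBracket_smul_right]
    · exact hφ1
    · exact hB W
    · exact hd.mdifferentiableAt (by simp)
    · exact hZ1
    · exact (hd.smul_section hZ).mdifferentiableAt (by simp)
    · exact MDifferentiableAt.smul_section hφ1 (hB W)
  have h2 : minSmoothness ℝ 2 ≤ ∞ := by
    rw [minSmoothness_of_isRCLikeNormedField]; exact ENat.LEInfty.out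
  have J := leibniz_identity_mlieBracket_apply ((X.contMDiff u).of_le h2)
    ((Y.contMDiff u).of_le h2) (((hφ.smul_section hZ)).of_le h2)
  have J' := leibniz_identity_mlieBracket_apply ((X.contMDiff u).of_le h2)
    ((Y.contMDiff u).of_le h2) (hZ.of_le h2)
  rw [key, key, mlieBracket_smul_right hφ1 hZ1, J'] at J
  rw [bracket_apply]
  rw [eq_sub_iff_add_eq]
  have J2 : (mvfderiv 𝓘(ℝ, E) φ u (mlieBracket 𝓘(ℝ, E) X Y u) +
      mvfderiv 𝓘(ℝ, E) (fun y => mvfderiv 𝓘(ℝ, E) φ y (X y)) u (Y u)) • Z u =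
      mvfderiv 𝓘(ℝ, E) (fun y => mvfderiv 𝓘(ℝ, E) φ y (Y y)) u (X u) • Z u := by
    rw [add_smul]
    rw [smul_add] at J
    generalize mlieBracket 𝓘(ℝ, E) (⇑X) Z u = a1 at J
    generalize mlieBracket 𝓘(ℝ, E) (⇑Y) Z u = a2 at J
    linear_combination (norm := module) (-1 : ℝ) • J
  exact smul_left_injective ℝ hZu J2

end SmoothVectorField

/-- A smooth principal `G`-bundle `proj : P → M`, with right action `act u g = u.g`: the action
preserves the fibres of `proj`, and around every point of `M` there is an equivariant
diffeomorphism `proj ⁻¹ U ≃ U × G` over an open set `U`. -/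
structure SmoothPrincipalBundle (EM EG EP M G P : Type*)
    [NormedAddCommGroup EM] [NormedSpace ℝ EM] [NormedAddCommGroup EG] [NormedSpace ℝ EG]
    [NormedAddCommGroup EP] [NormedSpace ℝ EP]
    [TopologicalSpace M] [ChartedSpace EM M]
    [TopologicalSpace G] [ChartedSpace EG G] [Group G]
    [TopologicalSpace P] [ChartedSpace EP P] where
  proj : P → M
  act : P → G → P
  act_one : ∀ u, act u 1 = u
  act_mul : ∀ u g h, act u (g * h) = act (act u g) h
  proj_act : ∀ u g, proj (act u g) = proj u
  contMDiff_proj : ContMDiff 𝓘(ℝ, EP) 𝓘(ℝ, EM) ∞ proj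
  contMDiff_act : ContMDiff (𝓘(ℝ, EP).prod 𝓘(ℝ, EG)) 𝓘(ℝ, EP) ∞ (fun p : P × G => act p.1 p.2)
  exists_trivialization : ∀ m : M, ∃ (U : Set M) (e : OpenPartialHomeomorph P (M × G)),
    IsOpen U ∧ m ∈ U ∧ e.source = proj ⁻¹' U ∧ e.target = U ×ˢ Set.univ ∧
    ContMDiffOn 𝓘(ℝ, EP) (𝓘(ℝ, EM).prod 𝓘(ℝ, EG)) ∞ e e.source ∧
    ContMDiffOn (𝓘(ℝ, EM).prod 𝓘(ℝ, EG)) 𝓘(ℝ, EP) ∞ e.symm e.target ∧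
    (∀ u ∈ e.source, (e u).1 = proj u) ∧
    ∀ u ∈ e.source, ∀ g, e (act u g) = (proj u, (e u).2 * g)

namespace SmoothPrincipalBundle

set_option linter.unusedSectionVars false

variable {EM EG EP M G P : Type*}
    [NormedAddCommGroup EM] [NormedSpace ℝ EM] [NormedAddCommGroup EG] [NormedSpace ℝ EG]
    [NormedAddCommGroup EP] [NormedSpace ℝ EP]
    [TopologicalSpace M] [ChartedSpace EM M] [IsManifold 𝓘(ℝ, EM) ∞ M]
    [TopologicalSpace G] [ChartedSpace EG G] [Group G]
    [TopologicalSpace P] [ChartedSpace EP P] [IsManifold 𝓘(ℝ, EP) ∞ P]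
    (B : SmoothPrincipalBundle EM EG EP M G P)

/-- The right translation `r_g : u ↦ u.g`. -/
def rightTranslation (g : G) (u : P) : P := B.act u g

theorem contMDiff_rightTranslation (g : G) :
    ContMDiff 𝓘(ℝ, EP) 𝓘(ℝ, EP) ∞ (B.rightTranslation g) :=
  B.contMDiff_act.comp (contMDiff_id.prodMk contMDiff_const)

theorem mdifferentiableAt_rightTranslation (g : G) (u : P) :
    MDifferentiableAt 𝓘(ℝ, EP) 𝓘(ℝ, EP) (B.rightTranslation g) u :=
  (B.contMDiff_rightTranslation g u).mdifferentiableAt (by simp)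

theorem rightTranslation_comp_inv (g : G) :
    B.rightTranslation g ∘ B.rightTranslation g⁻¹ = id := by
  ext u; simp [rightTranslation, ← B.act_mul, B.act_one]

theorem rightTranslation_inv_comp (g : G) :
    B.rightTranslation g⁻¹ ∘ B.rightTranslation g = id := by
  ext u; simp [rightTranslation, ← B.act_mul, B.act_one]

/-- The vector field `X` on `P` is `G`-invariant: `T_u r_g (X_u) = X_{u.g}`. -/
def IsInvariant (X : SmoothVectorField EP P) : Prop :=
  ∀ (g : G) (u : P),
    mfderiv 𝓘(ℝ, EP) 𝓘(ℝ, EP) (B.rightTranslation g) u (X u) = X (B.rightTranslation g u)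

theorem isInvertible_mfderiv_rightTranslation (g : G) (u : P) :
    (mfderiv 𝓘(ℝ, EP) 𝓘(ℝ, EP) (B.rightTranslation g) u).IsInvertible := by
  let Φ : Diffeomorph 𝓘(ℝ, EP) 𝓘(ℝ, EP) P P ∞ :=
    { toFun := B.rightTranslation g
      invFun := B.rightTranslation g⁻¹
      left_inv := congrFun (B.rightTranslation_inv_comp g)
      right_inv := congrFun (B.rightTranslation_comp_inv g)
      contMDiff_toFun := B.contMDiff_rightTranslation g
      contMDiff_invFun := B.contMDiff_rightTranslation g⁻¹ }
  exact ⟨Φ.mfderivToContinuousLinearEquiv (by simp) u, rfl⟩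

theorem mpullback_eq_of_isInvariant {X : SmoothVectorField EP P} (hX : B.IsInvariant X) (g : G) :
    mpullback 𝓘(ℝ, EP) 𝓘(ℝ, EP) (B.rightTranslation g) X = X := by
  ext u
  rw [mpullback_apply, ← hX g u]
  exact (B.isInvertible_mfderiv_rightTranslation g u).inverse_apply_self _

theorem mdifferentiableAt_proj (u : P) : MDifferentiableAt 𝓘(ℝ, EP) 𝓘(ℝ, EM) B.proj u :=
  (B.contMDiff_proj u).mdifferentiableAt (by simp)

/-- The derivative of a function `ψ ∘ proj` along an invariant vector field is constant along
the fibres. -/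
theorem mvfderiv_comp_proj_act {X : SmoothVectorField EP P} (hX : B.IsInvariant X) {ψ : M → ℝ}
    (w : P) (g : G) (hψ : MDifferentiableAt 𝓘(ℝ, EM) 𝓘(ℝ, ℝ) ψ (B.proj w)) :
    mvfderiv 𝓘(ℝ, EP) (ψ ∘ B.proj) (B.act w g) (X (B.act w g)) =
      mvfderiv 𝓘(ℝ, EP) (ψ ∘ B.proj) w (X w) := by
  have hc : (ψ ∘ B.proj) ∘ B.rightTranslation g = ψ ∘ B.proj := by
    ext y; simp [rightTranslation, B.proj_act]
  have hd : MDifferentiableAt 𝓘(ℝ, EP) 𝓘(ℝ, ℝ) (ψ ∘ B.proj) (B.rightTranslation g w) := by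
    refine MDifferentiableAt.comp _ ?_ (B.mdifferentiableAt_proj _)
    rwa [show B.proj (B.rightTranslation g w) = B.proj w from B.proj_act w g]
  have h := mvfderiv_comp w hd (B.mdifferentiableAt_rightTranslation g w)
  rw [hc] at h
  rw [h, ContinuousLinearMap.comp_apply, hX g w]
  rfl

/-- For `X` invariant, the derivative of `X (ψ ∘ proj)` along a vertical vector vanishes. -/
theorem mvfderiv_mvfderiv_comp_proj {X : SmoothVectorField EP P} (hX : B.IsInvariant X)
    {ψ : M → ℝ} (u : P) (hψ : ContMDiffAt 𝓘(ℝ, EM) 𝓘(ℝ, ℝ) ∞ ψ (B.proj u))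
    (v : TangentSpace 𝓘(ℝ, EP) u) (hv : mfderiv 𝓘(ℝ, EP) 𝓘(ℝ, EM) B.proj u v = 0) :
    mvfderiv 𝓘(ℝ, EP) (fun y => mvfderiv 𝓘(ℝ, EP) (ψ ∘ B.proj) y (X y)) u v = 0 := by
  obtain ⟨U, e, hU, hmU, hs, ht, -, hes, he1, he2⟩ := B.exists_trivialization (B.proj u)
  let h : P → ℝ := fun y => mvfderiv 𝓘(ℝ, EP) (ψ ∘ B.proj) y (X y)
  let σ : M → P := fun x => e.symm (x, (e u).2)
  have hus : u ∈ e.source := by rw [hs]; exact hmU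
  have hσu : σ (B.proj u) = u := by
    have : (B.proj u, (e u).2) = e u := Prod.ext (he1 u hus).symm rfl
    simp only [σ, this]
    exact e.left_inv hus
  have hh : MDifferentiableAt 𝓘(ℝ, EP) 𝓘(ℝ, ℝ) h u :=
    (SmoothVectorField.contMDiffAt_mvfderiv_apply
      (ContMDiffAt.comp u hψ (B.contMDiff_proj u)) X).mdifferentiableAt (by simp)
  have hσ : MDifferentiableAt 𝓘(ℝ, EM) 𝓘(ℝ, EP) σ (B.proj u) := by
    have hmem : (B.proj u, (e u).2) ∈ e.target := by rw [ht]; exact ⟨hmU, trivial⟩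
    have h1 := hes.contMDiffAt (e.open_target.mem_nhds hmem)
    have h2 : ContMDiffAt 𝓘(ℝ, EM) (𝓘(ℝ, EM).prod 𝓘(ℝ, EG)) ∞
        (fun x : M => (x, (e u).2)) (B.proj u) := contMDiffAt_id.prodMk contMDiffAt_const
    exact (ContMDiffAt.comp (B.proj u) h1 h2).mdifferentiableAt (by simp)
  have hψn : ∀ᶠ y in nhds u, MDifferentiableAt 𝓘(ℝ, EM) 𝓘(ℝ, ℝ) ψ (B.proj y) := by
    have h1 : ∀ᶠ x in nhds (B.proj u), ContMDiffAt 𝓘(ℝ, EM) 𝓘(ℝ, ℝ) 1 ψ x :=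
      (contMDiffAt_iff_contMDiffAt_nhds (by simp)).1 (hψ.of_le (by simp))
    filter_upwards [B.contMDiff_proj.continuous.continuousAt.eventually h1] with y hy
    exact hy.mdifferentiableAt (by simp)
  have heq : h =ᶠ[nhds u] (h ∘ σ) ∘ B.proj := by
    filter_upwards [hψn, e.open_source.mem_nhds hus] with y hy hys
    have hyU : B.proj y ∈ U := by rw [hs] at hys; exact hys
    have hmem : (B.proj y, (e u).2) ∈ e.target := by rw [ht]; exact ⟨hyU, trivial⟩
    have hws : σ (B.proj y) ∈ e.source := e.map_target hmem
    have hew : e (σ (B.proj y)) = (B.proj y, (e u).2) := e.right_inv hmem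
    have hpw : B.proj (σ (B.proj y)) = B.proj y := by rw [← he1 _ hws, hew]
    have hact : B.act (σ (B.proj y)) ((e u).2⁻¹ * (e y).2) = y := by
      refine e.injOn ?_ hys ?_
      · rw [hs, Set.mem_preimage, B.proj_act, hpw]; exact hyU
      · rw [he2 _ hws, hew, hpw]
        exact Prod.ext (he1 y hys).symm (by simp)
    have := B.mvfderiv_comp_proj_act hX (ψ := ψ) (σ (B.proj y)) ((e u).2⁻¹ * (e y).2)
      (by rw [hpw]; exact hy)
    rw [hact] at this
    exact this
  have hd : mfderiv 𝓘(ℝ, EP) 𝓘(ℝ, ℝ) h u = mfderiv 𝓘(ℝ, EP) 𝓘(ℝ, ℝ) ((h ∘ σ) ∘ B.proj) u :=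
    heq.mfderiv_eq
  have hhσ : MDifferentiableAt 𝓘(ℝ, EM) 𝓘(ℝ, ℝ) (h ∘ σ) (B.proj u) :=
    MDifferentiableAt.comp _ (by rw [hσu]; exact hh) hσ
  have hc := mfderiv_comp (I := 𝓘(ℝ, EP)) (I' := 𝓘(ℝ, EM)) (I'' := 𝓘(ℝ, ℝ)) u hhσ
    (B.mdifferentiableAt_proj u)
  have : mfderiv 𝓘(ℝ, EP) 𝓘(ℝ, ℝ) h u v = 0 := by
    have h5 : mfderiv 𝓘(ℝ, EM) 𝓘(ℝ, ℝ) (h ∘ σ) (B.proj u)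
        (mfderiv 𝓘(ℝ, EP) 𝓘(ℝ, EM) B.proj u v) = 0 := by rw [hv, map_zero]
    exact (congrArg (fun L : EP →L[ℝ] ℝ => L v) (hd.trans hc)).trans h5
  exact this

/-- A tangent vector of `P` is vertical as soon as it kills all functions `ψ ∘ proj`. -/
theorem mfderiv_proj_eq_zero (u : P) (v : TangentSpace 𝓘(ℝ, EP) u)
    (h : ∀ ψ : M → ℝ, ContMDiffAt 𝓘(ℝ, EM) 𝓘(ℝ, ℝ) ∞ ψ (B.proj u) →
      mvfderiv 𝓘(ℝ, EP) (ψ ∘ B.proj) u v = 0) :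
    mfderiv 𝓘(ℝ, EP) 𝓘(ℝ, EM) B.proj u v = 0 := by
  have hchart : ContMDiffAt 𝓘(ℝ, EM) 𝓘(ℝ, EM) ∞ (extChartAt 𝓘(ℝ, EM) (B.proj u)) (B.proj u) :=
    contMDiffAt_extChartAt
  have hinv := isInvertible_mfderiv_extChartAt (I := 𝓘(ℝ, EM))
    (mem_extChartAt_source (I := 𝓘(ℝ, EM)) (B.proj u))
  apply hinv.injective
  rw [map_zero]
  refine SeparatingDual.eq_zero_of_forall_dual_eq_zero (R := ℝ) (V := EM) fun ℓ => ?_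
  have hψ : ContMDiffAt 𝓘(ℝ, EM) 𝓘(ℝ, ℝ) ∞ (ℓ ∘ extChartAt 𝓘(ℝ, EM) (B.proj u)) (B.proj u) :=
    ContMDiffAt.comp _ ℓ.contMDiff.contMDiffAt hchart
  have h1 := h _ hψ
  have h2 := mfderiv_comp (I := 𝓘(ℝ, EP)) (I' := 𝓘(ℝ, EM)) (I'' := 𝓘(ℝ, ℝ)) u
    (hψ.mdifferentiableAt (by simp)) (B.mdifferentiableAt_proj u)
  have h3 := mfderiv_comp (I := 𝓘(ℝ, EM)) (I' := 𝓘(ℝ, EM)) (I'' := 𝓘(ℝ, ℝ)) (B.proj u)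
    (ℓ.contMDiff.contMDiffAt.mdifferentiableAt (by simp : (∞ : WithTop ℕ∞) ≠ 0))
    (hchart.mdifferentiableAt (by simp))
  have h4 : mfderiv 𝓘(ℝ, EP) 𝓘(ℝ, ℝ) ((ℓ ∘ extChartAt 𝓘(ℝ, EM) (B.proj u)) ∘ B.proj) u v = 0 := h1
  rw [h2, h3] at h4
  simp only [mfderiv_eq_fderiv, ContinuousLinearMap.fderiv] at h4
  exact h4

variable [CompleteSpace EP]

theorem isInvariant_bracket {X Y : SmoothVectorField EP P} (hX : B.IsInvariant X)
    (hY : B.IsInvariant Y) : B.IsInvariant ⁅X, Y⁆ := by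
  intro g u
  have h := mpullback_mlieBracket (I := 𝓘(ℝ, EP)) (I' := 𝓘(ℝ, EP)) (n := ∞) (x₀ := u)
    (X.mdifferentiableAt (B.rightTranslation g u)) (Y.mdifferentiableAt (B.rightTranslation g u))
    (B.contMDiff_rightTranslation g u) (by
      rw [minSmoothness_of_isRCLikeNormedField]; exact ENat.LEInfty.out)
  rw [B.mpullback_eq_of_isInvariant hX, B.mpullback_eq_of_isInvariant hY, mpullback_apply] at h
  rw [SmoothVectorField.bracket_apply, SmoothVectorField.bracket_apply, ← h]
  exact (B.isInvertible_mfderiv_rightTranslation g u).self_apply_inverse _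

/-- The Lie algebra `𝒜` of smooth sections of the Atiyah algebroid `A = TP/G`, i.e. of smooth
`G`-invariant vector fields on `P`, with the bracket of vector fields. -/
def atiyahAlgebra : LieSubalgebra ℝ (SmoothVectorField EP P) where
  carrier := {X | B.IsInvariant X}
  zero_mem' := fun g u => by simp
  add_mem' := fun {X Y} hX hY g u => by
    simp only [ContMDiffSection.coe_add, Pi.add_apply]
    rw [← hX g u, ← hY g u]; exact map_add _ _ _
  smul_mem' := fun c X hX g u => by
    simp only [ContMDiffSection.coe_smul, Pi.smul_apply]
    rw [← hX g u]; exact map_smul _ _ _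
  lie_mem' := fun hX hY => B.isInvariant_bracket hX hY

/-- The bracket of two invariant vector fields that are vertical at `u` is vertical at `u`. -/
theorem mfderiv_proj_bracket {X Y : SmoothVectorField EP P} (hX : B.IsInvariant X)
    (hY : B.IsInvariant Y) (u : P) (hXu : mfderiv 𝓘(ℝ, EP) 𝓘(ℝ, EM) B.proj u (X u) = 0)
    (hYu : mfderiv 𝓘(ℝ, EP) 𝓘(ℝ, EM) B.proj u (Y u) = 0) :
    mfderiv 𝓘(ℝ, EP) 𝓘(ℝ, EM) B.proj u (⁅X, Y⁆ u) = 0 := by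
  refine B.mfderiv_proj_eq_zero u _ fun ψ hψ => ?_
  rw [SmoothVectorField.mvfderiv_bracket (ContMDiffAt.comp u hψ (B.contMDiff_proj u)),
    B.mvfderiv_mvfderiv_comp_proj hY u hψ _ hXu, B.mvfderiv_mvfderiv_comp_proj hX u hψ _ hYu,
    sub_zero]

/-- The bracket of an invariant vector field with a vertical one is vertical. -/
theorem mfderiv_proj_bracket_of_vertical {X Y : SmoothVectorField EP P} (hX : B.IsInvariant X)
    (hY : ∀ u, mfderiv 𝓘(ℝ, EP) 𝓘(ℝ, EM) B.proj u (Y u) = 0) (u : P) :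
    mfderiv 𝓘(ℝ, EP) 𝓘(ℝ, EM) B.proj u (⁅X, Y⁆ u) = 0 := by
  refine B.mfderiv_proj_eq_zero u _ fun ψ hψ => ?_
  have h0 : (fun y => mvfderiv 𝓘(ℝ, EP) (ψ ∘ B.proj) y (Y y)) =ᶠ[nhds u] fun _ => (0 : ℝ) := by
    have h1 : ∀ᶠ x in nhds (B.proj u), ContMDiffAt 𝓘(ℝ, EM) 𝓘(ℝ, ℝ) 1 ψ x :=
      (contMDiffAt_iff_contMDiffAt_nhds (by simp)).1 (hψ.of_le (by simp))
    filter_upwards [B.contMDiff_proj.continuous.continuousAt.eventually h1] with y hy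
    rw [mvfderiv_comp y (hy.mdifferentiableAt (by simp)) (B.mdifferentiableAt_proj y),
      ContinuousLinearMap.comp_apply, hY y, map_zero]
  have h2 : mvfderiv 𝓘(ℝ, EP) (fun y => mvfderiv 𝓘(ℝ, EP) (ψ ∘ B.proj) y (Y y)) u (X u) = 0 := by
    have : mfderiv 𝓘(ℝ, EP) 𝓘(ℝ, ℝ) (fun y => mvfderiv 𝓘(ℝ, EP) (ψ ∘ B.proj) y (Y y)) u (X u)
        = 0 := by
      rw [h0.mfderiv_eq, mfderiv_const]; rfl
    exact this
  rw [SmoothVectorField.mvfderiv_bracket (ContMDiffAt.comp u hψ (B.contMDiff_proj u)),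
    B.mvfderiv_mvfderiv_comp_proj hX u hψ _ (hY u), sub_zero]
  exact h2

/-- The fibre `A_m` of the Atiyah algebroid `A = TP/G`: an equivalence class of tangent vectors
under `X_u ∼ T_u r_g (X_u)`, `proj u = m`, contains exactly one vector at each point of
`proj ⁻¹ m`, so that it is an equivariant family of vectors along `proj ⁻¹ m`. -/
def fiber (m : M) : Submodule ℝ (∀ u : {u : P // B.proj u = m}, TangentSpace 𝓘(ℝ, EP) u.1) where
  carrier := {X | ∀ (g : G) (u : {u : P // B.proj u = m}),
    mfderiv 𝓘(ℝ, EP) 𝓘(ℝ, EP) (B.rightTranslation g) u.1 (X u) =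
      X ⟨B.rightTranslation g u.1, (B.proj_act u.1 g).trans u.2⟩}
  zero_mem' := fun g u => by simp
  add_mem' := fun {X Y} hX hY g u => by
    simp only [Pi.add_apply]
    rw [← hX g u, ← hY g u]; exact map_add _ _ _
  smul_mem' := fun c X hX g u => by
    simp only [Pi.smul_apply]
    rw [← hX g u]; exact map_smul _ _ _

/-- The value `a_m ∈ A_m` at `m` of a section `a ∈ 𝒜`. -/
def value (m : M) : B.atiyahAlgebra →ₗ[ℝ] B.fiber m where
  toFun a := ⟨fun u => a.1 u.1, fun g u => a.2 g u.1⟩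
  map_add' _ _ := rfl
  map_smul' _ _ := rfl

/-- The fibre `K_m` of the kernel `K = P ×_G 𝔤` of the anchor `A → TM`, `[X_u] ↦ T_u proj (X_u)`. -/
def kernelFiber (m : M) : Submodule ℝ (B.fiber m) where
  carrier := {X | ∀ u : {u : P // B.proj u = m},
    mfderiv 𝓘(ℝ, EP) 𝓘(ℝ, EM) B.proj u.1 (X.1 u) = 0}
  zero_mem' := fun u => map_zero _
  add_mem' := fun {X Y} hX hY u => by
    refine (map_add _ (X.1 u) (Y.1 u)).trans ?_
    rw [hX u, hY u, add_zero]
  smul_mem' := fun c X hX u => by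
    refine (map_smul _ c (X.1 u)).trans ?_
    rw [hX u, smul_zero]

/-- The Lie ideal `𝒦 = Γ(K)` of `𝒜`: the sections with values in the kernel of the anchor. -/
def kernel : LieIdeal ℝ B.atiyahAlgebra where
  carrier := {a | ∀ m, B.value m a ∈ B.kernelFiber m}
  zero_mem' := fun m => by rw [map_zero]; exact zero_mem _
  add_mem' := fun ha hb m => by rw [map_add]; exact add_mem (ha m) (hb m)
  smul_mem' := fun c a ha m => by rw [map_smul]; exact Submodule.smul_mem _ c (ha m)
  lie_mem := fun {a b} hb m u =>
    B.mfderiv_proj_bracket_of_vertical a.2 (fun w => hb (B.proj w) ⟨w, rfl⟩) u.1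

/-- The Lie subalgebra `𝒜(m) = {a ∈ 𝒜 : a_m = 0}`. -/
def vanishingAt (m : M) : LieSubalgebra ℝ B.atiyahAlgebra where
  carrier := {a | B.value m a = 0}
  zero_mem' := map_zero _
  add_mem' := fun {a b} (ha : B.value m a = 0) (hb : B.value m b = 0) => by
    change B.value m (a + b) = 0
    rw [map_add, ha, hb, add_zero]
  smul_mem' := fun c a (ha : B.value m a = 0) => by
    change B.value m (c • a) = 0
    rw [map_smul, ha, smul_zero]
  lie_mem' := fun {a b} ha hb => by
    refine Subtype.ext (funext fun u => ?_)
    have hau : a.1 u.1 = 0 := congrFun (congrArg Subtype.val ha) u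
    have hbu : b.1 u.1 = 0 := congrFun (congrArg Subtype.val hb) u
    change mlieBracket 𝓘(ℝ, EP) a.1 b.1 u.1 = 0
    rw [← mlieBracketWithin_univ]
    exact mlieBracketWithin_eq_zero_of_eq_zero hau hbu

/-- The Lie subalgebra `𝒜_m = {a ∈ 𝒜 : â_m = 0}` of the sections whose anchor `â` vanishes
at `m`. -/
def anchorVanishingAt (m : M) : LieSubalgebra ℝ B.atiyahAlgebra where
  carrier := {a | B.value m a ∈ B.kernelFiber m}
  zero_mem' := by
    change B.value m 0 ∈ B.kernelFiber m
    rw [map_zero]; exact zero_mem _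
  add_mem' := fun {a b} ha hb => by
    change B.value m (a + b) ∈ B.kernelFiber m
    rw [map_add]; exact add_mem ha hb
  smul_mem' := fun c a ha => by
    change B.value m (c • a) ∈ B.kernelFiber m
    rw [map_smul]; exact Submodule.smul_mem _ c ha
  lie_mem' := fun {a b} ha hb u => B.mfderiv_proj_bracket a.2 b.2 u.1 (ha u) (hb u)

/-- The space `𝒦(m) = {k ∈ 𝒦 : k_m = 0}`. -/
def kernelVanishingAt (m : M) : Submodule ℝ B.kernel :=
  LinearMap.ker (B.value m ∘ₗ B.kernel.toSubmodule.subtype)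

end SmoothPrincipalBundle

section LieAlgebraic

variable {L : Type*} [LieRing L] [LieAlgebra ℝ L]

/-- `T` is a maximal finite-codimensional Lie subalgebra: it is maximal among the proper Lie
subalgebras of finite codimension. -/
def IsMaximalFiniteCodimSubalgebra (T : LieSubalgebra ℝ L) : Prop :=
  Maximal (fun S : LieSubalgebra ℝ L => S ≠ ⊤ ∧ FiniteDimensional ℝ (L ⧸ S.toSubmodule)) T

/-- `J` is a maximal finite-codimensional Lie ideal: it is maximal among the proper Lie ideals of
finite codimension. -/
def IsMaximalFiniteCodimIdeal (J : LieIdeal ℝ L) : Prop :=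
  Maximal (fun S : LieIdeal ℝ L => S ≠ ⊤ ∧ FiniteDimensional ℝ (L ⧸ S.toSubmodule)) J

/-- For a Lie ideal `K` of `L`: the bracket `[S, K]` is included in the subspace `W` of `K`. -/
def BracketIncluded {K : LieIdeal ℝ L} (S : LieSubalgebra ℝ L) (W : Submodule ℝ K) : Prop :=
  ∀ a ∈ S, ∀ k : K, ⁅a, k⁆ ∈ W

/-- For a Lie ideal `K` of `L`: the Lie ideal `J` of `K` is normalized by the Lie subalgebra `T`
of `L`, i.e. `[T, J] ⊆ J`. -/
def IsNormalizedBy {K : LieIdeal ℝ L} (J : LieIdeal ℝ K) (T : LieSubalgebra ℝ L) : Prop :=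
  ∀ a ∈ T, ∀ k ∈ J, ⁅a, k⁆ ∈ J

/-- For a Lie ideal `K` of `L`: the intersection of all maximal finite-codimensional Lie ideals of
`K` that are normalized by the Lie subalgebra `T` of `L`. -/
def normalizedIntersection (K : LieIdeal ℝ L) (T : LieSubalgebra ℝ L) : Submodule ℝ K :=
  (sInf {J : LieIdeal ℝ K | IsMaximalFiniteCodimIdeal J ∧ IsNormalizedBy J T}).toSubmodule

end LieAlgebraic

end

/-! Write C for the ring of smooth functions on M. The sections of A form a Lie-Rinehart algebra
over C: [a, f b] = f [a, b] + (â f) b. On the kernel 𝒦 the bracket is C-linear, and 𝒜 acts on 𝒦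
C-linearly in the acting element. Three facts carry the proof.

Brackets detect values (`bracketIncluded_kernelVanishingAt_iff`): [a, 𝒦] ⊆ 𝒦(m) exactly when a_m =
0. Bracketing with f k, where k_m ≠ 0, forces the anchor of a to vanish at m; then a_m lies in K_m ≅
𝔤 and is central, hence zero by semisimplicity.

Subalgebras (`isMaximalFiniteCodimSubalgebra_iff`): the maximal finite-codimensional subalgebras are
the 𝒜_m. If T has finite codimension, so does the ideal of all f with f 𝒜 ⊆ T, and this ideal is
stable under the anchors of elements of T. An ideal of finite codimension contains p(h) for some
nonzero polynomial p, and repeated differentiation turns this into a power of â h. So if T lies in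
no 𝒜_m, the ideal has no common zero. An ideal of finite codimension without common zero is all of
C, and T = 𝒜.

Ideals (`normalizedIntersection_anchorVanishingAt`): 𝒦^{𝒜_m} = 𝒦(m). For a maximal ideal J
normalized by 𝒜_m, the same mechanism shows that the functions f with f 𝒦 ⊆ J contain a power of the
ideal 𝔪 of functions vanishing at m. As 𝔤 is perfect, a squaring argument lowers this power to one,
so J contains 𝔪 𝒦 = 𝒦(m). Conversely, evaluation at m maps 𝒦 onto 𝔤, and the maximal ideals of a
semisimple algebra intersect in zero; their preimages are normalized by 𝒜_m, which acts on K_m by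
inner derivations.

Hence the classes of subalgebras in the first two claims both consist of the S contained in some
𝒜(m). Distinct 𝒜(m) are incomparable, because a section may vanish at one point and have nonzero
anchor at another; so these are exactly the maximal elements, and m is determined. -/

noncomputable section

/-! ### Ideals and subalgebras of finite codimension in Lie-Rinehart algebras. -/

section FiniteCodimension

open Submodule

theorem Submodule.CoFG.comap {k V W : Type*} [Field k] [AddCommGroup V] [Module k V]
    [AddCommGroup W] [Module k W] {J : Submodule k W} (hJ : J.CoFG) (f : V →ₗ[k] W) :
    (J.comap f).CoFG := by
  have : J.comap f = LinearMap.ker (J.mkQ ∘ₗ f) := by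
    rw [LinearMap.ker_comp, Submodule.ker_mkQ]
  rw [this]
  exact Submodule.CoFG.ker _

/-- If a subspace `S` of finite codimension acts on `V` preserving a subspace `J` of finite
codimension, then the elements of `S` that send `V` to `J` form a subspace of finite
codimension. -/
theorem Submodule.CoFG.of_forall_apply_mem {k L V : Type*} [Field k] [AddCommGroup L] [Module k L]
    [AddCommGroup V] [Module k V] (ρ : L →ₗ[k] Module.End k V) {S : Submodule k L}
    {J : Submodule k V} (hS : S.CoFG) (hJ : J.CoFG) (h : ∀ a ∈ S, ∀ x ∈ J, ρ a x ∈ J)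
    {N : Submodule k L} (hN : ∀ a ∈ S, (∀ x, ρ a x ∈ J) → a ∈ N) : N.CoFG := by
  obtain ⟨s, hs⟩ := Module.finite_def.1 hJ
  -- An element of `S` preserves `J`, so it sends `V` to `J` as soon as it does so on
  -- representatives of a finite spanning set of `V ⧸ J`: finitely many conditions of finite
  -- codimension.
  let N' : Submodule k L := S ⊓ ⨅ y ∈ s, J.comap (ρ.flip (Quotient.out y))
  have hN' : N'.CoFG := by
    refine CoFG.inf hS ?_
    clear hs
    classical
    induction s using Finset.induction with
    | empty => simp
    | insert y s _ ih =>
      rw [Finset.iInf_insert]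
      exact CoFG.inf (hJ.comap _) ih
  refine CoFG.of_le (fun a ha => ?_) hN'
  refine hN a ha.1 fun x => ?_
  have hle : J ≤ J.comap (ρ a) := h a ha.1
  have hmap : (J.comap (ρ a)).map J.mkQ = ⊤ := by
    rw [eq_top_iff, ← hs, Submodule.span_le]
    intro y hy
    refine ⟨Quotient.out y, ?_, ?_⟩
    · have := (Submodule.mem_iInf _).1 ((Submodule.mem_iInf _).1 ha.2 y) hy
      exact this
    · exact Quotient.out_eq y
  have htop : J.comap (ρ a) = ⊤ := by
    have := congrArg (Submodule.comap J.mkQ) hmap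
    rwa [Submodule.comap_map_mkQ, Submodule.comap_top, sup_eq_right.2 hle] at this
  have : x ∈ J.comap (ρ a) := by rw [htop]; trivial
  exact this

variable {C : Type*} [CommRing C] [Algebra ℝ C]

/-- An ideal of finite codimension contains a nonzero polynomial in any given element. -/
theorem Ideal.exists_aeval_mem_of_cofg {I : Ideal C} (hI : (I.restrictScalars ℝ).CoFG) (h : C) :
    ∃ p : Polynomial ℝ, p ≠ 0 ∧ Polynomial.aeval h p ∈ I := by
  have hc := CoFG.comap hI (Polynomial.aeval (R := ℝ) h).toLinearMap
  by_contra! H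
  have hbot : (I.restrictScalars ℝ).comap (Polynomial.aeval (R := ℝ) h).toLinearMap = ⊥ := by
    rw [eq_bot_iff]
    intro p hp
    by_contra hp0
    exact H p hp0 hp
  rw [hbot] at hc
  exact Polynomial.not_finite ((Module.Finite.iff_cofg_bot ℝ _).1 hc)

/-- If an ideal of finite codimension is stable under a derivation `δ`, it contains a power of
`δ h` for every `h`. -/
theorem Ideal.exists_pow_derivation_mem {I : Ideal C} (hI : (I.restrictScalars ℝ).CoFG)
    (δ : Derivation ℝ C C) (hδ : ∀ f ∈ I, δ f ∈ I) (h : C) : ∃ n : ℕ, δ h ^ n ∈ I := by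
  obtain ⟨p, hp0, hp⟩ := I.exists_aeval_mem_of_cofg hI h
  suffices H : ∀ (d : ℕ) (p : Polynomial ℝ), p ≠ 0 → p.natDegree = d → ∀ n : ℕ,
      Polynomial.aeval h p * δ h ^ n ∈ I → ∃ n : ℕ, δ h ^ n ∈ I from
    H _ p hp0 rfl 0 (by simpa using hp)
  intro d
  induction d with
  | zero =>
    intro p hp0 hd n hn
    rw [Polynomial.eq_C_of_natDegree_eq_zero hd] at hn hp0
    have hc : p.coeff 0 ≠ 0 := fun hc => hp0 (by rw [hc, map_zero])
    refine ⟨n, ?_⟩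
    have := I.mul_mem_left (algebraMap ℝ C (p.coeff 0)⁻¹) hn
    rwa [Polynomial.aeval_C, ← mul_assoc, ← map_mul, inv_mul_cancel₀ hc, map_one, one_mul] at this
  | succ d ih =>
    intro p hp0 hd n hn
    have hd' : p.derivative.natDegree = d := by
      rw [Polynomial.natDegree_derivative, hd, Nat.add_sub_cancel]
    have hp' : p.derivative ≠ 0 := fun h0 => by
      have := Polynomial.derivative_eq_zero.1 h0
      omega
    -- Differentiating p(h) (δh)^n gives p'(h) (δh)^(n+1) plus a term with (δh)^(n-1) δ²h. One
    -- further factor δh makes the latter a multiple of p(h) (δh)^n, which is in `I`; hence the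
    -- exponent rises by two while the degree of p drops by one.
    refine ih _ hp' hd' (n + 2) ?_
    have h1 := I.mul_mem_right (δ h) (hδ _ hn)
    have h2 := I.mul_mem_left (n * δ (δ h)) hn
    have e : δ (Polynomial.aeval h p * δ h ^ n) * δ h =
        Polynomial.aeval h (Polynomial.derivative p) * δ h ^ (n + 2) +
          n * δ (δ h) * (Polynomial.aeval h p * δ h ^ n) := by
      rw [Derivation.leibniz, Derivation.leibniz_pow, Derivation.map_aeval]
      rcases n with - | n
      · simp; ring
      · simp [pow_succ]; ring
    rw [e] at h1
    exact (Ideal.add_mem_iff_left I h2).1 h1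

variable (C) in
/-- The ideal of all `f` with `f • V ⊆ W`. -/
def conductorIdeal {V : Type*} [AddCommGroup V] [Module ℝ V] [Module C V] (W : Submodule ℝ V) :
    Ideal C where
  carrier := {f | ∀ v : V, f • v ∈ W}
  zero_mem' := fun v => by simp
  add_mem' := fun hf hg v => by rw [add_smul]; exact W.add_mem (hf v) (hg v)
  smul_mem' := fun g f hf v => by
    rw [smul_eq_mul, mul_comm, mul_smul]; exact hf _

variable {L : Type*} [LieRing L] [LieAlgebra ℝ L] [Module C L] [IsScalarTower ℝ C L]

theorem Submodule.CoFG.setOf_smul_mem {N : Submodule ℝ L} (hN : N.CoFG) (a : L) (h : C) :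
    (N.comap ((LinearMap.toSpanSingleton C L a).restrictScalars ℝ) ⊓
      N.comap ((LinearMap.toSpanSingleton C L (h • a)).restrictScalars ℝ)).CoFG :=
  (hN.comap _).inf (hN.comap _)

/-- The premises on f are finitely many linear conditions of finite codimension. An f satisfying all
of them has f ∑ wᵢ² in `I`, and the sum of squares is invertible. -/
theorem Ideal.cofg_of_forall_mul_sq_mem {ι : Type*} [Fintype ι] {N : Submodule ℝ L}
    (hN : N.CoFG) {I : Ideal C} (a : ι → L) (h w : ι → C) (hw : IsUnit (∑ i, w i ^ 2))
    (H : ∀ i f, f • a i ∈ N → (f * h i) • a i ∈ N → f * w i ^ 2 ∈ I) :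
    (I.restrictScalars ℝ).CoFG := by
  have : ∀ s : Finset ι, (⨅ i ∈ s,
      (N.comap ((LinearMap.toSpanSingleton C L (a i)).restrictScalars ℝ) ⊓
      N.comap ((LinearMap.toSpanSingleton C L (h i • a i)).restrictScalars ℝ))).CoFG := by
    classical
    intro s
    induction s using Finset.induction with
    | empty => simp
    | insert y s _ ih =>
      rw [Finset.iInf_insert]
      exact CoFG.inf (CoFG.setOf_smul_mem hN _ _) ih
  refine CoFG.of_le (fun f hf => ?_) (this Finset.univ)
  have hf' : ∀ i, f * w i ^ 2 ∈ I := fun i => by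
    have h1 := (Submodule.mem_iInf _).1 ((Submodule.mem_iInf _).1 hf i) (Finset.mem_univ i)
    refine H i f h1.1 ?_
    have h2 : f • h i • a i ∈ N := h1.2
    rwa [smul_smul] at h2
  have hs : f * ∑ i, w i ^ 2 ∈ I := by
    rw [Finset.mul_sum]; exact I.sum_mem fun i _ => hf' i
  exact (Ideal.mul_unit_mem_iff_mem I hw).1 hs

variable {D : L →ₗ[C] Derivation ℝ C C}

set_option linter.unusedSectionVars false

theorem smul_lie_of_leibniz (hD : ∀ (a : L) (f : C) (b : L), ⁅a, f • b⁆ = f • ⁅a, b⁆ + D a f • b)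
    (f : C) (a b : L) : ⁅f • a, b⁆ = f • ⁅a, b⁆ - D b f • a := by
  rw [← lie_skew, hD, ← lie_skew a b, smul_neg, neg_add, sub_eq_add_neg]

/-- A finite-codimensional Lie subalgebra `T` of a Lie-Rinehart algebra `L` contains `I • L` for an
ideal `I` of finite codimension. -/
theorem cofg_conductorIdeal_subalgebra
    (hD : ∀ (a : L) (f : C) (b : L), ⁅a, f • b⁆ = f • ⁅a, b⁆ + D a f • b)
    {ι : Type*} [Fintype ι] (a : ι → L) (h : ι → C) (hw : IsUnit (∑ i, D (a i) (h i) ^ 2))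
    (T : LieSubalgebra ℝ L) (hT : T.toSubmodule.CoFG) :
    ((conductorIdeal C T.toSubmodule).restrictScalars ℝ).CoFG := by
  let N : Submodule ℝ L :=
    { carrier := {a | ∀ b, ⁅a, b⁆ ∈ T}
      zero_mem' := fun b => by rw [zero_lie]; exact T.zero_mem
      add_mem' := fun ha hb b => by rw [add_lie]; exact T.add_mem (ha b) (hb b)
      smul_mem' := fun c a ha b => by rw [smul_lie]; exact T.smul_mem c (ha b) }
  have hN : N.CoFG :=
    CoFG.of_forall_apply_mem (LieAlgebra.ad ℝ L : L →ₗ[ℝ] Module.End ℝ L) hT hT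
      (fun a ha x hx => T.lie_mem ha hx) (fun a _ ha => ha)
  refine Ideal.cofg_of_forall_mul_sq_mem hN a h _ hw fun i f h1 h2 => ?_
  -- Moving h from one argument of the bracket to the other cancels all terms except those in which
  -- h is differentiated.
  have key : ∀ (g : C) (b : L),
      (f * g * D (a i) (h i)) • b + (f * g * D b (h i)) • a i ∈ T := by
    intro g b
    have e := T.sub_mem (h1 ((g * h i) • b)) (h2 (g • b))
    have e2 : ⁅f • a i, (g * h i) • b⁆ - ⁅(f * h i) • a i, g • b⁆ =
        (f * g * D (a i) (h i)) • b + (f * g * D b (h i)) • a i := by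
      simp only [smul_lie_of_leibniz hD, hD, map_smul, Derivation.leibniz, Derivation.smul_apply,
        smul_eq_mul]
      module
    rwa [e2] at e
  intro b
  -- For b = aᵢ the two terms coincide. This removes the second term of `key` for general b, once g
  -- is taken to be D(aᵢ)(hᵢ).
  have h3 : ∀ g : C, (f * g * D (a i) (h i)) • a i ∈ T := fun g => by
    have := T.smul_mem (2⁻¹ : ℝ) (key g (a i))
    rwa [← two_smul ℝ, smul_smul, inv_mul_cancel₀ two_ne_zero, one_smul] at this
  have h4 := T.sub_mem (key (D (a i) (h i)) b) (h3 (D b (h i)))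
  have e3 : (f * D (a i) (h i) * D (a i) (h i)) • b + (f * D (a i) (h i) * D b (h i)) • a i -
      (f * D b (h i) * D (a i) (h i)) • a i = (f * D (a i) (h i) ^ 2) • b := by module
  rwa [e3] at h4

/-- Let `J` be a subspace of finite codimension of a module `V` over a Lie-Rinehart algebra `L`,
stable under a subspace of finite codimension of `L`. If `L` acts on `V` by first-order operators
in the module and linearly over `C` in the acting element, then `J` contains `I • V` for an ideal
`I` of finite codimension. -/
theorem cofg_conductorIdeal_of_stable {V : Type*} [AddCommGroup V] [Module ℝ V] [Module C V]
    [LieRingModule L V] [LieModule ℝ L V]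
    (hD : ∀ (a : L) (f : C) (v : V), ⁅a, f • v⁆ = f • ⁅a, v⁆ + D a f • v)
    (hlin : ∀ (f : C) (a : L) (v : V), ⁅f • a, v⁆ = f • ⁅a, v⁆)
    {ι : Type*} [Fintype ι] (a : ι → L) (h : ι → C) (hw : IsUnit (∑ i, D (a i) (h i) ^ 2))
    {S : Submodule ℝ L} (hS : S.CoFG) {J : Submodule ℝ V} (hJ : J.CoFG)
    (hSJ : ∀ a ∈ S, ∀ x ∈ J, ⁅a, x⁆ ∈ J) :
    ((conductorIdeal C J).restrictScalars ℝ).CoFG := by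
  let N : Submodule ℝ L :=
    { carrier := {a | ∀ v : V, ⁅a, v⁆ ∈ J}
      zero_mem' := fun b => by rw [zero_lie]; exact J.zero_mem
      add_mem' := fun ha hb b => by rw [add_lie]; exact J.add_mem (ha b) (hb b)
      smul_mem' := fun c a ha b => by rw [smul_lie]; exact J.smul_mem c (ha b) }
  have hN : N.CoFG :=
    CoFG.of_forall_apply_mem (LieModule.toEnd ℝ L V : L →ₗ[ℝ] Module.End ℝ V) hS hJ
      hSJ (fun a _ ha => ha)
  refine Ideal.cofg_of_forall_mul_sq_mem hN a h _ hw fun i f h1 h2 v => ?_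
  -- The same shift of h; linearity in the acting element now leaves a single term, f w² v with w =
  -- D(aᵢ)(hᵢ).
  have e := J.sub_mem (h1 (h i • D (a i) (h i) • v)) (h2 (D (a i) (h i) • v))
  have e2 : ⁅f • a i, h i • D (a i) (h i) • v⁆ - ⁅(f * h i) • a i, D (a i) (h i) • v⁆ =
      (f * D (a i) (h i) ^ 2) • v := by
    simp only [hlin, hD]
    module
  rwa [e2] at e

/-- An ideal of finite codimension contains a power of every ideal that it contains up to
powers of elements. -/
theorem Ideal.exists_pow_le_of_cofg {I 𝔪 : Ideal C} (hI : (I.restrictScalars ℝ).CoFG)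
    (h : ∀ f ∈ 𝔪, ∃ n : ℕ, f ^ n ∈ I) : ∃ n : ℕ, 𝔪 ^ n ≤ I := by
  have : Module.Finite ℝ (C ⧸ I) :=
    Module.Finite.equiv (Submodule.Quotient.restrictScalarsEquiv ℝ I)
  have : IsArtinianRing (C ⧸ I) := IsArtinianRing.of_finite ℝ _
  obtain ⟨n, hn⟩ := IsArtinianRing.isNilpotent_nilradical (R := C ⧸ I)
  refine ⟨n, ?_⟩
  have hle : 𝔪.map (Ideal.Quotient.mk I) ≤ nilradical (C ⧸ I) := by
    rw [Ideal.map_le_iff_le_comap]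
    intro f hf
    obtain ⟨k, hk⟩ := h f hf
    rw [Ideal.mem_comap, mem_nilradical]
    exact ⟨k, by rw [← map_pow]; exact Ideal.Quotient.eq_zero_iff_mem.2 hk⟩
  have h1 : (𝔪 ^ n).map (Ideal.Quotient.mk I) ≤ ⊥ := by
    rw [Ideal.map_pow]
    exact (Ideal.pow_right_mono hle n).trans hn.le
  intro f hf
  exact Ideal.Quotient.eq_zero_iff_mem.1 (h1 (Ideal.mem_map_of_mem _ hf))

end FiniteCodimension

/-! ### Maximal ideals of a Lie algebra whose bracket is linear over a ring. -/

section LinearLieAlgebra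

variable {C K : Type*} [CommRing C] [Algebra ℝ C] [LieRing K] [LieAlgebra ℝ K] [Module C K]
    [IsScalarTower ℝ C K]

/-- The Lie ideal `I • K` of a Lie algebra `K` whose bracket is linear over `C`. -/
def smulLieIdeal (hlin : ∀ (f : C) (k l : K), ⁅k, f • l⁆ = f • ⁅k, l⁆) (I : Ideal C) :
    LieIdeal ℝ K where
  __ := (I • (⊤ : Submodule C K)).restrictScalars ℝ
  lie_mem := fun {x n} hn => by
    change n ∈ I • (⊤ : Submodule C K) at hn
    change ⁅x, n⁆ ∈ I • (⊤ : Submodule C K)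
    induction hn using Submodule.smul_induction_on' with
    | smul f hf k _ => rw [hlin]; exact Submodule.smul_mem_smul hf trivial
    | add y _ z _ hy hz => rw [lie_add]; exact add_mem hy hz

theorem mem_smulLieIdeal {hlin : ∀ (f : C) (k l : K), ⁅k, f • l⁆ = f • ⁅k, l⁆} {I : Ideal C}
    {k : K} : k ∈ smulLieIdeal hlin I ↔ k ∈ I • (⊤ : Submodule C K) := Iff.rfl

theorem lie_mem_smulLieIdeal_mul {hlin : ∀ (f : C) (k l : K), ⁅k, f • l⁆ = f • ⁅k, l⁆}
    {I I' : Ideal C} {k l : K} (hk : k ∈ smulLieIdeal hlin I) (hl : l ∈ smulLieIdeal hlin I') :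
    ⁅k, l⁆ ∈ smulLieIdeal hlin (I * I') := by
  rw [mem_smulLieIdeal] at *
  induction hk using Submodule.smul_induction_on' with
  | smul f hf k _ =>
    rw [← lie_skew, hlin, ← smul_neg, lie_skew, mul_smul]
    refine Submodule.smul_mem_smul hf ?_
    exact (smulLieIdeal hlin I').lie_mem hl
  | add y _ z _ hy hz => rw [add_lie]; exact add_mem hy hz

/-- Let `K` be a Lie algebra over `C`, perfect modulo `𝔪 • K`. A maximal finite-codimensional ideal
that contains `𝔪 ^ n • K` for some `n` contains `𝔪 • K`. -/
theorem IsMaximalFiniteCodimIdeal.smul_mem (hlin : ∀ (f : C) (k l : K), ⁅k, f • l⁆ = f • ⁅k, l⁆)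
    {J : LieIdeal ℝ K} (hJ : IsMaximalFiniteCodimIdeal J) {𝔪 : Ideal C} {r : ℕ}
    (hr : 𝔪 ^ r ≤ conductorIdeal C J.toSubmodule)
    (hperf : ⊤ ≤ Submodule.span C {x : K | ∃ k l : K, ⁅k, l⁆ = x} ⊔ 𝔪 • (⊤ : Submodule C K))
    {f : C} (hf : f ∈ 𝔪) (k : K) : f • k ∈ J := by
  set Q := Submodule.span C {x : K | ∃ k l : K, ⁅k, l⁆ = x} with hQ
  have hrJ : smulLieIdeal hlin (𝔪 ^ r) ≤ J := by
    intro x hx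
    rw [mem_smulLieIdeal] at hx
    induction hx using Submodule.smul_induction_on' with
    | smul f hf k _ => exact hr hf k
    | add y _ z _ hy hz => exact add_mem hy hz
  have htop : ∀ n : ℕ, ⊤ ≤ Q ⊔ 𝔪 ^ n • (⊤ : Submodule C K) := by
    intro n
    induction n with
    | zero => simp
    | succ n ih =>
      refine ih.trans (sup_le le_sup_left ?_)
      calc 𝔪 ^ n • (⊤ : Submodule C K) ≤ 𝔪 ^ n • (Q ⊔ 𝔪 • (⊤ : Submodule C K)) :=
            smul_mono_right _ hperf
        _ = 𝔪 ^ n • Q ⊔ 𝔪 ^ (n + 1) • (⊤ : Submodule C K) := by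
            rw [Submodule.smul_sup, pow_succ, mul_smul]
        _ ≤ _ := sup_le_sup_right Submodule.smul_le_right _
  -- If `K ⧸ J` were abelian, J would contain the C-span of the brackets, since f [k, l] = [k, f l];
  -- together with 𝔪^r K this is all of K.
  have hnab : ¬ ∀ k l : K, ⁅k, l⁆ ∈ J := by
    intro hab
    refine hJ.prop.1 (eq_top_iff.2 fun x hx => ?_)
    clear hx
    obtain ⟨q, hq, y, hy, rfl⟩ := Submodule.mem_sup.1 (htop r (Submodule.mem_top (x := x)))
    refine add_mem ?_ (hrJ hy)
    induction hq using Submodule.span_induction with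
    | mem x hx => obtain ⟨k, l, rfl⟩ := hx; exact hab k l
    | zero => exact zero_mem _
    | add x y _ _ hx hy => exact add_mem hx hy
    | smul f x hx' hxJ =>
      clear hy hxJ
      induction hx' using Submodule.span_induction generalizing f with
      | mem x hx => obtain ⟨k, l, rfl⟩ := hx; rw [← hlin]; exact hab k _
      | zero => rw [smul_zero]; exact zero_mem _
      | add x y _ _ hx hy => rw [smul_add]; exact add_mem (hx f) (hy f)
      | smul g x _ hx => rw [smul_smul]; exact hx _
  -- If 𝔪^s K were not in J, maximality would give K = J + 𝔪^s K, so that [K, K] ⊆ J + 𝔪^(2s) K = J,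
  -- against `hnab`. As 2s ≥ s + 1, this descends from exponents at least r to the exponent 1.
  have hstep : ∀ s : ℕ, 1 ≤ s → smulLieIdeal hlin (𝔪 ^ (2 * s)) ≤ J →
      smulLieIdeal hlin (𝔪 ^ s) ≤ J := by
    intro s _ hs
    by_contra hnot
    have hsup : J ⊔ smulLieIdeal hlin (𝔪 ^ s) = ⊤ := by
      by_contra hne
      refine hnot (le_sup_right.trans (hJ.le_of_ge ⟨hne, ?_⟩ le_sup_left))
      refine Submodule.CoFG.of_le ?_ hJ.prop.2
      exact (le_sup_left : J ≤ J ⊔ smulLieIdeal hlin (𝔪 ^ s))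
    refine hnab fun k l => ?_
    have hk : k ∈ J ⊔ smulLieIdeal hlin (𝔪 ^ s) := by rw [hsup]; trivial
    have hl : l ∈ J ⊔ smulLieIdeal hlin (𝔪 ^ s) := by rw [hsup]; trivial
    obtain ⟨k₁, hk₁, k₂, hk₂, rfl⟩ := (LieSubmodule.mem_sup ..).1 hk
    obtain ⟨l₁, hl₁, l₂, hl₂, rfl⟩ := (LieSubmodule.mem_sup ..).1 hl
    rw [add_lie, lie_add k₂]
    refine add_mem (lie_mem_left ℝ K J _ _ hk₁) (add_mem (J.lie_mem hl₁) (hs ?_))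
    rw [two_mul, pow_add]
    exact lie_mem_smulLieIdeal_mul hk₂ hl₂
  have hall : ∀ n s : ℕ, 1 ≤ s → r ≤ s + n → smulLieIdeal hlin (𝔪 ^ s) ≤ J := by
    intro n
    induction n with
    | zero =>
      intro s _ hrs x hx
      exact hrJ (Submodule.smul_mono_left (Ideal.pow_le_pow_right hrs) hx)
    | succ n ih => exact fun s hs hrs => hstep s hs (ih (2 * s) (by omega) (by omega))
  refine hall r 1 le_rfl (by omega) ?_
  rw [mem_smulLieIdeal, pow_one]
  exact Submodule.smul_mem_smul hf trivial

end LinearLieAlgebra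

/-! ### Ideals of semisimple Lie algebras. -/

section SemisimpleIdeals

/-- In a real Lie algebra with trivial radical, the maximal ideals intersect in zero. -/
theorem LieAlgebra.exists_isCoatom_notMem {L : Type*} [LieRing L] [LieAlgebra ℝ L]
    [FiniteDimensional ℝ L] [LieAlgebra.HasTrivialRadical ℝ L] {x : L} (hx : x ≠ 0) :
    ∃ J : LieIdeal ℝ L, IsCoatom J ∧ x ∉ J := by
  have : LieAlgebra.IsSemisimple ℝ L := inferInstance
  have hne : LieSubmodule.lieSpan ℝ L {x} ≠ ⊥ := fun h => hx <| by
    have := LieSubmodule.subset_lieSpan (R := ℝ) (L := L) (Set.mem_singleton x)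
    rw [SetLike.mem_coe, h] at this
    exact (LieSubmodule.mem_bot x).1 this
  obtain ⟨I, hI, hIx⟩ := (eq_bot_or_exists_atom_le (LieSubmodule.lieSpan ℝ L {x})).resolve_left hne
  -- The ideals of a semisimple algebra form a Boolean lattice. If the complement of an atom `I`
  -- below the ideal generated by x contained x, it would contain `I`.
  refine ⟨Iᶜ, isCoatom_compl.2 hI, fun hmem => hI.1 ?_⟩
  have h1 : I ≤ Iᶜ := hIx.trans (LieSubmodule.lieSpan_le.2 (by simpa using hmem))
  exact le_compl_self.1 h1

/-- The complement N of [L, L] in the lattice of ideals satisfies [N, N] ⊆ [L, L] ∩ N = 0, so it is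
an abelian ideal and vanishes. -/
theorem LieAlgebra.top_lie_top_of_hasTrivialRadical {L : Type*} [LieRing L] [LieAlgebra ℝ L]
    [FiniteDimensional ℝ L] [LieAlgebra.HasTrivialRadical ℝ L] :
    ⁅(⊤ : LieIdeal ℝ L), (⊤ : LieIdeal ℝ L)⁆ = ⊤ := by
  have : LieAlgebra.IsSemisimple ℝ L := inferInstance
  rw [← compl_eq_bot]
  refine (LieAlgebra.hasTrivialRadical_iff_no_abelian_ideals ℝ L).1 inferInstance _ ?_
  rw [LieSubmodule.lie_abelian_iff_lie_self_eq_bot, eq_bot_iff]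
  refine (le_inf (LieSubmodule.mono_lie le_top le_top)
    (LieSubmodule.lie_le_right _ _)).trans ?_
  exact (inf_compl_eq_bot).le

end SemisimpleIdeals

/-! ### Ideals of finite codimension in the algebra of smooth functions. -/

section SmoothFunctions

variable {E M : Type*} [NormedAddCommGroup E] [NormedSpace ℝ E]
    [TopologicalSpace M] [ChartedSpace E M]

namespace ContMDiffMap

theorem isUnit_of_forall_ne_zero {f : C^∞⟮𝓘(ℝ, E), M; ℝ⟯} (hf : ∀ x, f x ≠ 0) : IsUnit f := by
  let g : C^∞⟮𝓘(ℝ, E), M; ℝ⟯ := ⟨fun x => (f x)⁻¹, fun x => (f.contMDiff x).inv₀ (hf x)⟩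
  refine IsUnit.of_mul_eq_one g ?_
  ext x
  exact mul_inv_cancel₀ (hf x)

theorem aeval_apply (f : C^∞⟮𝓘(ℝ, E), M; ℝ⟯) (p : Polynomial ℝ) (x : M) :
    Polynomial.aeval f p x = p.eval (f x) := by
  have h := Polynomial.aeval_algHom_apply
    ((Pi.evalAlgHom ℝ (fun _ : M => ℝ) x).comp
      (coeFnAlgHom (I := 𝓘(ℝ, E)) (N := M) (n := ∞) (A := ℝ))) f p
  rw [Polynomial.coe_aeval_eq_eval] at h
  exact h.symm

/-- The ideal of the smooth functions that vanish at `m`. -/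
def vanishingIdeal (E : Type*) {M : Type*} [NormedAddCommGroup E] [NormedSpace ℝ E]
    [TopologicalSpace M] [ChartedSpace E M] (m : M) : Ideal C^∞⟮𝓘(ℝ, E), M; ℝ⟯ :=
  RingHom.ker (evalRingHom (I := 𝓘(ℝ, E)) (I' := 𝓘(ℝ, ℝ)) (n := ∞) (R := ℝ) m)

theorem mem_vanishingIdeal {m : M} {f : C^∞⟮𝓘(ℝ, E), M; ℝ⟯} :
    f ∈ vanishingIdeal E m ↔ f m = 0 := Iff.rfl

variable [FiniteDimensional ℝ E] [IsManifold 𝓘(ℝ, E) ∞ M] [T2Space M] [SecondCountableTopology M]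

/-- A smooth function lying above the index function of a compact exhaustion has sublevel sets
contained in compact sets. For such ρ and p ≠ 0, the zeros of p(ρ) stay in a compact set. -/
theorem exists_proper (E M : Type*) [NormedAddCommGroup E] [NormedSpace ℝ E] [FiniteDimensional ℝ E]
    [TopologicalSpace M] [ChartedSpace E M] [IsManifold 𝓘(ℝ, E) ∞ M] [T2Space M]
    [SecondCountableTopology M] :
    ∃ ρ : C^∞⟮𝓘(ℝ, E), M; ℝ⟯, ∀ c : ℝ, ∃ K : Set M, IsCompact K ∧ ∀ x, ρ x ≤ c → x ∈ K := by
  have := ChartedSpace.locallyCompactSpace E M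
  let K := CompactExhaustion.choice M
  obtain ⟨ρ, hρ⟩ := exists_contMDiffMap_forall_mem_convex_of_local_const (n := ⊤) 𝓘(ℝ, E)
    (t := fun x : M => Set.Ici (K.find x : ℝ)) (fun x => convex_Ici _) (fun x => by
      refine ⟨(K.find x + 1 : ℕ), ?_⟩
      have hx : x ∈ interior (K (K.find x + 1)) := K.subset_interior_succ _ (K.mem_find x)
      filter_upwards [mem_interior_iff_mem_nhds.1 hx] with y hy
      exact Nat.cast_le (α := ℝ).2 (K.mem_iff_find_le.1 hy))
  refine ⟨ρ, fun c => ⟨K ⌈c⌉₊, K.isCompact _, fun x hx => ?_⟩⟩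
  rw [K.mem_iff_find_le]
  have h1 : (K.find x : ℝ) ≤ ⌈c⌉₊ := ((hρ x).trans hx).trans (Nat.le_ceil c)
  exact_mod_cast h1

/-- An ideal of finite codimension of the algebra of smooth functions without common zero is the
whole algebra. -/
theorem eq_top_of_cofg {I : Ideal C^∞⟮𝓘(ℝ, E), M; ℝ⟯} (hI : (I.restrictScalars ℝ).CoFG)
    (h : ∀ m, ∃ f ∈ I, f m ≠ 0) : I = ⊤ := by
  obtain ⟨ρ, hρ⟩ := exists_proper E M
  obtain ⟨p, hp0, hp⟩ := I.exists_aeval_mem_of_cofg hI ρ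
  obtain ⟨c, hc⟩ : ∃ c : ℝ, ∀ r ∈ p.roots, r ≤ c := by
    obtain ⟨c, hc⟩ := p.roots.toFinset.bddAbove
    exact ⟨c, fun r hr => hc (by simpa using hr)⟩
  obtain ⟨K, hK, hKc⟩ := hρ c
  choose f hf hfm using h
  obtain ⟨s, -, hs⟩ := hK.elim_nhds_subcover (fun m => {x | f m x ≠ 0}) (fun m _ =>
    ((f m).contMDiff.continuous.isOpen_preimage _ isOpen_compl_singleton).mem_nhds (hfm m))
  -- The first square is positive outside the compact set `K`; on `K`, finitely many squares of
  -- elements of `I` suffice by compactness. The sum is therefore invertible.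
  have hg : Polynomial.aeval ρ p ^ 2 + ∑ m ∈ s, f m ^ 2 ∈ I :=
    I.add_mem (I.pow_mem_of_mem hp 2 two_pos)
      (I.sum_mem fun m _ => I.pow_mem_of_mem (hf m) 2 two_pos)
  refine I.eq_top_of_isUnit_mem hg (isUnit_of_forall_ne_zero fun x => ?_)
  have e : (Polynomial.aeval ρ p ^ 2 + ∑ m ∈ s, f m ^ 2) x =
      (p.eval (ρ x)) ^ 2 + ∑ m ∈ s, f m x ^ 2 := by
    rw [← aeval_apply]
    have : (∑ m ∈ s, f m ^ 2 : C^∞⟮𝓘(ℝ, E), M; ℝ⟯) x = ∑ m ∈ s, f m x ^ 2 :=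
      (map_sum (evalRingHom (I := 𝓘(ℝ, E)) (I' := 𝓘(ℝ, ℝ)) (n := ∞) (R := ℝ) x) _ _)
    rw [← this]; rfl
  rw [e]
  refine ne_of_gt ?_
  by_cases hx : p.eval (ρ x) = 0
  · have hxK : x ∈ K := hKc x (hc _ ((Polynomial.mem_roots hp0).2 hx))
    obtain ⟨m, hm, hmx⟩ := Set.mem_iUnion₂.1 (hs hxK)
    have h1 : f m x ^ 2 ≤ ∑ m ∈ s, f m x ^ 2 :=
      Finset.single_le_sum (f := fun m => f m x ^ 2) (fun i _ => sq_nonneg _) hm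
    have h2 : 0 < f m x ^ 2 := by have : f m x ≠ 0 := hmx; positivity
    have h3 := sq_nonneg (p.eval (ρ x))
    linarith
  · have h1 : 0 ≤ ∑ m ∈ s, f m x ^ 2 := Finset.sum_nonneg fun i _ => sq_nonneg _
    have h2 : 0 < (p.eval (ρ x)) ^ 2 := by positivity
    linarith

/-- If an ideal of finite codimension has no common zero but possibly `m`, it contains a power of
the ideal of the functions that vanish at `m`. -/
theorem exists_pow_vanishingIdeal_le {I : Ideal C^∞⟮𝓘(ℝ, E), M; ℝ⟯}
    (hI : (I.restrictScalars ℝ).CoFG) (m : M) (h : ∀ x, x ≠ m → ∃ f ∈ I, f x ≠ 0) :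
    ∃ n : ℕ, vanishingIdeal E m ^ n ≤ I := by
  refine Ideal.exists_pow_le_of_cofg hI fun f hf => ?_
  obtain ⟨p, hp0, hp⟩ := I.exists_aeval_mem_of_cofg hI f
  -- Write p(f) = f^r q(f) with q(0) ≠ 0. Since q(f) does not vanish at m, adding it to `I` removes
  -- the last possible common zero; multiplying the resulting decomposition of 1 by f^r puts f^r in
  -- `I`.
  obtain ⟨q, hq, hq0⟩ := Polynomial.exists_eq_pow_rootMultiplicity_mul_and_not_dvd p hp0 0
  rw [map_zero, sub_zero] at hq hq0
  have hq0' : q.eval 0 ≠ 0 := fun h0 => hq0 (by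
    rw [Polynomial.X_dvd_iff, Polynomial.coeff_zero_eq_eval_zero, h0])
  set r := p.rootMultiplicity 0
  set g : C^∞⟮𝓘(ℝ, E), M; ℝ⟯ := Polynomial.aeval f q
  have htop : I ⊔ Ideal.span {g} = ⊤ := by
    refine eq_top_of_cofg (Submodule.CoFG.of_le (S := I.restrictScalars ℝ) ?_ hI) fun x => ?_
    · exact (le_sup_left : I ≤ I ⊔ Ideal.span {g})
    · by_cases hx : x = m
      · refine ⟨g, le_sup_right (a := I) (Ideal.mem_span_singleton_self g), ?_⟩
        rw [hx, aeval_apply, mem_vanishingIdeal.1 hf]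
        exact hq0'
      · obtain ⟨f', hf', hne⟩ := h x hx
        exact ⟨f', le_sup_left (b := Ideal.span {g}) hf', hne⟩
  refine ⟨r, ?_⟩
  rw [hq, map_mul, map_pow, Polynomial.aeval_X] at hp
  have h1 : (1 : C^∞⟮𝓘(ℝ, E), M; ℝ⟯) ∈ I ⊔ Ideal.span {g} := by rw [htop]; trivial
  obtain ⟨i, hi, y, hy, hiy⟩ := Submodule.mem_sup.1 h1
  obtain ⟨z, rfl⟩ := Ideal.mem_span_singleton'.1 hy
  have e : f ^ r = f ^ r * i + z * (f ^ r * g) := by linear_combination -(f ^ r) * hiy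
  rw [e]
  exact I.add_mem (I.mul_mem_left _ hi) (I.mul_mem_left _ hp)

end ContMDiffMap
end SmoothFunctions

/-! ### Two functions without common critical point, by a Baire category argument. -/

section NoncriticalPairs

open Metric Topology

/-- The bad parameters are the projection of a closed set along the compact factor `K`, hence
closed. -/
theorem isOpen_setOf_forall_sum_comp_ne_zero {ι E F : Type*} [NormedAddCommGroup E]
    [NormedSpace ℝ E] [NormedAddCommGroup F] [NormedSpace ℝ F] (s : Finset ι)
    {A : ι → E → E →L[ℝ] E} {K : Set E} (hK : IsCompact K) (hA : ∀ i ∈ s, ContinuousOn (A i) K) :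
    IsOpen {c : ι → E →L[ℝ] F | ∀ z ∈ K, ∑ i ∈ s, (c i).comp (A i z) ≠ 0} := by
  have : CompactSpace K := isCompact_iff_compactSpace.1 hK
  let Φ : (ι → E →L[ℝ] F) × K → E →L[ℝ] F := fun p => ∑ i ∈ s, (p.1 i).comp (A i p.2)
  have hΦ : Continuous Φ := by
    refine continuous_finsetSum s fun i hi => ?_
    exact ((continuous_apply i).comp continuous_fst).clm_comp
      ((continuousOn_iff_continuous_domRestrict.1 (hA i hi)).comp continuous_snd)
  have h1 := isClosedMap_fst_of_compactSpace (X := ι → E →L[ℝ] F) (Y := K) _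
    (isClosed_singleton.preimage hΦ : IsClosed (Φ ⁻¹' {0}))
  convert h1.isOpen_compl using 1
  ext c
  simp only [Set.mem_ofPred_eq, Set.mem_compl_iff, Set.mem_image, not_exists, not_and]
  constructor
  · rintro h ⟨c', z⟩ hz rfl
    exact h z z.2 hz
  · intro h z hz h0
    exact h (c, ⟨z, hz⟩) h0 rfl

/-- It is enough to perturb the coefficient at i₀, where `A` is the identity. Its bad values form
the C¹ image of a subset of E in Hom(E, F), a space of dimension dim E · dim F > dim E, so their
complement is dense. -/
theorem dense_setOf_forall_sum_comp_ne_zero {ι E F : Type*} [NormedAddCommGroup E]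
    [NormedSpace ℝ E] [FiniteDimensional ℝ E] [Nontrivial E] [NormedAddCommGroup F]
    [NormedSpace ℝ F] [FiniteDimensional ℝ F] (hF : 1 < Module.finrank ℝ F) (s : Finset ι)
    {A : ι → E → E →L[ℝ] E} {K : Set E} (hK : Convex ℝ K) (hA : ∀ i ∈ s, ContDiffOn ℝ 1 (A i) K)
    {i₀ : ι} (hi₀ : i₀ ∈ s) (hA₀ : ∀ z ∈ K, A i₀ z = ContinuousLinearMap.id ℝ E) :
    Dense {c : ι → E →L[ℝ] F | ∀ z ∈ K, ∑ i ∈ s, (c i).comp (A i z) ≠ 0} := by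
  classical
  intro c
  let Ψ : E → E →L[ℝ] F := fun z => -∑ i ∈ s.erase i₀, (c i).comp (A i z)
  have hΨ : ContDiffOn ℝ 1 Ψ K := by
    refine ContDiffOn.neg (ContDiffOn.sum fun i hi => ?_)
    exact contDiffOn_const.clm_comp (hA i (Finset.mem_of_mem_erase hi))
  have hfr : Module.finrank ℝ (E →L[ℝ] F) = Module.finrank ℝ E * Module.finrank ℝ F := by
    rw [← Module.finrank_linearMap ℝ ℝ E F]
    exact (LinearMap.toContinuousLinearMap (𝕜 := ℝ) (E := E) (F' := F)).finrank_eq.symm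
  have hd : Dense (Ψ '' K)ᶜ := by
    refine hΨ.dense_compl_image_of_dimH_lt_finrank hK subset_rfl ?_
    refine (dimH_mono (Set.subset_univ K)).trans_lt ?_
    rw [Real.dimH_univ_eq_finrank, hfr]
    have : 0 < Module.finrank ℝ E := Module.finrank_pos
    exact_mod_cast (by nlinarith : Module.finrank ℝ E < Module.finrank ℝ E * Module.finrank ℝ F)
  have hu : Continuous (fun l : E →L[ℝ] F => Function.update c i₀ l) :=
    continuous_const.update i₀ continuous_id
  have hmem := map_mem_closure hu (hd (c i₀)) (t := {c : ι → E →L[ℝ] F |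
    ∀ z ∈ K, ∑ i ∈ s, (c i).comp (A i z) ≠ 0}) (fun l hl z hz h0 => hl ⟨z, hz, ?_⟩)
  · rwa [Function.update_eq_self] at hmem
  · rw [← Finset.add_sum_erase _ _ hi₀, Function.update_self, hA₀ z hz,
      ContinuousLinearMap.comp_id] at h0
    have : ∑ i ∈ s.erase i₀, (Function.update c i₀ l i).comp (A i z) =
        ∑ i ∈ s.erase i₀, (c i).comp (A i z) := by
      refine Finset.sum_congr rfl fun i hi => ?_
      rw [Function.update_of_ne (Finset.ne_of_mem_erase hi)]
    rw [this] at h0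
    exact (eq_neg_of_add_eq_zero_left h0).symm

variable (E M : Type*) [NormedAddCommGroup E] [NormedSpace ℝ E] [FiniteDimensional ℝ E]
    [Nontrivial E] [TopologicalSpace M] [ChartedSpace E M] [IsManifold 𝓘(ℝ, E) ∞ M] [T2Space M]
    [SecondCountableTopology M]

/-- On a manifold of positive dimension there are two smooth functions without common critical
point. -/
theorem exists_pair_noncritical : ∃ h : Fin 2 → C^∞⟮𝓘(ℝ, E), M; ℝ⟯,
    ∀ x, ∃ j, mfderiv 𝓘(ℝ, E) 𝓘(ℝ, ℝ) (h j) x ≠ 0 := by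
  have := ChartedSpace.locallyCompactSpace E M
  obtain ⟨ι, fs, -⟩ := SmoothBumpCovering.exists_isSubordinate 𝓘(ℝ, E) (isClosed_univ (X := M))
    (U := fun _ => Set.univ) (fun _ _ => Filter.univ_mem)
  have : Countable ι := Set.countable_univ_iff.1
    (fs.locallyFinite.countable_univ fun i => (fs i).nonempty_support)
  let ψ : ι → M → E := fun i x => fs i x • extChartAt 𝓘(ℝ, E) (fs.c i) x
  have hψ : ∀ i, ContMDiff 𝓘(ℝ, E) 𝓘(ℝ, E) ∞ (ψ i) := fun i =>
    (fs i).contMDiff_smul (contMDiffOn_extChartAt (I := 𝓘(ℝ, E)) (n := ∞) (x := fs.c i))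
  have hfin : LocallyFinite fun i => Function.support (ψ i) :=
    fs.locallyFinite.subset fun i x hx h0 => hx (by
      change fs i x • _ = (0 : E)
      rw [h0, zero_smul])
  -- The candidates are locally finite sums of linear images of cut-off charts; the parameter is the
  -- family c of linear maps to ℝ². Near each point, nonvanishing of the differential is an open
  -- dense condition on c.
  let H : (ι → E →L[ℝ] ℝ × ℝ) → M → ℝ × ℝ := fun c x => ∑ᶠ i, c i (ψ i x)
  have hH : ∀ c, ContMDiff 𝓘(ℝ, E) 𝓘(ℝ, ℝ × ℝ) ∞ (H c) := fun c =>
    contMDiff_finsum (fun i => (c i).contMDiff.comp (hψ i))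
      (hfin.subset fun i x hx h0 => hx (by
        change c i (ψ i x) = 0
        rw [h0, map_zero]))
  have key : ∀ x : M, ∃ N ∈ 𝓝 x, ∃ G : Set (ι → E →L[ℝ] ℝ × ℝ), IsOpen G ∧ Dense G ∧
      ∀ c ∈ G, ∀ y ∈ N, mfderiv 𝓘(ℝ, E) 𝓘(ℝ, ℝ × ℝ) (H c) y ≠ 0 := by
    intro x
    classical
    set i₀ := fs.ind x trivial
    set χ := extChartAt 𝓘(ℝ, E) (fs.c i₀)
    have hxs : x ∈ χ.source := fs.mem_extChartAt_ind_source x trivial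
    obtain ⟨V, hV, hVfin⟩ := hfin x
    let s : Finset ι := insert i₀ hVfin.toFinset
    have hsum : ∀ c, ∀ y ∈ V, H c y = ∑ i ∈ s, c i (ψ i y) := fun c y hy => by
      refine finsum_eq_sum_of_support_subset _ fun i hi => ?_
      refine Finset.mem_insert_of_mem (hVfin.mem_toFinset.2 ⟨y, fun h0 => hi ?_, hy⟩)
      change c i (ψ i y) = 0
      rw [h0, map_zero]
    have hχx : χ x ∈ χ.target := χ.map_source hxs
    have hnhds : ∀ᶠ z in 𝓝 (χ x), z ∈ χ.target ∧ χ.symm z ∈ V ∧ fs i₀ (χ.symm z) = 1 := by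
      have hc : Filter.Tendsto χ.symm (𝓝 (χ x)) (𝓝 x) := by
        have := (continuousAt_extChartAt_symm'' hχx : ContinuousAt χ.symm (χ x))
        rwa [ContinuousAt, χ.left_inv hxs] at this
      refine Filter.Eventually.and ((isOpen_extChartAt_target (fs.c i₀)).mem_nhds hχx)
        ((hc.eventually hV).and (hc.eventually (fs.eventuallyEq_one x trivial)))
    obtain ⟨R, hR, hball⟩ := Metric.eventually_nhds_iff_ball.1 hnhds
    have hsub : closedBall (χ x) (R / 2) ⊆ ball (χ x) R := closedBall_subset_ball (by linarith)
    let A : ι → E → E →L[ℝ] E := fun i z => fderiv ℝ (ψ i ∘ χ.symm) z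
    have hsm : ∀ i, ContDiffOn ℝ ∞ (ψ i ∘ χ.symm) (ball (χ x) R) := fun i => by
      rw [← contMDiffOn_iff_contDiffOn]
      exact (hψ i).comp_contMDiffOn
        ((contMDiffOn_extChartAt_symm (fs.c i₀)).mono fun z hz => (hball z hz).1)
    have hA : ∀ i, ContDiffOn ℝ 1 (A i) (ball (χ x) R) := fun i =>
      (hsm i).fderiv_of_isOpen isOpen_ball (by rw [one_add_one_eq_two]; exact ENat.LEInfty.out)
    have hA₀ : ∀ z ∈ ball (χ x) R, A i₀ z = ContinuousLinearMap.id ℝ E := fun z hz => by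
      have : ψ i₀ ∘ χ.symm =ᶠ[𝓝 z] id := by
        filter_upwards [isOpen_ball.mem_nhds hz] with w hw
        change fs i₀ (χ.symm w) • χ (χ.symm w) = w
        rw [(hball w hw).2.2, one_smul, χ.right_inv (hball w hw).1]
      exact this.fderiv_eq.trans fderiv_id
    refine ⟨χ.source ∩ χ ⁻¹' ball (χ x) (R / 2), ?_, {c | ∀ z ∈ closedBall (χ x) (R / 2),
      ∑ i ∈ s, (c i).comp (A i z) ≠ 0}, ?_, ?_, ?_⟩
    · exact Filter.inter_mem (extChartAt_source_mem_nhds' hxs)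
        ((continuousAt_extChartAt' hxs).preimage_mem_nhds (ball_mem_nhds _ (half_pos hR)))
    · exact isOpen_setOf_forall_sum_comp_ne_zero s (isCompact_closedBall _ _)
        fun i _ => ((hA i).mono hsub).continuousOn
    · exact dense_setOf_forall_sum_comp_ne_zero (by simp) s (convex_closedBall _ _)
        (fun i _ => (hA i).mono hsub) (Finset.mem_insert_self _ _) fun z hz => hA₀ z (hsub hz)
    · rintro c hc y ⟨hys, hyb⟩ h0
      have hyK := ball_subset_closedBall hyb
      refine hc (χ y) hyK ?_
      have hz := hsub hyK
      have e1 : H c ∘ χ.symm =ᶠ[𝓝 (χ y)] fun z => ∑ i ∈ s, c i ((ψ i ∘ χ.symm) z) := by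
        filter_upwards [isOpen_ball.mem_nhds hz] with w hw
        exact hsum c _ (hball w hw).2.1
      have hd : ∀ i, HasFDerivAt (ψ i ∘ χ.symm) (A i (χ y)) (χ y) := fun i =>
        (((hsm i).contDiffAt (isOpen_ball.mem_nhds hz)).differentiableAt (by simp)).hasFDerivAt
      have e2 : HasFDerivAt (fun z => ∑ i ∈ s, c i ((ψ i ∘ χ.symm) z))
          (∑ i ∈ s, (c i).comp (A i (χ y))) (χ y) :=
        HasFDerivAt.fun_sum fun i _ => (c i).hasFDerivAt.comp _ (hd i)
      have e3 : HasMFDerivAt 𝓘(ℝ, E) 𝓘(ℝ, ℝ × ℝ) (H c ∘ χ.symm) (χ y)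
          (mfderiv 𝓘(ℝ, E) 𝓘(ℝ, ℝ × ℝ) (H c) y ∘L mfderiv 𝓘(ℝ, E) 𝓘(ℝ, E) χ.symm (χ y)) := by
        refine HasMFDerivAt.comp _ ?_ ?_
        · rw [χ.left_inv hys]
          exact ((hH c y).mdifferentiableAt (by simp)).hasMFDerivAt
        · have := (contMDiffOn_extChartAt_symm (I := 𝓘(ℝ, E)) (n := ∞) (fs.c i₀)).contMDiffAt
            ((isOpen_extChartAt_target (fs.c i₀)).mem_nhds (χ.map_source hys))
          exact (this.mdifferentiableAt (by simp)).hasMFDerivAt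
      rw [h0] at e3
      have e4 : HasMFDerivAt 𝓘(ℝ, E) 𝓘(ℝ, ℝ × ℝ) (H c ∘ χ.symm) (χ y)
          (0 : E →L[ℝ] ℝ × ℝ) := e3
      exact (e2.congr_of_eventuallyEq e1).unique (hasMFDerivAt_iff_hasFDerivAt.1 e4)
  choose N hN G hGo hGd hG using key
  obtain ⟨s, hs, hsN⟩ := TopologicalSpace.countable_cover_nhds hN
  -- Countably many neighbourhoods cover M. The parameter space is a countable product of
  -- finite-dimensional spaces, so Baire's theorem applies.
  have hdense : Dense (⋂ x ∈ s, G x) :=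
    dense_biInter_of_isOpen (fun x _ => hGo x) hs (fun x _ => hGd x)
  obtain ⟨c, hc⟩ := hdense.nonempty
  have hne : ∀ y, mfderiv 𝓘(ℝ, E) 𝓘(ℝ, ℝ × ℝ) (H c) y ≠ 0 := fun y => by
    have hy : y ∈ ⋃ x ∈ s, N x := by rw [hsN]; trivial
    obtain ⟨x, hx, hyx⟩ := Set.mem_iUnion₂.1 hy
    exact hG x c (Set.mem_iInter₂.1 hc x hx) y hyx
  let p : Fin 2 → (ℝ × ℝ →L[ℝ] ℝ) :=
    ![ContinuousLinearMap.fst ℝ ℝ ℝ, ContinuousLinearMap.snd ℝ ℝ ℝ]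
  refine ⟨fun j => ⟨p j ∘ H c, (p j).contMDiff.comp (hH c)⟩, fun x => ?_⟩
  by_contra! h0
  refine hne x (ContinuousLinearMap.ext fun v => ?_)
  have hp : ∀ j, p j (mfderiv 𝓘(ℝ, E) 𝓘(ℝ, ℝ × ℝ) (H c) x v) = 0 := fun j => by
    have h1 : HasMFDerivAt 𝓘(ℝ, E) 𝓘(ℝ, ℝ) (p j ∘ H c) x
        (p j ∘L mfderiv 𝓘(ℝ, E) 𝓘(ℝ, ℝ × ℝ) (H c) x) :=
      (p j).hasMFDerivAt.comp x ((hH c x).mdifferentiableAt (by simp)).hasMFDerivAt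
    have h2 := h1.mfderiv.symm.trans (h0 j)
    exact congrArg (fun l : E →L[ℝ] ℝ => l v) h2
  exact Prod.ext (hp 0) (hp 1)

end NoncriticalPairs

/-! ### Smooth functions, bump functions and tangent vectors. -/

section TangentVectors

open Topology

variable {E M : Type*} [NormedAddCommGroup E] [NormedSpace ℝ E]
    [TopologicalSpace M] [ChartedSpace E M] [IsManifold 𝓘(ℝ, E) ∞ M]

/-- Smooth functions separate tangent vectors. -/
theorem TangentSpace.eq_of_forall_mvfderiv_eq {x : M} {v w : TangentSpace 𝓘(ℝ, E) x}
    (h : ∀ φ : M → ℝ, ContMDiffAt 𝓘(ℝ, E) 𝓘(ℝ, ℝ) ∞ φ x →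
      mvfderiv 𝓘(ℝ, E) φ x v = mvfderiv 𝓘(ℝ, E) φ x w) : v = w := by
  have hchart : ContMDiffAt 𝓘(ℝ, E) 𝓘(ℝ, E) ∞ (extChartAt 𝓘(ℝ, E) x) x := contMDiffAt_extChartAt
  have hinv := isInvertible_mfderiv_extChartAt (I := 𝓘(ℝ, E))
    (mem_extChartAt_source (I := 𝓘(ℝ, E)) x)
  apply hinv.injective
  refine (SeparatingDual.eq_iff_forall_dual_eq (R := ℝ) (V := E)).2 fun ℓ => ?_
  have hφ : ContMDiffAt 𝓘(ℝ, E) 𝓘(ℝ, ℝ) ∞ (ℓ ∘ extChartAt 𝓘(ℝ, E) x) x :=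
    ContMDiffAt.comp _ ℓ.contMDiff.contMDiffAt hchart
  have h3 := mfderiv_comp (I := 𝓘(ℝ, E)) (I' := 𝓘(ℝ, E)) (I'' := 𝓘(ℝ, ℝ)) x
    (ℓ.contMDiff.contMDiffAt.mdifferentiableAt (by simp : (∞ : WithTop ℕ∞) ≠ 0))
    (hchart.mdifferentiableAt (by simp))
  have h4 : mfderiv 𝓘(ℝ, E) 𝓘(ℝ, ℝ) (ℓ ∘ extChartAt 𝓘(ℝ, E) x) x v =
    mfderiv 𝓘(ℝ, E) 𝓘(ℝ, ℝ) (ℓ ∘ extChartAt 𝓘(ℝ, E) x) x w := h _ hφ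
  rw [h3] at h4
  simp only [mfderiv_eq_fderiv, ContinuousLinearMap.fderiv] at h4
  exact h4

variable [FiniteDimensional ℝ E] [T2Space M]

theorem ContMDiffMap.exists_bump {m : M} {O : Set M} (hO : O ∈ 𝓝 m) :
    ∃ χ : C^∞⟮𝓘(ℝ, E), M; ℝ⟯, tsupport χ ⊆ O ∧ χ =ᶠ[𝓝 m] 1 := by
  obtain ⟨f, hf, -⟩ := (SmoothBumpFunction.nhds_basis_support (I := 𝓘(ℝ, E)) hO).mem_iff.1 hO
  exact ⟨⟨f, f.contMDiff⟩, hf, f.eventuallyEq_one⟩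

theorem ContMDiffMap.exists_mvfderiv_ne_zero {m : M} {v : TangentSpace 𝓘(ℝ, E) m} (hv : v ≠ 0) :
    ∃ f : C^∞⟮𝓘(ℝ, E), M; ℝ⟯, mvfderiv 𝓘(ℝ, E) f m v ≠ 0 := by
  have hchart : ContMDiffAt 𝓘(ℝ, E) 𝓘(ℝ, E) ∞ (extChartAt 𝓘(ℝ, E) m) m := contMDiffAt_extChartAt
  have hinv := isInvertible_mfderiv_extChartAt (I := 𝓘(ℝ, E))
    (mem_extChartAt_source (I := 𝓘(ℝ, E)) m)
  have hv' : (mfderiv 𝓘(ℝ, E) 𝓘(ℝ, E) (extChartAt 𝓘(ℝ, E) m) m v : E) ≠ 0 := fun h0 =>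
    hv (hinv.injective (h0.trans (map_zero _).symm))
  obtain ⟨ℓ, hℓ⟩ : ∃ ℓ : E →L[ℝ] ℝ,
      ℓ (mfderiv 𝓘(ℝ, E) 𝓘(ℝ, E) (extChartAt 𝓘(ℝ, E) m) m v) ≠ 0 := by
    by_contra! H
    exact hv' (SeparatingDual.eq_zero_of_forall_dual_eq_zero (R := ℝ) (V := E) H)
  obtain ⟨χ⟩ : Nonempty (SmoothBumpFunction 𝓘(ℝ, E) m) := inferInstance
  have hsm : ContMDiff 𝓘(ℝ, E) 𝓘(ℝ, E) ∞ (fun x => χ x • extChartAt 𝓘(ℝ, E) m x) :=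
    χ.contMDiff_smul contMDiffOn_extChartAt
  refine ⟨⟨fun x => ℓ (χ x • extChartAt 𝓘(ℝ, E) m x), ℓ.contMDiff.comp hsm⟩, ?_⟩
  have he : (fun x => ℓ (χ x • extChartAt 𝓘(ℝ, E) m x)) =ᶠ[𝓝 m] ℓ ∘ extChartAt 𝓘(ℝ, E) m := by
    filter_upwards [χ.eventuallyEq_one] with x hx
    simp [hx]
  have h3 := mfderiv_comp (I := 𝓘(ℝ, E)) (I' := 𝓘(ℝ, E)) (I'' := 𝓘(ℝ, ℝ)) m
    (ℓ.contMDiff.contMDiffAt.mdifferentiableAt (by simp : (∞ : WithTop ℕ∞) ≠ 0))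
    (hchart.mdifferentiableAt (by simp))
  intro h0
  have h1 : mfderiv 𝓘(ℝ, E) 𝓘(ℝ, ℝ) (fun x => ℓ (χ x • extChartAt 𝓘(ℝ, E) m x)) m v = 0 := h0
  rw [he.mfderiv_eq, h3] at h1
  simp only [mfderiv_eq_fderiv, ContinuousLinearMap.fderiv] at h1
  exact hℓ h1

end TangentVectors

/-! ### Local trivializations, the module of sections and the anchor as a derivation. -/

namespace SmoothPrincipalBundle

open Topology

set_option linter.unusedSectionVars false

variable {EM EG EP M G P : Type*}
    [NormedAddCommGroup EM] [NormedSpace ℝ EM] [NormedAddCommGroup EG] [NormedSpace ℝ EG]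
    [NormedAddCommGroup EP] [NormedSpace ℝ EP]
    [TopologicalSpace M] [ChartedSpace EM M] [IsManifold 𝓘(ℝ, EM) ∞ M]
    [TopologicalSpace G] [ChartedSpace EG G] [Group G]
    [TopologicalSpace P] [ChartedSpace EP P] [IsManifold 𝓘(ℝ, EP) ∞ P]
    (B : SmoothPrincipalBundle EM EG EP M G P)

/-- An equivariant local trivialization of a principal bundle. -/
structure LocalTrivialization where
  base : Set M
  e : OpenPartialHomeomorph P (M × G)
  isOpen_base : IsOpen base
  source_eq : e.source = B.proj ⁻¹' base
  target_eq : e.target = base ×ˢ Set.univ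
  contMDiffOn : ContMDiffOn 𝓘(ℝ, EP) (𝓘(ℝ, EM).prod 𝓘(ℝ, EG)) ∞ e e.source
  contMDiffOn_symm : ContMDiffOn (𝓘(ℝ, EM).prod 𝓘(ℝ, EG)) 𝓘(ℝ, EP) ∞ e.symm e.target
  fst_apply : ∀ u ∈ e.source, (e u).1 = B.proj u
  apply_act : ∀ u ∈ e.source, ∀ g, e (B.act u g) = (B.proj u, (e u).2 * g)

theorem exists_localTrivialization (m : M) : ∃ t : B.LocalTrivialization, m ∈ t.base := by
  obtain ⟨U, e, h1, h2, h3, h4, h5, h6, h7, h8⟩ := B.exists_trivialization m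
  exact ⟨⟨U, e, h1, h3, h4, h5, h6, h7, h8⟩, h2⟩

namespace LocalTrivialization

variable {B} (t : B.LocalTrivialization)

/-- The point of `P` with coordinates `x` and `g`. -/
def pt (x : M) (g : G) : P := t.e.symm (x, g)

theorem mem_target {x : M} (hx : x ∈ t.base) (g : G) : (x, g) ∈ t.e.target := by
  rw [t.target_eq]; exact ⟨hx, trivial⟩

theorem mem_source {u : P} : u ∈ t.e.source ↔ B.proj u ∈ t.base := by rw [t.source_eq]; rfl

theorem pt_mem_source {x : M} (hx : x ∈ t.base) (g : G) : t.pt x g ∈ t.e.source :=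
  t.e.map_target (t.mem_target hx g)

theorem apply_pt {x : M} (hx : x ∈ t.base) (g : G) : t.e (t.pt x g) = (x, g) :=
  t.e.right_inv (t.mem_target hx g)

theorem proj_pt {x : M} (hx : x ∈ t.base) (g : G) : B.proj (t.pt x g) = x := by
  rw [← t.fst_apply _ (t.pt_mem_source hx g), t.apply_pt hx]

theorem pt_proj {u : P} (hu : B.proj u ∈ t.base) : t.pt (B.proj u) (t.e u).2 = u := by
  have hus := t.mem_source.2 hu
  have : (B.proj u, (t.e u).2) = t.e u := Prod.ext (t.fst_apply u hus).symm rfl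
  rw [pt, this, t.e.left_inv hus]

theorem act_pt {x : M} (hx : x ∈ t.base) (g h : G) : B.act (t.pt x g) h = t.pt x (g * h) := by
  have h1 := t.pt_mem_source hx g
  have h2 : B.proj (B.act (t.pt x g) h) ∈ t.base := by rw [B.proj_act, t.proj_pt hx]; exact hx
  rw [← t.pt_proj h2, t.apply_act _ h1, t.apply_pt hx, B.proj_act, t.proj_pt hx]

theorem contMDiffAt_pt {x : M} (hx : x ∈ t.base) (g : G) :
    ContMDiffAt (𝓘(ℝ, EM).prod 𝓘(ℝ, EG)) 𝓘(ℝ, EP) ∞ (fun p : M × G => t.pt p.1 p.2) (x, g) :=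
  t.contMDiffOn_symm.contMDiffAt (t.e.open_target.mem_nhds (t.mem_target hx g))

theorem contMDiffAt_coord {u : P} (hu : B.proj u ∈ t.base) :
    ContMDiffAt 𝓘(ℝ, EP) 𝓘(ℝ, EG) ∞ (fun w => (t.e w).2) u :=
  _root_.contMDiffAt_snd.comp u (t.contMDiffOn.contMDiffAt
    (t.e.open_source.mem_nhds (t.mem_source.2 hu)))

end LocalTrivialization

theorem exists_act_eq {u w : P} (h : B.proj u = B.proj w) : ∃ g, B.act u g = w := by
  obtain ⟨t, ht⟩ := B.exists_localTrivialization (B.proj u)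
  refine ⟨(t.e u).2⁻¹ * (t.e w).2, ?_⟩
  have hw : B.proj w ∈ t.base := h ▸ ht
  have h1 := t.act_pt ht (t.e u).2 ((t.e u).2⁻¹ * (t.e w).2)
  rwa [t.pt_proj ht, mul_inv_cancel_left, h, t.pt_proj hw] at h1

theorem proj_surjective : Function.Surjective B.proj := fun m => by
  obtain ⟨t, ht⟩ := B.exists_localTrivialization m
  exact ⟨t.pt m 1, t.proj_pt ht 1⟩

variable [CompleteSpace EP]

/-- The smooth function `f ∘ proj`. -/
theorem contMDiff_comp_proj (f : C^∞⟮𝓘(ℝ, EM), M; ℝ⟯) :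
    ContMDiff 𝓘(ℝ, EP) 𝓘(ℝ, ℝ) ∞ (f ∘ B.proj) :=
  f.contMDiff.comp B.contMDiff_proj

instance : SMul C^∞⟮𝓘(ℝ, EM), M; ℝ⟯ B.atiyahAlgebra where
  smul f a := ⟨⟨fun u => f (B.proj u) • a.1 u,
      (B.contMDiff_comp_proj f).smul_section a.1.contMDiff⟩,
    fun g u => by
      change mfderiv 𝓘(ℝ, EP) 𝓘(ℝ, EP) (B.rightTranslation g) u (f (B.proj u) • a.1 u) =
        f (B.proj (B.rightTranslation g u)) • a.1 (B.rightTranslation g u)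
      rw [← a.2 g u, show B.proj (B.rightTranslation g u) = B.proj u from B.proj_act u g]
      exact map_smul _ _ _⟩

theorem smul_apply (f : C^∞⟮𝓘(ℝ, EM), M; ℝ⟯) (a : B.atiyahAlgebra) (u : P) :
    (f • a).1 u = f (B.proj u) • a.1 u := rfl

variable {B} in
theorem atiyahAlgebra_ext {a b : B.atiyahAlgebra} (h : ∀ u, a.1 u = b.1 u) : a = b :=
  Subtype.ext (ContMDiffSection.ext h)

theorem add_apply (a b : B.atiyahAlgebra) (u : P) : (a + b).1 u = a.1 u + b.1 u := rfl
theorem sub_apply (a b : B.atiyahAlgebra) (u : P) : (a - b).1 u = a.1 u - b.1 u := rfl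

instance : Module C^∞⟮𝓘(ℝ, EM), M; ℝ⟯ B.atiyahAlgebra where
  one_smul a := atiyahAlgebra_ext fun u => one_smul ℝ (a.1 u)
  mul_smul f g a := atiyahAlgebra_ext fun u => mul_smul (f (B.proj u)) (g (B.proj u)) (a.1 u)
  smul_zero f := atiyahAlgebra_ext fun u => smul_zero (f (B.proj u))
  smul_add f a b := atiyahAlgebra_ext fun u => smul_add (f (B.proj u)) (a.1 u) (b.1 u)
  add_smul f g a := atiyahAlgebra_ext fun u => add_smul (f (B.proj u)) (g (B.proj u)) (a.1 u)
  zero_smul a := atiyahAlgebra_ext fun u => zero_smul ℝ (a.1 u)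

instance : IsScalarTower ℝ C^∞⟮𝓘(ℝ, EM), M; ℝ⟯ B.atiyahAlgebra where
  smul_assoc c f a := atiyahAlgebra_ext fun u => smul_assoc c (f (B.proj u)) (a.1 u)

/-- The derivative of a smooth function on `M` along the anchor of a section. -/
def anchorApply (a : B.atiyahAlgebra) (f : C^∞⟮𝓘(ℝ, EM), M; ℝ⟯) (m : M) : ℝ :=
  mvfderiv 𝓘(ℝ, EP) (f ∘ B.proj) (Function.surjInv B.proj_surjective m)
    (a.1 (Function.surjInv B.proj_surjective m))

/-- The point chosen in the fibre to define `anchorApply` is immaterial, since derivatives of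
functions pulled back from M along an invariant field are constant on fibres. -/
theorem anchorApply_proj (a : B.atiyahAlgebra) (f : C^∞⟮𝓘(ℝ, EM), M; ℝ⟯) (u : P) :
    B.anchorApply a f (B.proj u) = mvfderiv 𝓘(ℝ, EP) (f ∘ B.proj) u (a.1 u) := by
  obtain ⟨g, hg⟩ := B.exists_act_eq (Function.surjInv_eq B.proj_surjective (B.proj u)).symm
  rw [anchorApply, ← hg]
  exact B.mvfderiv_comp_proj_act a.2 u g ((f.contMDiff _).mdifferentiableAt (by simp))

theorem contMDiff_anchorApply (a : B.atiyahAlgebra) (f : C^∞⟮𝓘(ℝ, EM), M; ℝ⟯) :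
    ContMDiff 𝓘(ℝ, EM) 𝓘(ℝ, ℝ) ∞ (B.anchorApply a f) := by
  intro m
  obtain ⟨t, ht⟩ := B.exists_localTrivialization m
  have h1 : ContMDiffAt 𝓘(ℝ, EM) 𝓘(ℝ, EP) ∞ (fun x => t.pt x 1) m :=
    (t.contMDiffAt_pt ht 1).comp m (contMDiffAt_id.prodMk contMDiffAt_const)
  have h2 := SmoothVectorField.contMDiffAt_mvfderiv_apply
    ((B.contMDiff_comp_proj f) (t.pt m 1)) a.1
  refine (h2.comp m h1).congr_of_eventuallyEq ?_
  filter_upwards [t.isOpen_base.mem_nhds ht] with x hx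
  conv_lhs => rw [← t.proj_pt hx 1]
  exact B.anchorApply_proj a f _

/-- The anchor, as a map from sections of the Atiyah algebroid to derivations. -/
def anchor : B.atiyahAlgebra →ₗ[C^∞⟮𝓘(ℝ, EM), M; ℝ⟯]
    Derivation ℝ C^∞⟮𝓘(ℝ, EM), M; ℝ⟯ C^∞⟮𝓘(ℝ, EM), M; ℝ⟯ where
  toFun a := Derivation.mk'
    { toFun := fun f => ⟨B.anchorApply a f, B.contMDiff_anchorApply a f⟩
      map_add' := fun f g => by
        ext m
        obtain ⟨u, rfl⟩ := B.proj_surjective m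
        change B.anchorApply a (f + g) _ = B.anchorApply a f _ + B.anchorApply a g _
        simp only [anchorApply_proj]
        have := mvfderiv_add (I := 𝓘(ℝ, EP)) (x := u)
          ((B.contMDiff_comp_proj f u).mdifferentiableAt (by simp))
          ((B.contMDiff_comp_proj g u).mdifferentiableAt (by simp))
        exact congrArg (fun l => l (a.1 u)) this
      map_smul' := fun c f => by
        ext m
        obtain ⟨u, rfl⟩ := B.proj_surjective m
        change B.anchorApply a (c • f) _ = c * B.anchorApply a f _
        simp only [anchorApply_proj]
        have := mvfderiv_mul (I := 𝓘(ℝ, EP)) (x := u) (f := fun _ => c) mdifferentiableAt_const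
          ((B.contMDiff_comp_proj f u).mdifferentiableAt (by simp))
        have := congrArg (fun l => l (a.1 u)) this
        simp only [mvfderiv_const, smul_zero, add_zero] at this
        exact this }
    (fun f g => by
        ext m
        obtain ⟨u, rfl⟩ := B.proj_surjective m
        change B.anchorApply a (f * g) _ =
          f (B.proj u) * B.anchorApply a g _ + g (B.proj u) * B.anchorApply a f _
        simp only [anchorApply_proj]
        have := mvfderiv_mul (I := 𝓘(ℝ, EP)) (x := u)
          ((B.contMDiff_comp_proj f u).mdifferentiableAt (by simp))
          ((B.contMDiff_comp_proj g u).mdifferentiableAt (by simp))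
        exact congrArg (fun l => l (a.1 u)) this)
  map_add' a b := by
    ext f m
    obtain ⟨u, rfl⟩ := B.proj_surjective m
    change B.anchorApply (a + b) f _ = B.anchorApply a f _ + B.anchorApply b f _
    simp only [anchorApply_proj, add_apply, map_add]
  map_smul' g a := by
    ext f m
    obtain ⟨u, rfl⟩ := B.proj_surjective m
    change B.anchorApply (g • a) f _ = g (B.proj u) * B.anchorApply a f _
    simp only [anchorApply_proj, smul_apply, map_smul, smul_eq_mul]

theorem anchor_apply_proj (a : B.atiyahAlgebra) (f : C^∞⟮𝓘(ℝ, EM), M; ℝ⟯) (u : P) :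
    B.anchor a f (B.proj u) = mvfderiv 𝓘(ℝ, EP) (f ∘ B.proj) u (a.1 u) :=
  B.anchorApply_proj a f u

theorem anchor_apply_proj' (a : B.atiyahAlgebra) (f : C^∞⟮𝓘(ℝ, EM), M; ℝ⟯) (u : P) :
    B.anchor a f (B.proj u) = mvfderiv 𝓘(ℝ, EM) f (B.proj u)
      (mfderiv 𝓘(ℝ, EP) 𝓘(ℝ, EM) B.proj u (a.1 u)) := by
  rw [anchor_apply_proj, mvfderiv_comp u ((f.contMDiff _).mdifferentiableAt (by simp))
    (B.mdifferentiableAt_proj u)]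
  rfl

theorem lie_smul_eq (a : B.atiyahAlgebra) (f : C^∞⟮𝓘(ℝ, EM), M; ℝ⟯) (b : B.atiyahAlgebra) :
    ⁅a, f • b⁆ = f • ⁅a, b⁆ + B.anchor a f • b := by
  refine atiyahAlgebra_ext fun u => ?_
  rw [add_apply, smul_apply, smul_apply, anchor_apply_proj, add_comm]
  exact mlieBracket_smul_right ((B.contMDiff_comp_proj f u).mdifferentiableAt (by simp))
    (b.1.mdifferentiableAt u)

end SmoothPrincipalBundle

/-! ### Calculus lemmas: chain rule on model spaces and derivatives with parameters. -/

section ChainRule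

variable {E₁ E₂ E₃ M₁ M₂ M₃ : Type*} [NormedAddCommGroup E₁] [NormedSpace ℝ E₁]
    [NormedAddCommGroup E₂] [NormedSpace ℝ E₂] [NormedAddCommGroup E₃] [NormedSpace ℝ E₃]
    [TopologicalSpace M₁] [ChartedSpace E₁ M₁] [TopologicalSpace M₂] [ChartedSpace E₂ M₂]
    [TopologicalSpace M₃] [ChartedSpace E₃ M₃]

/-- The chain rule, with the tangent spaces at `f x` and at `y = f x` identified with the model
space. -/
theorem mfderiv_comp_model_apply {f : M₁ → M₂} {g : M₂ → M₃} {x : M₁} {y : M₂} (hy : f x = y)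
    (hg : MDifferentiableAt 𝓘(ℝ, E₂) 𝓘(ℝ, E₃) g y) (hf : MDifferentiableAt 𝓘(ℝ, E₁) 𝓘(ℝ, E₂) f x)
    (v : E₁) : (mfderiv 𝓘(ℝ, E₁) 𝓘(ℝ, E₃) (g ∘ f) x v : E₃) =
      mfderiv 𝓘(ℝ, E₂) 𝓘(ℝ, E₃) g y (mfderiv 𝓘(ℝ, E₁) 𝓘(ℝ, E₂) f x v : E₂) := by
  subst hy
  exact mfderiv_comp_apply (I := 𝓘(ℝ, E₁)) (I' := 𝓘(ℝ, E₂)) (I'' := 𝓘(ℝ, E₃)) x hg hf v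

end ChainRule

section ParametricDerivative

open Topology

variable {E E' N P : Type*} [NormedAddCommGroup E] [NormedSpace ℝ E] [NormedAddCommGroup E']
    [NormedSpace ℝ E'] [TopologicalSpace P] [ChartedSpace E P] [IsManifold 𝓘(ℝ, E) ∞ P]
    [TopologicalSpace N] [ChartedSpace E' N] [IsManifold 𝓘(ℝ, E') ∞ N]

/-- The velocity field `u ↦ ∂F(u, y)/∂y` at `y = y₀` of a smooth deformation `F` of the identity is
smooth. -/
theorem contMDiffAt_mfderiv_of_deformation {F : P → N → P} {y₀ : N} {u₀ : P}
    (hF : ContMDiffAt (𝓘(ℝ, E).prod 𝓘(ℝ, E')) 𝓘(ℝ, E) ∞ (Function.uncurry F) (u₀, y₀))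
    (hid : ∀ᶠ u in 𝓝 u₀, F u y₀ = u) (w : TangentSpace 𝓘(ℝ, E') y₀) :
    ContMDiffAt 𝓘(ℝ, E) (𝓘(ℝ, E).prod 𝓘(ℝ, E)) ∞ (fun u => (Bundle.TotalSpace.mk' E u
      (mfderiv 𝓘(ℝ, E') 𝓘(ℝ, E) (F u) y₀ w) : TangentBundle 𝓘(ℝ, E) P)) u₀ := by
  have A := ContMDiffAt.mfderiv (m := ∞) F (fun _ => y₀) hF contMDiffAt_const (by simp)
  have hb : ContMDiffAt 𝓘(ℝ, E) 𝓘(ℝ, E) ∞ (fun u => F u y₀) u₀ :=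
    contMDiffAt_id.congr_of_eventuallyEq hid
  have hc : ContMDiffAt 𝓘(ℝ, E) (𝓘(ℝ, E').prod 𝓘(ℝ, E')) ∞
      (fun _ : P => (Bundle.TotalSpace.mk' E' y₀ w : TangentBundle 𝓘(ℝ, E') N)) u₀ :=
    contMDiffAt_const
  have h := ContMDiffAt.clm_apply_of_inCoordinates (n := ∞) (E₁ := TangentSpace 𝓘(ℝ, E'))
    (E₂ := TangentSpace 𝓘(ℝ, E)) (ϕ := fun u => mfderiv 𝓘(ℝ, E') 𝓘(ℝ, E) (F u) y₀)
    (v := fun _ => w) (b₁ := fun _ => y₀) (b₂ := fun u => F u y₀) A hc hb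
  refine h.congr_of_eventuallyEq ?_
  have haux : ∀ (x y : P) (_ : x = y) (v : E), (Bundle.TotalSpace.mk' E x v :
      TangentBundle 𝓘(ℝ, E) P) = Bundle.TotalSpace.mk' E y v := by
    rintro x _ rfl v; rfl
  filter_upwards [hid] with u hu
  exact haux _ _ hu.symm _

end ParametricDerivative

/-! ### Pointwise criteria, the kernel as a module, construction of invariant fields. -/

namespace SmoothPrincipalBundle

open Topology

set_option linter.unusedSectionVars false

variable {EM EG EP M G P : Type*}
    [NormedAddCommGroup EM] [NormedSpace ℝ EM] [NormedAddCommGroup EG] [NormedSpace ℝ EG]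
    [NormedAddCommGroup EP] [NormedSpace ℝ EP]
    [TopologicalSpace M] [ChartedSpace EM M] [IsManifold 𝓘(ℝ, EM) ∞ M]
    [TopologicalSpace G] [ChartedSpace EG G] [Group G]
    [TopologicalSpace P] [ChartedSpace EP P] [IsManifold 𝓘(ℝ, EP) ∞ P]
    (B : SmoothPrincipalBundle EM EG EP M G P) [CompleteSpace EP]

variable {B}

/-- The group acts transitively on the fibre, so by invariance one point of the fibre decides. -/
theorem mem_vanishingAt_iff {a : B.atiyahAlgebra} {m : M} {u : P} (hu : B.proj u = m) :
    a ∈ B.vanishingAt m ↔ a.1 u = 0 := by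
  constructor
  · intro h
    exact congrFun (congrArg Subtype.val (h : B.value m a = 0)) ⟨u, hu⟩
  · intro h
    refine Subtype.ext (funext fun w => ?_)
    obtain ⟨g, hg⟩ := B.exists_act_eq (hu.trans w.2.symm)
    change a.1 w.1 = 0
    have h1 := a.2 g u
    rw [h] at h1
    rw [← hg]
    exact h1.symm.trans (map_zero _)

theorem mem_anchorVanishingAt_iff {a : B.atiyahAlgebra} {m : M} {u : P} (hu : B.proj u = m) :
    a ∈ B.anchorVanishingAt m ↔ mfderiv 𝓘(ℝ, EP) 𝓘(ℝ, EM) B.proj u (a.1 u) = 0 := by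
  constructor
  · intro h
    exact (h : B.value m a ∈ B.kernelFiber m) ⟨u, hu⟩
  · intro h
    rintro ⟨w, hw⟩
    obtain ⟨g, rfl⟩ := B.exists_act_eq (hu.trans hw.symm)
    change mfderiv 𝓘(ℝ, EP) 𝓘(ℝ, EM) B.proj (B.rightTranslation g u)
      (a.1 (B.rightTranslation g u)) = 0
    rw [← a.2 g u]
    have hc : B.proj ∘ B.rightTranslation g = B.proj := funext fun y => B.proj_act y g
    have h1 := mfderiv_comp (I := 𝓘(ℝ, EP)) (I' := 𝓘(ℝ, EP)) (I'' := 𝓘(ℝ, EM)) u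
      (B.mdifferentiableAt_proj (B.rightTranslation g u))
      (B.mdifferentiableAt_rightTranslation g u)
    have h2 := congrArg (fun l : EP →L[ℝ] EM => l (a.1 u)) h1
    rw [hc] at h2
    exact h2.symm.trans h

theorem mem_kernel_iff {a : B.atiyahAlgebra} :
    a ∈ B.kernel ↔ ∀ u, mfderiv 𝓘(ℝ, EP) 𝓘(ℝ, EM) B.proj u (a.1 u) = 0 :=
  ⟨fun h u => h (B.proj u) ⟨u, rfl⟩, fun h _ u => h u.1⟩

theorem mem_kernelVanishingAt_iff {k : B.kernel} {m : M} :
    k ∈ B.kernelVanishingAt m ↔ k.1 ∈ B.vanishingAt m := Iff.rfl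

theorem anchor_kernel (k : B.kernel) : B.anchor k.1 = 0 := by
  ext f m
  obtain ⟨u, rfl⟩ := B.proj_surjective m
  rw [anchor_apply_proj', mem_kernel_iff.1 k.2 u, map_zero]
  rfl

variable [FiniteDimensional ℝ EM] [T2Space M] in
theorem mem_anchorVanishingAt_iff_anchor {a : B.atiyahAlgebra} {m : M} :
    a ∈ B.anchorVanishingAt m ↔ ∀ f, B.anchor a f m = 0 := by
  obtain ⟨u, rfl⟩ := B.proj_surjective m
  rw [mem_anchorVanishingAt_iff rfl]
  constructor
  · intro h f
    rw [anchor_apply_proj', h, map_zero]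
  · intro h
    by_contra h0
    obtain ⟨f, hf⟩ := ContMDiffMap.exists_mvfderiv_ne_zero h0
    exact hf (by rw [← anchor_apply_proj']; exact h f)

theorem smul_mem_kernel (f : C^∞⟮𝓘(ℝ, EM), M; ℝ⟯) {a : B.atiyahAlgebra} (ha : a ∈ B.kernel) :
    f • a ∈ B.kernel := by
  rw [mem_kernel_iff] at *
  intro u
  rw [smul_apply]
  refine (map_smul _ (f (B.proj u)) (a.1 u)).trans ?_
  rw [ha u, smul_zero]

instance : SMul C^∞⟮𝓘(ℝ, EM), M; ℝ⟯ B.kernel where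
  smul f k := ⟨f • k.1, smul_mem_kernel f k.2⟩

theorem coe_smul_kernel (f : C^∞⟮𝓘(ℝ, EM), M; ℝ⟯) (k : B.kernel) :
    ((f • k : B.kernel) : B.atiyahAlgebra) = f • (k : B.atiyahAlgebra) := rfl

instance : Module C^∞⟮𝓘(ℝ, EM), M; ℝ⟯ B.kernel :=
  Function.Injective.module _ (B.kernel.toSubmodule.subtype.toAddMonoidHom)
    Subtype.val_injective (fun _ _ => rfl)

instance : IsScalarTower ℝ C^∞⟮𝓘(ℝ, EM), M; ℝ⟯ B.kernel where
  smul_assoc c f k := Subtype.ext (smul_assoc c f (k : B.atiyahAlgebra))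

theorem lie_smul_kernel_eq (a : B.atiyahAlgebra) (f : C^∞⟮𝓘(ℝ, EM), M; ℝ⟯) (k : B.kernel) :
    ⁅a, f • k⁆ = f • ⁅a, k⁆ + B.anchor a f • k :=
  Subtype.ext (B.lie_smul_eq a f k.1)

/-- The derivative term involves the anchor of k, which is zero. This is the linearity that
`cofg_conductorIdeal_of_stable` asks for. -/
theorem smul_lie_kernel_eq (f : C^∞⟮𝓘(ℝ, EM), M; ℝ⟯) (a : B.atiyahAlgebra) (k : B.kernel) :
    ⁅f • a, k⁆ = f • ⁅a, k⁆ := by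
  refine Subtype.ext ((smul_lie_of_leibniz B.lie_smul_eq f a k.1).trans ?_)
  rw [anchor_kernel]
  exact (congrArg _ (zero_smul _ a)).trans (sub_zero _)

theorem kernel_lie_smul (f : C^∞⟮𝓘(ℝ, EM), M; ℝ⟯) (k l : B.kernel) :
    ⁅k, f • l⁆ = f • ⁅k, l⁆ := by
  refine Subtype.ext ((B.lie_smul_eq k.1 f l.1).trans ?_)
  rw [anchor_kernel]
  exact (congrArg _ (zero_smul _ l.1)).trans (add_zero _)

section LocalFields

variable {EN N : Type*} [NormedAddCommGroup EN] [NormedSpace ℝ EN] [TopologicalSpace N]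
    [ChartedSpace EN N] [IsManifold 𝓘(ℝ, EN) ∞ N]

/-- A local equivariant deformation `F` of the identity of `P` defines, after multiplication by
a cutoff function, an invariant vector field. -/
theorem exists_invariantField {O : Set M} (hO : IsOpen O) {F : P → N → P} {y₀ : N}
    (hF : ∀ u, B.proj u ∈ O →
      ContMDiffAt (𝓘(ℝ, EP).prod 𝓘(ℝ, EN)) 𝓘(ℝ, EP) ∞ (Function.uncurry F) (u, y₀))
    (hid : ∀ u, B.proj u ∈ O → F u y₀ = u)
    (hact : ∀ u, B.proj u ∈ O → ∀ g, ∀ᶠ y in 𝓝 y₀, F (B.act u g) y = B.act (F u y) g)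
    (w : TangentSpace 𝓘(ℝ, EN) y₀) {χ : C^∞⟮𝓘(ℝ, EM), M; ℝ⟯} (hχ : tsupport χ ⊆ O) :
    ∃ a : B.atiyahAlgebra, ∀ u,
      a.1 u = χ (B.proj u) • (mfderiv 𝓘(ℝ, EN) 𝓘(ℝ, EP) (F u) y₀ w : EP) := by
  have hO' : IsOpen (B.proj ⁻¹' O) := hO.preimage B.contMDiff_proj.continuous
  let s : ∀ u : P, TangentSpace 𝓘(ℝ, EP) u := fun u =>
    (mfderiv 𝓘(ℝ, EN) 𝓘(ℝ, EP) (F u) y₀ w : EP)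
  have hs : ContMDiffOn 𝓘(ℝ, EP) (𝓘(ℝ, EP).prod 𝓘(ℝ, EP)) ∞
      (fun u => (s u : TangentBundle 𝓘(ℝ, EP) P)) (B.proj ⁻¹' O) := fun u hu =>
    (contMDiffAt_mfderiv_of_deformation (hF u hu)
      (Filter.eventually_of_mem (hO'.mem_nhds hu) hid) w).contMDiffWithinAt
  have hsupp : tsupport (χ ∘ B.proj) ⊆ B.proj ⁻¹' O :=
    (tsupport_comp_subset_preimage χ B.contMDiff_proj.continuous).trans (Set.preimage_mono hχ)
  have hsm := ContMDiffOn.smul_section_of_tsupport (B.contMDiff_comp_proj χ).contMDiffOn hO' hsupp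
    hs
  refine ⟨⟨⟨(χ ∘ B.proj) • s, hsm⟩, fun g u => ?_⟩, fun u => rfl⟩
  change mfderiv 𝓘(ℝ, EP) 𝓘(ℝ, EP) (B.rightTranslation g) u (χ (B.proj u) • s u) =
    χ (B.proj (B.act u g)) • s (B.act u g)
  rw [B.proj_act]
  refine (map_smul _ _ _).trans ?_
  by_cases hu : B.proj u ∈ O
  · congr 1
    have hFu : MDifferentiableAt 𝓘(ℝ, EN) 𝓘(ℝ, EP) (F u) y₀ := by
      have h1 : ContMDiffAt 𝓘(ℝ, EN) 𝓘(ℝ, EP) ∞ (Function.uncurry F ∘ fun y => (u, y)) y₀ :=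
        (hF u hu).comp y₀ (contMDiffAt_const.prodMk contMDiffAt_id)
      exact h1.mdifferentiableAt (by simp)
    have hev : F (B.act u g) =ᶠ[𝓝 y₀] B.rightTranslation g ∘ F u := hact u hu g
    have h2 := mfderiv_comp_model_apply (hid u hu) (B.mdifferentiableAt_rightTranslation g u) hFu w
    have h3 := hev.mfderiv_eq (I := 𝓘(ℝ, EN)) (I' := 𝓘(ℝ, EP))
    exact ((congrArg (fun l : EN →L[ℝ] EP => l w) h3).trans h2).symm
  · have h0 : χ (B.proj u) = 0 :=
      image_eq_zero_of_notMem_tsupport fun h => hu (hχ h)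
    rw [h0]
    exact (zero_smul ℝ _).trans (zero_smul ℝ _).symm

end LocalFields

end SmoothPrincipalBundle

/-! ### Sections with prescribed anchor and the maximal finite-codimensional subalgebras. -/

namespace SmoothPrincipalBundle

open Topology

set_option linter.unusedSectionVars false

variable {EM EG EP M G P : Type*}
    [NormedAddCommGroup EM] [NormedSpace ℝ EM] [NormedAddCommGroup EG] [NormedSpace ℝ EG]
    [NormedAddCommGroup EP] [NormedSpace ℝ EP]
    [TopologicalSpace M] [ChartedSpace EM M] [IsManifold 𝓘(ℝ, EM) ∞ M]
    [TopologicalSpace G] [ChartedSpace EG G] [Group G]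
    [TopologicalSpace P] [ChartedSpace EP P] [IsManifold 𝓘(ℝ, EP) ∞ P]
    (B : SmoothPrincipalBundle EM EG EP M G P) [CompleteSpace EP]
    [FiniteDimensional ℝ EM] [T2Space M]

/-- Every tangent vector of `M` at which `f` has nonzero derivative is the anchor of a section. -/
theorem exists_anchor_eq_one {f : C^∞⟮𝓘(ℝ, EM), M; ℝ⟯} {m : M}
    (hf : mfderiv 𝓘(ℝ, EM) 𝓘(ℝ, ℝ) f m ≠ 0) : ∃ a : B.atiyahAlgebra, B.anchor a f m = 1 := by
  obtain ⟨t, ht⟩ := B.exists_localTrivialization m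
  set χ := extChartAt 𝓘(ℝ, EM) m
  have hm : m ∈ χ.source := mem_extChartAt_source m
  have hsymm : ∀ x ∈ χ.source, ContMDiffAt 𝓘(ℝ, EM) 𝓘(ℝ, EM) ∞ χ.symm (χ x) := fun x hx =>
    (contMDiffOn_extChartAt_symm m).contMDiffAt
      ((isOpen_extChartAt_target m).mem_nhds (χ.map_source hx))
  have hχ : ∀ x ∈ χ.source, ContMDiffAt 𝓘(ℝ, EM) 𝓘(ℝ, EM) ∞ χ x := fun x hx =>
    contMDiffAt_extChartAt' (by rwa [← extChartAt_source 𝓘(ℝ, EM)])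
  have hfd : ∀ x ∈ χ.source, MDifferentiableAt 𝓘(ℝ, EM) 𝓘(ℝ, ℝ) (f ∘ χ.symm) (χ x) :=
    fun x hx => ((f.contMDiff _).comp _ (hsymm x hx)).mdifferentiableAt (by simp)
  obtain ⟨w, hw⟩ : ∃ w : EM, (mfderiv 𝓘(ℝ, EM) 𝓘(ℝ, ℝ) (f ∘ χ.symm) (χ m) w : ℝ) ≠ 0 := by
    by_contra! h0
    refine hf (ContinuousLinearMap.ext fun v => ?_)
    have he : f =ᶠ[𝓝 m] (f ∘ χ.symm) ∘ χ := by
      filter_upwards [extChartAt_source_mem_nhds (I := 𝓘(ℝ, EM)) m] with x hx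
      exact congrArg f (χ.left_inv hx).symm
    rw [he.mfderiv_eq]
    exact (mfderiv_comp_model_apply rfl (hfd m hm)
      ((hχ m hm).mdifferentiableAt (by simp)) v).trans (h0 _)
  let O : Set M := t.base ∩ χ.source
  have hO : IsOpen O := t.isOpen_base.inter (isOpen_extChartAt_source m)
  -- Translation in a chart of M, lifted to P by keeping the group coordinate fixed; it commutes
  -- with the right action.
  let F : P → EM → P := fun u v => t.pt (χ.symm (χ (B.proj u) + v)) (t.e u).2
  have hF : ∀ u, B.proj u ∈ O →
      ContMDiffAt (𝓘(ℝ, EP).prod 𝓘(ℝ, EM)) 𝓘(ℝ, EP) ∞ (Function.uncurry F) (u, 0) := by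
    intro u hu
    have h1 : ContMDiffAt (𝓘(ℝ, EP).prod 𝓘(ℝ, EM)) 𝓘(ℝ, EM) ∞
        (fun p : P × EM => χ (B.proj p.1) + p.2) (u, 0) :=
      (((hχ _ hu.2).comp u (B.contMDiff_proj u)).comp (u, (0 : EM)) contMDiffAt_fst).add
        contMDiffAt_snd
    have h2 : ContMDiffAt (𝓘(ℝ, EP).prod 𝓘(ℝ, EM)) 𝓘(ℝ, EM) ∞
        (fun p : P × EM => χ.symm (χ (B.proj p.1) + p.2)) (u, 0) := by
      refine ContMDiffAt.comp (u, (0 : EM)) ?_ h1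
      simp only [add_zero]
      exact hsymm _ hu.2
    have h3 : ContMDiffAt (𝓘(ℝ, EP).prod 𝓘(ℝ, EM)) 𝓘(ℝ, EG) ∞
        (fun p : P × EM => (t.e p.1).2) (u, 0) :=
      ContMDiffAt.comp (u, (0 : EM)) (g := fun w => (t.e w).2) (t.contMDiffAt_coord hu.1)
        contMDiffAt_fst
    refine ContMDiffAt.comp (u, (0 : EM)) (g := fun p : M × G => t.pt p.1 p.2) ?_ (h2.prodMk h3)
    simp only [add_zero, χ.left_inv hu.2]
    exact t.contMDiffAt_pt hu.1 _
  have hev : ∀ u, B.proj u ∈ O → ∀ᶠ v in 𝓝 (0 : EM), χ.symm (χ (B.proj u) + v) ∈ t.base := by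
    intro u hu
    have hc : ContinuousAt (fun v : EM => χ.symm (χ (B.proj u) + v)) 0 := by
      refine ContinuousAt.comp (g := χ.symm) ?_ (continuousAt_const.add continuousAt_id)
      simp only [add_zero]
      exact (hsymm _ hu.2).continuousAt
    refine hc.eventually_mem (t.isOpen_base.mem_nhds ?_)
    rw [add_zero, χ.left_inv hu.2]
    exact hu.1
  have hid : ∀ u, B.proj u ∈ O → F u 0 = u := fun u hu => by
    simp only [F, add_zero, χ.left_inv hu.2]
    exact t.pt_proj hu.1
  obtain ⟨b, hb, hb1⟩ := ContMDiffMap.exists_bump (E := EM) (hO.mem_nhds ⟨ht, hm⟩)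
  obtain ⟨a, ha⟩ := exists_invariantField (B := B) hO (F := F) (y₀ := (0 : EM)) hF hid
    (fun u hu g => by
      filter_upwards [hev u hu] with v hv
      simp only [F, B.proj_act, t.apply_act u (t.mem_source.2 hu.1) g]
      exact (t.act_pt hv _ _).symm) w hb
  let r : ℝ := mfderiv 𝓘(ℝ, EM) 𝓘(ℝ, ℝ) (f ∘ χ.symm) (χ m) w
  have key : B.anchor a f m = r := by
    obtain ⟨u, hu⟩ := B.proj_surjective m
    have huO : B.proj u ∈ O := by rw [hu]; exact ⟨ht, hm⟩
    have h1 : B.anchor a f m = mvfderiv 𝓘(ℝ, EP) (f ∘ B.proj) u (a.1 u) := by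
      rw [← hu]; exact B.anchor_apply_proj a f u
    have h2 : a.1 u = (mfderiv 𝓘(ℝ, EM) 𝓘(ℝ, EP) (F u) 0 w : EP) := by
      rw [ha u, hu, hb1.eq_of_nhds]; exact one_smul ℝ _
    have hFu : MDifferentiableAt 𝓘(ℝ, EM) 𝓘(ℝ, EP) (F u) 0 := by
      have h1 : ContMDiffAt 𝓘(ℝ, EM) 𝓘(ℝ, EP) ∞
          (Function.uncurry F ∘ fun y => (u, y)) (0 : EM) :=
        (hF u huO).comp (0 : EM) (contMDiffAt_const.prodMk contMDiffAt_id)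
      exact h1.mdifferentiableAt (by simp)
    have h3 := mfderiv_comp_model_apply (hid u huO)
      ((B.contMDiff_comp_proj f u).mdifferentiableAt (by simp)) hFu w
    have h4 : (f ∘ B.proj) ∘ F u =ᶠ[𝓝 0] (f ∘ χ.symm) ∘ fun v => χ m + v := by
      filter_upwards [hev u huO] with v hv
      rw [hu] at hv
      simp only [Function.comp_apply, F, hu, t.proj_pt hv]
    have h5 : HasMFDerivAt 𝓘(ℝ, EM) 𝓘(ℝ, EM) (fun v : EM => χ m + v) 0
        (ContinuousLinearMap.id ℝ EM) :=
      ((hasFDerivAt_id (0 : EM)).const_add (χ m)).hasMFDerivAt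
    have h6 := mfderiv_comp_model_apply (x := (0 : EM)) (add_zero (χ m)) (hfd m hm)
      h5.mdifferentiableAt w
    rw [h5.mfderiv] at h6
    rw [h1, h2]
    refine h3.symm.trans ?_
    rw [h4.mfderiv_eq]
    exact h6
  refine ⟨r⁻¹ • a, ?_⟩
  have h7 : B.anchor (r⁻¹ • a) f m = r⁻¹ * B.anchor a f m := by
    obtain ⟨u, rfl⟩ := B.proj_surjective m
    rw [anchor_apply_proj, anchor_apply_proj]
    exact map_smul _ r⁻¹ (a.1 u)
  rw [h7, key]
  exact inv_mul_cancel₀ hw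

theorem exists_finsum_smul {ι : Type*} {ρ : ι → C^∞⟮𝓘(ℝ, EM), M; ℝ⟯}
    (hρ : LocallyFinite fun i => Function.support (ρ i)) (a : ι → B.atiyahAlgebra) :
    ∃ b : B.atiyahAlgebra, ∀ u, b.1 u = ∑ᶠ i, ρ i (B.proj u) • (a i).1 u := by
  have hsub : ∀ (f : C^∞⟮𝓘(ℝ, EM), M; ℝ⟯) (c : B.atiyahAlgebra) (u : P),
      f (B.proj u) • c.1 u ≠ 0 → f (B.proj u) ≠ 0 := fun f c u h h0 =>
    h (by rw [h0]; exact zero_smul ℝ _)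
  have hsm := ContMDiff.finsum_section_of_locallyFinite (I := 𝓘(ℝ, EP)) (F := EP) (n := ∞)
    (V := (TangentSpace 𝓘(ℝ, EP) : P → Type _)) (t := fun i u => ρ i (B.proj u) • (a i).1 u)
    ((hρ.preimage_continuous B.contMDiff_proj.continuous).subset
      fun i u hu => hsub (ρ i) (a i) u hu)
    (fun i => (ρ i • a i).1.contMDiff)
  refine ⟨⟨⟨_, hsm⟩, fun g u => ?_⟩, fun u => rfl⟩
  change mfderiv 𝓘(ℝ, EP) 𝓘(ℝ, EP) (B.rightTranslation g) u
    (∑ᶠ i, ρ i (B.proj u) • (a i).1 u : EP) =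
    ∑ᶠ i, ρ i (B.proj (B.act u g)) • (a i).1 (B.act u g)
  have hfin : (Function.support fun i => ((ρ i (B.proj u) • (a i).1 u : EP))).Finite :=
    (hρ.point_finite (B.proj u)).subset fun i hi => hsub (ρ i) (a i) u hi
  let l : EP →L[ℝ] EP := mfderiv 𝓘(ℝ, EP) 𝓘(ℝ, EP) (B.rightTranslation g) u
  refine (l.toLinearMap.toAddMonoidHom.map_finsum hfin).trans ?_
  exact finsum_congr fun i => (ρ i • a i).2 g u

variable [SecondCountableTopology M]

/-- Positivity of the sum is preserved by convex combinations, so local solutions can be glued by a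
partition of unity. -/
theorem exists_anchor_sum_pos {h : Fin 2 → C^∞⟮𝓘(ℝ, EM), M; ℝ⟯}
    (hh : ∀ x, ∃ j, mfderiv 𝓘(ℝ, EM) 𝓘(ℝ, ℝ) (h j) x ≠ 0) :
    ∃ a : Fin 2 → B.atiyahAlgebra, ∀ m, 0 < ∑ j, B.anchor (a j) (h j) m := by
  have := ChartedSpace.locallyCompactSpace EM M
  have hloc : ∀ x, ∃ a : Fin 2 → B.atiyahAlgebra, 0 < ∑ j, B.anchor (a j) (h j) x := by
    intro x
    obtain ⟨j, hj⟩ := hh x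
    obtain ⟨a, ha⟩ := B.exists_anchor_eq_one hj
    refine ⟨Pi.single j a, ?_⟩
    rw [Finset.sum_eq_single j]
    · rw [Pi.single_eq_same, ha]; exact one_pos
    · intro i _ hi
      rw [Pi.single_eq_of_ne hi, map_zero]
      rfl
    · intro h; exact absurd (Finset.mem_univ j) h
  choose a ha using hloc
  let U : M → Set M := fun x => {y | 0 < ∑ j, B.anchor (a x j) (h j) y}
  have hU : ∀ x, IsOpen (U x) := fun x =>
    isOpen_lt continuous_const (continuous_finsetSum _ fun j _ =>
      (B.anchor (a x j) (h j)).contMDiff.continuous)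
  obtain ⟨ρ, hρ⟩ := SmoothPartitionOfUnity.exists_isSubordinate 𝓘(ℝ, EM) isClosed_univ U hU
    (fun x _ => Set.mem_iUnion.2 ⟨x, ha x⟩)
  have hfs := fun j => B.exists_finsum_smul ρ.locallyFinite (fun x => a x j)
  choose b hb using hfs
  refine ⟨b, fun m => ?_⟩
  obtain ⟨u, rfl⟩ := B.proj_surjective m
  have hanchor : ∀ j, B.anchor (b j) (h j) (B.proj u) =
      ∑ᶠ x, ρ x (B.proj u) * B.anchor (a x j) (h j) (B.proj u) := by
    intro j
    rw [anchor_apply_proj, hb j u]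
    have hfin : (Function.support fun x => ((ρ x (B.proj u) • (a x j).1 u : EP))).Finite :=
      (ρ.locallyFinite.point_finite (B.proj u)).subset fun i hi h0 =>
        hi (by
          change ρ i (B.proj u) • ((a i j).1 u : EP) = 0
          rw [show ρ i (B.proj u) = 0 from h0, zero_smul])
    let l : EP →L[ℝ] ℝ := mvfderiv 𝓘(ℝ, EP) (h j ∘ B.proj) u
    refine (l.toLinearMap.toAddMonoidHom.map_finsum hfin).trans ?_
    refine finsum_congr fun x => ?_
    rw [anchor_apply_proj]
    exact map_smul (mvfderiv 𝓘(ℝ, EP) (h j ∘ B.proj) u) (ρ x (B.proj u)) ((a x j).1 u)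
  have hfin : ∀ c : M → ℝ, (Function.support fun x => ρ x (B.proj u) * c x).Finite := fun c =>
    (ρ.locallyFinite.point_finite (B.proj u)).subset fun i hi => left_ne_zero_of_mul hi
  simp only [hanchor]
  rw [← finsum_sum_comm _ _ fun j _ => hfin _]
  simp only [← Finset.mul_sum]
  obtain ⟨x, hx⟩ := ρ.exists_pos_of_mem (Set.mem_univ (B.proj u))
  refine finsum_pos (fun y => ?_) ⟨x, ?_⟩ (hfin _)
  · by_cases hy : ρ y (B.proj u) = 0
    · rw [hy, zero_mul]
    · exact mul_nonneg (ρ.nonneg y _)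
        (le_of_lt (show (0 : ℝ) < _ from hρ y (subset_closure hy)))
  · exact mul_pos hx (hρ x (subset_closure hx.ne'))

variable [Nontrivial EM]

/-- This supplies the invertible sum of squares needed by both finite-codimension criteria: where
the plain sum of the two derivatives is positive, they cannot both vanish. -/
theorem exists_isUnit_sum_anchor_sq : ∃ (a : Fin 2 → B.atiyahAlgebra)
    (h : Fin 2 → C^∞⟮𝓘(ℝ, EM), M; ℝ⟯), IsUnit (∑ j, B.anchor (a j) (h j) ^ 2) := by
  obtain ⟨h, hh⟩ := exists_pair_noncritical EM M
  obtain ⟨a, ha⟩ := B.exists_anchor_sum_pos hh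
  refine ⟨a, h, ContMDiffMap.isUnit_of_forall_ne_zero fun x hx => ?_⟩
  have h1 := ha x
  rw [Fin.sum_univ_two] at h1 hx
  have h2 : (B.anchor (a 0) (h 0) x) ^ 2 + (B.anchor (a 1) (h 1) x) ^ 2 = 0 := hx
  nlinarith [sq_nonneg (B.anchor (a 0) (h 0) x + B.anchor (a 1) (h 1) x),
    sq_nonneg (B.anchor (a 0) (h 0) x - B.anchor (a 1) (h 1) x)]

variable {B}

/-- A proper finite-codimensional Lie subalgebra is contained in some `𝒜_m`. -/
theorem exists_le_anchorVanishingAt {T : LieSubalgebra ℝ B.atiyahAlgebra} (hT : T ≠ ⊤)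
    (hfin : T.toSubmodule.CoFG) : ∃ m, T ≤ B.anchorVanishingAt m := by
  by_contra! hnot
  obtain ⟨a, h, hw⟩ := B.exists_isUnit_sum_anchor_sq
  have hU := cofg_conductorIdeal_subalgebra B.lie_smul_eq a h hw T hfin
  -- For b in T, the identity (b̂ g) v = [b, g v] - g [b, v] makes the conductor ideal stable under
  -- b̂. So it contains a power of b̂ f, which is nonzero at m.
  have htop := ContMDiffMap.eq_top_of_cofg hU fun m => by
    obtain ⟨b, hbT, hb⟩ := SetLike.not_le_iff_exists.1 (hnot m)
    rw [mem_anchorVanishingAt_iff_anchor] at hb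
    push Not at hb
    obtain ⟨f, hf⟩ := hb
    obtain ⟨n, hn⟩ := Ideal.exists_pow_derivation_mem hU (B.anchor b) (fun g hg v => by
      have h1 := T.lie_mem hbT (hg v)
      rw [B.lie_smul_eq] at h1
      have h2 := T.sub_mem h1 (hg ⁅b, v⁆)
      rwa [add_sub_cancel_left] at h2) f
    exact ⟨_, hn, pow_ne_zero n hf⟩
  refine hT (eq_top_iff.2 fun b _ => ?_)
  have h1 : (1 : C^∞⟮𝓘(ℝ, EM), M; ℝ⟯) ∈ conductorIdeal C^∞⟮𝓘(ℝ, EM), M; ℝ⟯ T.toSubmodule := by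
    rw [htop]; trivial
  have h2 := h1 b
  rwa [one_smul] at h2

theorem cofg_anchorVanishingAt (m : M) : (B.anchorVanishingAt m).toSubmodule.CoFG := by
  obtain ⟨u, hu⟩ := B.proj_surjective m
  let l : B.atiyahAlgebra →ₗ[ℝ] EM :=
    { toFun := fun a => mfderiv 𝓘(ℝ, EP) 𝓘(ℝ, EM) B.proj u (a.1 u)
      map_add' := fun a b => map_add (mfderiv 𝓘(ℝ, EP) 𝓘(ℝ, EM) B.proj u) (a.1 u) (b.1 u)
      map_smul' := fun c a => map_smul (mfderiv 𝓘(ℝ, EP) 𝓘(ℝ, EM) B.proj u) c (a.1 u) }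
  refine Submodule.CoFG.of_le (S := LinearMap.ker l) (fun a ha => ?_) (Submodule.CoFG.ker l)
  exact (mem_anchorVanishingAt_iff hu).2 ha

/-- A section that vanishes at a point may have nonzero anchor at any other point. -/
theorem eq_of_vanishingAt_le_anchorVanishingAt {m m' : M}
    (h : B.vanishingAt m ≤ B.anchorVanishingAt m') : m = m' := by
  by_contra hne
  obtain ⟨v, hv⟩ := exists_ne (0 : EM)
  obtain ⟨f, hf⟩ := ContMDiffMap.exists_mvfderiv_ne_zero (E := EM) (m := m')
    (v := (v : TangentSpace 𝓘(ℝ, EM) m')) hv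
  obtain ⟨a, ha⟩ := B.exists_anchor_eq_one (f := f) (m := m') fun h0 => hf (by
    change mfderiv 𝓘(ℝ, EM) 𝓘(ℝ, ℝ) f m' v = 0
    rw [h0]; rfl)
  obtain ⟨b, hb, hb1⟩ := ContMDiffMap.exists_bump (E := EM) (m := m') (O := {m}ᶜ)
    (isOpen_compl_singleton.mem_nhds (Ne.symm hne))
  have hbm : b m = 0 := image_eq_zero_of_notMem_tsupport fun hm => hb hm rfl
  have hmem : b • a ∈ B.vanishingAt m := by
    obtain ⟨u, hu⟩ := B.proj_surjective m
    rw [mem_vanishingAt_iff hu, smul_apply, hu, hbm]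
    exact zero_smul ℝ _
  have h1 := mem_anchorVanishingAt_iff_anchor.1 (h hmem) f
  rw [map_smul] at h1
  have h2 : b m' * B.anchor a f m' = 0 := h1
  rw [ha, hb1.eq_of_nhds] at h2
  simp at h2

theorem vanishingAt_le_anchorVanishingAt (m : M) : B.vanishingAt m ≤ B.anchorVanishingAt m := by
  obtain ⟨u, hu⟩ := B.proj_surjective m
  intro a ha
  rw [mem_vanishingAt_iff hu] at ha
  rw [mem_anchorVanishingAt_iff hu, ha]
  exact map_zero _

theorem anchorVanishingAt_ne_top (m : M) : B.anchorVanishingAt m ≠ ⊤ := by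
  intro h
  obtain ⟨v, hv⟩ := exists_ne (0 : EM)
  obtain ⟨f, hf⟩ := ContMDiffMap.exists_mvfderiv_ne_zero (E := EM) (m := m)
    (v := (v : TangentSpace 𝓘(ℝ, EM) m)) hv
  obtain ⟨a, ha⟩ := B.exists_anchor_eq_one (f := f) (m := m) fun h0 => hf (by
    change mfderiv 𝓘(ℝ, EM) 𝓘(ℝ, ℝ) f m v = 0
    rw [h0]; rfl)
  have hmem : a ∈ B.anchorVanishingAt m := by rw [h]; trivial
  have h1 := mem_anchorVanishingAt_iff_anchor.1 hmem f
  rw [ha] at h1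
  exact one_ne_zero h1

/-- The maximal finite-codimensional Lie subalgebras of `𝒜` are the `𝒜_m`. -/
theorem isMaximalFiniteCodimSubalgebra_iff {T : LieSubalgebra ℝ B.atiyahAlgebra} :
    IsMaximalFiniteCodimSubalgebra T ↔ ∃ m, T = B.anchorVanishingAt m := by
  constructor
  · intro hT
    obtain ⟨m, hm⟩ := exists_le_anchorVanishingAt hT.prop.1 hT.prop.2
    exact ⟨m, hT.eq_of_le ⟨anchorVanishingAt_ne_top m, cofg_anchorVanishingAt m⟩ hm⟩
  · rintro ⟨m, rfl⟩
    refine ⟨⟨anchorVanishingAt_ne_top m, cofg_anchorVanishingAt m⟩, fun S hS hle => ?_⟩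
    obtain ⟨m', hm'⟩ := exists_le_anchorVanishingAt hS.1 hS.2
    have : m = m' := eq_of_vanishingAt_le_anchorVanishingAt
      ((vanishingAt_le_anchorVanishingAt m).trans (hle.trans hm'))
    rwa [this]

end SmoothPrincipalBundle

/-! ### Related vector fields, left-invariant fields and vertical vectors. -/

section RelatedFields

open Topology

variable {E E' N P : Type*} [NormedAddCommGroup E] [NormedSpace ℝ E] [CompleteSpace E]
    [NormedAddCommGroup E'] [NormedSpace ℝ E'] [CompleteSpace E']
    [TopologicalSpace P] [ChartedSpace E P] [IsManifold 𝓘(ℝ, E) ∞ P]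
    [TopologicalSpace N] [ChartedSpace E' N] [IsManifold 𝓘(ℝ, E') ∞ N]

/-- The brackets of `j`-related vector fields are `j`-related. -/
theorem SmoothVectorField.bracket_related {j : N → P} (hj : ContMDiff 𝓘(ℝ, E') 𝓘(ℝ, E) ∞ j)
    {X Y : SmoothVectorField E P} {X' Y' : SmoothVectorField E' N}
    (hX : ∀ g, X (j g) = mfderiv 𝓘(ℝ, E') 𝓘(ℝ, E) j g (X' g))
    (hY : ∀ g, Y (j g) = mfderiv 𝓘(ℝ, E') 𝓘(ℝ, E) j g (Y' g)) (g : N) :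
    ⁅X, Y⁆ (j g) = mfderiv 𝓘(ℝ, E') 𝓘(ℝ, E) j g (⁅X', Y'⁆ g) := by
  have hjd : ∀ g, MDifferentiableAt 𝓘(ℝ, E') 𝓘(ℝ, E) j g := fun g =>
    (hj g).mdifferentiableAt (by simp)
  -- The map j need not be a local diffeomorphism, so both sides are tested on functions by means of
  -- [X, Y]φ = X(Yφ) - Y(Xφ) and (Yφ) ∘ j = Y'(φ ∘ j).
  refine TangentSpace.eq_of_forall_mvfderiv_eq fun φ hφ => ?_
  have hφj : ContMDiffAt 𝓘(ℝ, E') 𝓘(ℝ, ℝ) ∞ (φ ∘ j) g := hφ.comp g (hj g)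
  have hφn : ∀ᶠ y in 𝓝 g, MDifferentiableAt 𝓘(ℝ, E) 𝓘(ℝ, ℝ) φ (j y) := by
    have h1 : ∀ᶠ x in 𝓝 (j g), ContMDiffAt 𝓘(ℝ, E) 𝓘(ℝ, ℝ) 1 φ x :=
      (contMDiffAt_iff_contMDiffAt_nhds (by simp)).1 (hφ.of_le (by simp))
    filter_upwards [hj.continuous.continuousAt.eventually h1] with y hy
    exact hy.mdifferentiableAt (by simp)
  have key : ∀ {X Y : SmoothVectorField E P} {X' Y' : SmoothVectorField E' N},
      (∀ g, X (j g) = mfderiv 𝓘(ℝ, E') 𝓘(ℝ, E) j g (X' g)) →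
      (∀ g, Y (j g) = mfderiv 𝓘(ℝ, E') 𝓘(ℝ, E) j g (Y' g)) →
      mvfderiv 𝓘(ℝ, E) (fun y => mvfderiv 𝓘(ℝ, E) φ y (Y y)) (j g) (X (j g)) =
      mvfderiv 𝓘(ℝ, E') (fun y => mvfderiv 𝓘(ℝ, E') (φ ∘ j) y (Y' y)) g (X' g) := by
    intro X Y X' Y' hX hY
    have hd := (contMDiffAt_mvfderiv_apply hφ Y).mdifferentiableAt (by simp : ∞ ≠ 0)
    have h1 := mvfderiv_comp (I := 𝓘(ℝ, E)) (I' := 𝓘(ℝ, E')) g hd (hjd g)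
    have h2 : (fun y => mvfderiv 𝓘(ℝ, E) φ y (Y y)) ∘ j =ᶠ[𝓝 g]
        fun y => mvfderiv 𝓘(ℝ, E') (φ ∘ j) y (Y' y) := by
      filter_upwards [hφn] with y hy
      rw [Function.comp_apply, hY y, mvfderiv_comp y hy (hjd y)]
      rfl
    have h3 : mfderiv 𝓘(ℝ, E') 𝓘(ℝ, ℝ) ((fun y => mvfderiv 𝓘(ℝ, E) φ y (Y y)) ∘ j) g (X' g) =
      mfderiv 𝓘(ℝ, E') 𝓘(ℝ, ℝ) (fun y => mvfderiv 𝓘(ℝ, E') (φ ∘ j) y (Y' y)) g (X' g) := by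
      rw [h2.mfderiv_eq]; rfl
    rw [hX g]
    exact (congrArg (fun l => l (X' g)) h1).symm.trans h3
  rw [mvfderiv_bracket hφ, key hX hY, key hY hX, ← mvfderiv_bracket hφj,
    mvfderiv_comp g (hφ.mdifferentiableAt (by simp)) (hjd g)]
  rfl

end RelatedFields

section LeftInvariant

variable {EG G : Type*} [NormedAddCommGroup EG] [NormedSpace ℝ EG] [TopologicalSpace G]
    [ChartedSpace EG G] [Group G] [LieGroup 𝓘(ℝ, EG) ∞ G]

/-- The left-invariant vector field of an element of the Lie algebra. -/
def leftInvariantField (ξ : GroupLieAlgebra 𝓘(ℝ, EG) G) : SmoothVectorField EG G :=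
  ⟨mulInvariantVectorField ξ, fun g =>
    contMDiffAt_mfderiv_of_deformation (F := fun g h : G => g * h) (y₀ := (1 : G))
      (contMDiff_mul 𝓘(ℝ, EG) ∞ (g, 1)) (Filter.Eventually.of_forall fun g => mul_one g) ξ⟩

end LeftInvariant

section Vertical

open Topology

variable {EM EG EP M G P : Type*}
    [NormedAddCommGroup EM] [NormedSpace ℝ EM] [NormedAddCommGroup EG] [NormedSpace ℝ EG]
    [NormedAddCommGroup EP] [NormedSpace ℝ EP]
    [TopologicalSpace M] [ChartedSpace EM M] [TopologicalSpace G] [ChartedSpace EG G]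
    [TopologicalSpace P] [ChartedSpace EP P]

/-- In product coordinates `w = f (p w, q w)`, a vector killed by the derivative of `p` is tangent
to the second factor. -/
theorem mfderiv_snd_of_mfderiv_fst_eq_zero {f : M × G → P} {p : P → M} {q : P → G} {u : P}
    (hf : MDifferentiableAt (𝓘(ℝ, EM).prod 𝓘(ℝ, EG)) 𝓘(ℝ, EP) f (p u, q u))
    (hp : MDifferentiableAt 𝓘(ℝ, EP) 𝓘(ℝ, EM) p u) (hq : MDifferentiableAt 𝓘(ℝ, EP) 𝓘(ℝ, EG) q u)
    (hid : ∀ᶠ w in 𝓝 u, f (p w, q w) = w) {v : TangentSpace 𝓘(ℝ, EP) u}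
    (hv : mfderiv 𝓘(ℝ, EP) 𝓘(ℝ, EM) p u v = 0) :
    (mfderiv 𝓘(ℝ, EG) 𝓘(ℝ, EP) (fun g => f (p u, g)) (q u)
      (mfderiv 𝓘(ℝ, EP) 𝓘(ℝ, EG) q u v) : EP) = v := by
  have h1 := mfderiv_comp_apply (I := 𝓘(ℝ, EP)) (I' := 𝓘(ℝ, EM).prod 𝓘(ℝ, EG))
    (I'' := 𝓘(ℝ, EP)) u hf (hp.prodMk hq) v
  have h2 : f ∘ (fun w => (p w, q w)) =ᶠ[𝓝 u] id := hid
  have h3 := congrArg (fun l : EP →L[ℝ] EP => l v)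
    (h2.mfderiv_eq (I := 𝓘(ℝ, EP)) (I' := 𝓘(ℝ, EP)))
  have h4 : (mfderiv 𝓘(ℝ, EP) 𝓘(ℝ, EP) (id : P → P) u v : EP) = v := by
    rw [mfderiv_id]; rfl
  have h5 := mfderiv_prod_eq_add_apply hf
    (v := mfderiv 𝓘(ℝ, EP) (𝓘(ℝ, EM).prod 𝓘(ℝ, EG)) (fun w => (p w, q w)) u v)
  have h6 := mfderiv_prodMk hp hq
  have h7 : mfderiv 𝓘(ℝ, EP) (𝓘(ℝ, EM).prod 𝓘(ℝ, EG)) (fun w => (p w, q w)) u v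
    = (mfderiv 𝓘(ℝ, EP) 𝓘(ℝ, EM) p u v, mfderiv 𝓘(ℝ, EP) 𝓘(ℝ, EG) q u v) := by
    rw [h6]; rfl
  rw [h7, hv] at h5
  rw [h7, hv, h5] at h1
  have h8 := (congrArg (fun z : TangentSpace 𝓘(ℝ, EP) (f (p u, q u)) =>
    z + mfderiv 𝓘(ℝ, EG) 𝓘(ℝ, EP) (fun g => f (p u, g)) (q u)
    (mfderiv 𝓘(ℝ, EP) 𝓘(ℝ, EG) q u v)) (map_zero (mfderiv 𝓘(ℝ, EM) 𝓘(ℝ, EP)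
      (fun z => f (z, q u)) (p u)))).trans (zero_add _)
  exact h8.symm.trans (h1.symm.trans (h3.trans h4))

end Vertical

/-! ### Identification of the fibres of the kernel with the Lie algebra of G. -/

namespace SmoothPrincipalBundle

open Topology

set_option linter.unusedSectionVars false

variable {EM EG EP M G P : Type*}
    [NormedAddCommGroup EM] [NormedSpace ℝ EM] [NormedAddCommGroup EG] [NormedSpace ℝ EG]
    [NormedAddCommGroup EP] [NormedSpace ℝ EP]
    [TopologicalSpace M] [ChartedSpace EM M] [IsManifold 𝓘(ℝ, EM) ∞ M]
    [TopologicalSpace G] [ChartedSpace EG G] [Group G] [LieGroup 𝓘(ℝ, EG) ∞ G]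
    [TopologicalSpace P] [ChartedSpace EP P] [IsManifold 𝓘(ℝ, EP) ∞ P]
    {B : SmoothPrincipalBundle EM EG EP M G P} [CompleteSpace EP]

namespace LocalTrivialization

variable (t : B.LocalTrivialization)

/-- The inverse of the group coordinate. -/
def invCoord (w : P) : G := (t.e w).2⁻¹

/-- The parametrization `g ↦ σ(x).g⁻¹` of a fibre, with `σ` the unit section. -/
def fibreMap (x : M) (g : G) : P := t.pt x g⁻¹

theorem contMDiffAt_invCoord {u : P} (hu : B.proj u ∈ t.base) :
    ContMDiffAt 𝓘(ℝ, EP) 𝓘(ℝ, EG) ∞ t.invCoord u := (t.contMDiffAt_coord hu).inv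

theorem contMDiffAt_fibreMap_prod {x : M} (hx : x ∈ t.base) (g : G) :
    ContMDiffAt (𝓘(ℝ, EM).prod 𝓘(ℝ, EG)) 𝓘(ℝ, EP) ∞
      (fun p : M × G => t.fibreMap p.1 p.2) (x, g) :=
  ContMDiffAt.comp (x, g) (t.contMDiffAt_pt hx g⁻¹)
    (contMDiffAt_fst.prodMk contMDiffAt_snd.inv)

theorem contMDiff_fibreMap {x : M} (hx : x ∈ t.base) :
    ContMDiff 𝓘(ℝ, EG) 𝓘(ℝ, EP) ∞ (t.fibreMap x) := fun g =>
  ContMDiffAt.comp (g := fun p : M × G => t.fibreMap p.1 p.2) (f := fun h => (x, h)) g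
    (t.contMDiffAt_fibreMap_prod hx g) (contMDiffAt_const.prodMk contMDiffAt_id)

theorem mdifferentiableAt_fibreMap {x : M} (hx : x ∈ t.base) (g : G) :
    MDifferentiableAt 𝓘(ℝ, EG) 𝓘(ℝ, EP) (t.fibreMap x) g :=
  (t.contMDiff_fibreMap hx g).mdifferentiableAt (by simp)

theorem proj_fibreMap {x : M} (hx : x ∈ t.base) (g : G) : B.proj (t.fibreMap x g) = x :=
  t.proj_pt hx _

theorem invCoord_fibreMap {x : M} (hx : x ∈ t.base) (g : G) : t.invCoord (t.fibreMap x g) = g := by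
  rw [invCoord, fibreMap, t.apply_pt hx, inv_inv]

theorem fibreMap_invCoord {u : P} (hu : B.proj u ∈ t.base) :
    t.fibreMap (B.proj u) (t.invCoord u) = u := by
  rw [invCoord, fibreMap, inv_inv, t.pt_proj hu]

/-- The reason for the inverse in `fibreMap`: the right action becomes left multiplication on G, so
that invariant fields correspond to left-invariant ones and brackets keep their sign. -/
theorem act_fibreMap {x : M} (hx : x ∈ t.base) (g h : G) :
    B.act (t.fibreMap x h) g⁻¹ = t.fibreMap x (g * h) := by
  rw [fibreMap, t.act_pt hx, fibreMap, mul_inv_rev]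

/-- The derivative at the unit of the parametrization of the fibre over `x`. -/
def incl (x : M) : EG →L[ℝ] EP := mfderiv 𝓘(ℝ, EG) 𝓘(ℝ, EP) (t.fibreMap x) 1

/-- The vertical component at `σ(x)` of an invariant vector field. -/
def coeff (a : B.atiyahAlgebra) (x : M) : EG :=
  mfderiv 𝓘(ℝ, EP) 𝓘(ℝ, EG) t.invCoord (t.fibreMap x 1) (a.1 (t.fibreMap x 1))

theorem incl_coeff {x : M} (hx : x ∈ t.base) {a : B.atiyahAlgebra}
    (ha : a ∈ B.anchorVanishingAt x) : t.incl x (t.coeff a x) = a.1 (t.fibreMap x 1) := by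
  have hpx := t.proj_fibreMap hx 1
  have hx' : B.proj (t.fibreMap x 1) ∈ t.base := by rw [hpx]; exact hx
  have h := mfderiv_snd_of_mfderiv_fst_eq_zero (f := fun p : M × G => t.fibreMap p.1 p.2)
    (p := B.proj) (q := t.invCoord) (u := t.fibreMap x 1)
    ((t.contMDiffAt_fibreMap_prod hx' _).mdifferentiableAt (by simp))
    (B.mdifferentiableAt_proj _) ((t.contMDiffAt_invCoord hx').mdifferentiableAt (by simp))
    (Filter.eventually_of_mem ((t.isOpen_base.preimage B.contMDiff_proj.continuous).mem_nhds hx')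
      fun w hw => t.fibreMap_invCoord hw) ((mem_anchorVanishingAt_iff hpx).1 ha)
  have haux : ∀ (y : M) (g g' : G) (v : EG), y = x → g' = g →
      (mfderiv 𝓘(ℝ, EG) 𝓘(ℝ, EP) (fun g => t.fibreMap y g) g' v : EP) =
        (mfderiv 𝓘(ℝ, EG) 𝓘(ℝ, EP) (t.fibreMap x) g v : EP) := by
    rintro y g _ v rfl rfl; rfl
  exact (haux _ _ _ _ hpx (t.invCoord_fibreMap hx 1)).symm.trans h

theorem mfderiv_invCoord_incl {x : M} (hx : x ∈ t.base) (ξ : EG) :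
    (mfderiv 𝓘(ℝ, EP) 𝓘(ℝ, EG) t.invCoord (t.fibreMap x 1) (t.incl x ξ : EP) : EG) = ξ := by
  have hx' : B.proj (t.fibreMap x 1) ∈ t.base := by rw [t.proj_fibreMap hx]; exact hx
  have h := mfderiv_comp_model_apply (rfl : t.fibreMap x 1 = _)
    ((t.contMDiffAt_invCoord hx').mdifferentiableAt (by simp)) (t.mdifferentiableAt_fibreMap hx 1) ξ
  have hid : t.invCoord ∘ t.fibreMap x = id := funext fun g => t.invCoord_fibreMap hx g
  refine h.symm.trans ?_
  rw [hid, mfderiv_id]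
  rfl

theorem coeff_eq {x : M} (hx : x ∈ t.base) {a : B.atiyahAlgebra} {ξ : EG}
    (h : a.1 (t.fibreMap x 1) = t.incl x ξ) : t.coeff a x = ξ := by
  rw [coeff, h]; exact t.mfderiv_invCoord_incl hx ξ

/-- An invariant vector field whose anchor vanishes at `x` is related to a left-invariant field. -/
theorem apply_fibreMap {x : M} (hx : x ∈ t.base) {a : B.atiyahAlgebra}
    (ha : a ∈ B.anchorVanishingAt x) (g : G) :
    a.1 (t.fibreMap x g) = mfderiv 𝓘(ℝ, EG) 𝓘(ℝ, EP) (t.fibreMap x) g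
      (leftInvariantField (G := G) (t.coeff a x) g) := by
  have hg : B.rightTranslation g⁻¹ (t.fibreMap x 1) = t.fibreMap x g := by
    rw [rightTranslation, t.act_fibreMap hx, mul_one]
  have h1 := a.2 g⁻¹ (t.fibreMap x 1)
  have haux : ∀ u w : P, u = w → (a.1 u : EP) = a.1 w := by rintro u _ rfl; rfl
  have hc : B.rightTranslation g⁻¹ ∘ t.fibreMap x = t.fibreMap x ∘ fun h : G => g * h :=
    funext fun h => t.act_fibreMap hx g h
  have h2 := mfderiv_comp_model_apply (rfl : t.fibreMap x 1 = _)
    (B.mdifferentiableAt_rightTranslation g⁻¹ (t.fibreMap x 1)) (t.mdifferentiableAt_fibreMap hx 1)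
    (t.coeff a x)
  have h3 := mfderiv_comp_model_apply (f := fun h : G => g * h) (x := 1) (mul_one g)
    (t.mdifferentiableAt_fibreMap hx g)
    ((contMDiff_mul_left (I := 𝓘(ℝ, EG)) (n := ∞) (a := g) 1).mdifferentiableAt (by simp))
    (t.coeff a x)
  rw [hc] at h2
  have h4 : (t.incl x (t.coeff a x) : EP) = a.1 (t.fibreMap x 1) := t.incl_coeff hx ha
  refine (haux _ _ hg).symm.trans (h1.symm.trans ?_)
  refine (congrArg (mfderiv 𝓘(ℝ, EP) 𝓘(ℝ, EP) (B.rightTranslation g⁻¹) (t.fibreMap x 1))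
    h4.symm).trans ?_
  exact h2.symm.trans h3

variable [CompleteSpace EG]

/-- Along the fibre both fields are related to left-invariant fields on G, hence so are their
brackets; the bracket of the Lie algebra of G is the value at the unit. -/
theorem coeff_lie {x : M} (hx : x ∈ t.base) {a b : B.atiyahAlgebra}
    (ha : a ∈ B.anchorVanishingAt x) (hb : b ∈ B.anchorVanishingAt x) :
    t.coeff ⁅a, b⁆ x = Bracket.bracket (L := GroupLieAlgebra 𝓘(ℝ, EG) G)
      (M := GroupLieAlgebra 𝓘(ℝ, EG) G) (t.coeff a x) (t.coeff b x) :=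
  t.coeff_eq hx (SmoothVectorField.bracket_related (t.contMDiff_fibreMap hx)
    (t.apply_fibreMap hx ha) (t.apply_fibreMap hx hb) 1)

theorem mem_vanishingAt_iff_coeff {x : M} (hx : x ∈ t.base) {a : B.atiyahAlgebra}
    (ha : a ∈ B.anchorVanishingAt x) : a ∈ B.vanishingAt x ↔ t.coeff a x = 0 := by
  rw [mem_vanishingAt_iff (t.proj_fibreMap hx 1), ← t.incl_coeff hx ha]
  refine ⟨fun h => ?_, fun h => by rw [h]; exact map_zero _⟩
  exact (t.coeff_eq hx (ξ := 0) (((t.incl_coeff hx ha).symm.trans h).trans (map_zero _).symm))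

/-- The vertical component of an invariant vector field depends smoothly on the point. -/
theorem contMDiffAt_coeff (a : B.atiyahAlgebra) {x : M} (hx : x ∈ t.base) :
    ContMDiffAt 𝓘(ℝ, EM) 𝓘(ℝ, EG) ∞ (t.coeff a) x := by
  have hx' : B.proj (t.fibreMap x 1) ∈ t.base := by rw [t.proj_fibreMap hx]; exact hx
  have hQ := t.contMDiffAt_invCoord hx'
  have A := hQ.mfderiv_const (m := ∞) (by simp)
  have h := ContMDiffAt.clm_apply_of_inCoordinates (n := ∞) (E₁ := TangentSpace 𝓘(ℝ, EP))
    (E₂ := TangentSpace 𝓘(ℝ, EG)) (ϕ := fun u => mfderiv 𝓘(ℝ, EP) 𝓘(ℝ, EG) t.invCoord u)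
    (v := fun u => a.1 u) (b₁ := id) (b₂ := t.invCoord) A (a.1.contMDiff _) hQ
  have hσ : ContMDiffAt 𝓘(ℝ, EM) 𝓘(ℝ, EP) ∞ (fun y => t.fibreMap y 1) x :=
    ContMDiffAt.comp (g := fun p : M × G => t.fibreMap p.1 p.2) (f := fun y => (y, 1)) x
      (t.contMDiffAt_fibreMap_prod hx 1) (contMDiffAt_id.prodMk contMDiffAt_const)
  have h2 := ContMDiffAt.comp x h hσ
  have haux : ∀ (g g' : G) (_ : g = g') (v : EG), (Bundle.TotalSpace.mk' EG g v :
      TangentBundle 𝓘(ℝ, EG) G) = Bundle.TotalSpace.mk' EG g' v := by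
    rintro g _ rfl v; rfl
  have h3 : ContMDiffAt 𝓘(ℝ, EM) (𝓘(ℝ, EG).prod 𝓘(ℝ, EG)) ∞ (fun y =>
      (Bundle.TotalSpace.mk' EG (1 : G) (t.coeff a y) : TangentBundle 𝓘(ℝ, EG) G)) x := by
    refine h2.congr_of_eventuallyEq ?_
    filter_upwards [t.isOpen_base.mem_nhds hx] with y hy
    exact haux _ _ (t.invCoord_fibreMap hy 1).symm _
  have h4 := (Bundle.contMDiffAt_totalSpace.1 h3).2
  refine h4.congr_of_eventuallyEq (Filter.Eventually.of_forall fun y => ?_)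
  exact (congrArg Prod.snd ((tangentBundleCore 𝓘(ℝ, EG) G).localTrivAt_apply_mk (1 : G)
    (t.coeff a y))).symm

/-- The vertical invariant fields of a local trivialization. -/
theorem exists_kernel_eq_incl (ξ : EG) {χ : C^∞⟮𝓘(ℝ, EM), M; ℝ⟯} (hχ : tsupport χ ⊆ t.base) :
    ∃ k : B.kernel, ∀ x ∈ t.base, k.1.1 (t.fibreMap x 1) = χ x • t.incl x ξ := by
  -- Left multiplication of the group coordinate commutes with the right action. The inverse makes
  -- the orbit of σ(x) equal to `fibreMap x`.
  let F : P → G → P := fun u h => t.pt (B.proj u) (h⁻¹ * (t.e u).2)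
  have hF : ∀ u, B.proj u ∈ t.base →
      ContMDiffAt (𝓘(ℝ, EP).prod 𝓘(ℝ, EG)) 𝓘(ℝ, EP) ∞ (Function.uncurry F) (u, (1 : G)) := by
    intro u hu
    refine ContMDiffAt.comp (u, (1 : G)) (t.contMDiffAt_pt hu _)
      (ContMDiffAt.prodMk ?_ (contMDiffAt_snd.inv.mul ?_))
    · exact ContMDiffAt.comp (u, (1 : G)) (B.contMDiff_proj u) contMDiffAt_fst
    · exact ContMDiffAt.comp (g := fun w => (t.e w).2) (u, (1 : G)) (t.contMDiffAt_coord hu)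
        contMDiffAt_fst
  have hFu : ∀ u, B.proj u ∈ t.base → ∀ h, B.proj (F u h) = B.proj u := fun u hu h => t.proj_pt hu _
  obtain ⟨a, ha⟩ := exists_invariantField t.isOpen_base hF
    (fun u hu => by simp only [F, inv_one, one_mul]; exact t.pt_proj hu)
    (fun u hu g => Filter.Eventually.of_forall fun h => by
      simp only [F]
      rw [t.act_pt hu, t.apply_act u (t.mem_source.2 hu), B.proj_act, mul_assoc]) ξ hχ
  refine ⟨⟨a, mem_kernel_iff.2 fun u => ?_⟩, fun x hx => ?_⟩
  · rw [ha]
    refine (map_smul _ _ _).trans ?_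
    by_cases hu : B.proj u ∈ t.base
    · have hd : MDifferentiableAt 𝓘(ℝ, EG) 𝓘(ℝ, EP) (F u) 1 := by
        have h1 : ContMDiffAt 𝓘(ℝ, EG) 𝓘(ℝ, EP) ∞ (Function.uncurry F ∘ fun y => (u, y)) 1 :=
          (hF u hu).comp 1 (contMDiffAt_const.prodMk contMDiffAt_id)
        exact h1.mdifferentiableAt (by simp)
      have hu1 : F u 1 = u := by simp only [F, inv_one, one_mul]; exact t.pt_proj hu
      have h2 := mfderiv_comp_model_apply hu1 (B.mdifferentiableAt_proj u) hd ξ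
      have hc : B.proj ∘ F u = fun _ => B.proj u := funext fun h => hFu u hu h
      rw [hc, mfderiv_const] at h2
      exact (congrArg (fun v : TangentSpace 𝓘(ℝ, EM) (B.proj u) => χ (B.proj u) • v)
        h2.symm).trans (smul_zero _)
    · have h0 : χ (B.proj u) = 0 := image_eq_zero_of_notMem_tsupport fun h => hu (hχ h)
      rw [h0]
      exact zero_smul ℝ _
  · have hFx : F (t.fibreMap x 1) = t.fibreMap x := by
      funext h
      simp only [F]
      rw [t.proj_fibreMap hx, fibreMap, t.apply_pt hx, fibreMap, inv_one, mul_one]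
    refine (ha _).trans ?_
    rw [hFx, t.proj_fibreMap hx]
    rfl

end LocalTrivialization

end SmoothPrincipalBundle

/-- The preimage of a maximal ideal under a surjection onto a finite-dimensional Lie algebra. -/
theorem IsMaximalFiniteCodimIdeal.comap_of_isCoatom {K L : Type*} [LieRing K] [LieAlgebra ℝ K]
    [LieRing L] [LieAlgebra ℝ L] [FiniteDimensional ℝ L] {θ : K →ₗ⁅ℝ⁆ L}
    (hθ : Function.Surjective θ) {J : LieIdeal ℝ L} (hJ : IsCoatom J) :
    IsMaximalFiniteCodimIdeal (J.comap θ) := by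
  have hfin : (J.toSubmodule.comap (θ : K →ₗ[ℝ] L)).CoFG :=
    Submodule.CoFG.comap (J := J.toSubmodule)
      (inferInstance : FiniteDimensional ℝ (L ⧸ J.toSubmodule)) _
  refine ⟨⟨fun h => hJ.1 (eq_top_iff.2 fun y _ => ?_), hfin⟩, fun J' hJ' hle => ?_⟩
  · obtain ⟨x, rfl⟩ := hθ y
    have : x ∈ J.comap θ := by rw [h]; trivial
    exact this
  · have hJle : J ≤ J'.map θ := fun y hy => by
      obtain ⟨x, rfl⟩ := hθ y
      exact LieIdeal.mem_map (hle (show x ∈ J.comap θ from hy))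
    rcases hJ.le_iff.1 hJle with h | h
    · refine absurd (eq_top_iff.2 fun x _ => ?_) hJ'.1
      obtain ⟨y, hy⟩ := LieIdeal.mem_map_of_surjective (I := J') (y := θ x) hθ (by rw [h]; trivial)
      have h0 : x - y ∈ J.comap θ := by
        rw [LieIdeal.mem_comap, map_sub, hy, sub_self]
        exact zero_mem _
      have := add_mem (hle h0) y.2
      rwa [sub_add_cancel] at this
    · intro x hx
      rw [LieIdeal.mem_comap, ← h]
      exact LieIdeal.mem_map hx

/-! ### Evaluation of kernel sections and the maximal ideals normalized by 𝒜_m. -/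

namespace SmoothPrincipalBundle

open Topology

set_option linter.unusedSectionVars false

variable {EM EG EP M G P : Type*}
    [NormedAddCommGroup EM] [NormedSpace ℝ EM] [NormedAddCommGroup EG] [NormedSpace ℝ EG]
    [NormedAddCommGroup EP] [NormedSpace ℝ EP]
    [TopologicalSpace M] [ChartedSpace EM M] [IsManifold 𝓘(ℝ, EM) ∞ M]
    [TopologicalSpace G] [ChartedSpace EG G] [Group G] [LieGroup 𝓘(ℝ, EG) ∞ G]
    [TopologicalSpace P] [ChartedSpace EP P] [IsManifold 𝓘(ℝ, EP) ∞ P]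
    {B : SmoothPrincipalBundle EM EG EP M G P} [CompleteSpace EP]

theorem kernel_mem_anchorVanishingAt (k : B.kernel) (m : M) : k.1 ∈ B.anchorVanishingAt m := k.2 m

theorem smul_mem_kernelVanishingAt {f : C^∞⟮𝓘(ℝ, EM), M; ℝ⟯} {x : M} (hf : f x = 0)
    (k : B.kernel) : f • k ∈ B.kernelVanishingAt x := by
  obtain ⟨u, rfl⟩ := B.proj_surjective x
  rw [mem_kernelVanishingAt_iff, mem_vanishingAt_iff rfl, coe_smul_kernel, smul_apply, hf]
  exact zero_smul ℝ _

theorem kernel_eq_zero_of_forall_mem {k : B.kernel} (h : ∀ x, k ∈ B.kernelVanishingAt x) :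
    k = 0 :=
  Subtype.ext (atiyahAlgebra_ext fun u => (mem_vanishingAt_iff rfl).1 (h (B.proj u)))

namespace LocalTrivialization

variable (t : B.LocalTrivialization)

/-- The value at `m` of the sections of the kernel, as elements of the Lie algebra of `G`. -/
def kernelEval [CompleteSpace EG] {m : M} (hm : m ∈ t.base) :
    B.kernel →ₗ⁅ℝ⁆ GroupLieAlgebra 𝓘(ℝ, EG) G where
  toFun k := t.coeff k.1 m
  map_add' _ _ := map_add (mfderiv 𝓘(ℝ, EP) 𝓘(ℝ, EG) t.invCoord (t.fibreMap m 1)) _ _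
  map_smul' _ _ := map_smul (mfderiv 𝓘(ℝ, EP) 𝓘(ℝ, EG) t.invCoord (t.fibreMap m 1)) _ _
  map_lie' {k l} := t.coeff_lie hm (kernel_mem_anchorVanishingAt k m)
    (kernel_mem_anchorVanishingAt l m)

theorem kernelEval_eq_zero_iff [CompleteSpace EG] {m : M} (hm : m ∈ t.base) {k : B.kernel} :
    t.kernelEval hm k = 0 ↔ k ∈ B.kernelVanishingAt m :=
  (t.mem_vanishingAt_iff_coeff hm (kernel_mem_anchorVanishingAt k m)).symm

theorem kernelEval_smul [CompleteSpace EG] {m : M} (hm : m ∈ t.base) (f : C^∞⟮𝓘(ℝ, EM), M; ℝ⟯)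
    (k : B.kernel) : t.kernelEval hm (f • k) = f m • t.kernelEval hm k := by
  have h : (f • k.1).1 (t.fibreMap m 1) = f m • k.1.1 (t.fibreMap m 1) := by
    rw [smul_apply, t.proj_fibreMap hm]
  refine (congrArg (mfderiv 𝓘(ℝ, EP) 𝓘(ℝ, EG) t.invCoord (t.fibreMap m 1)) h).trans ?_
  exact map_smul (mfderiv 𝓘(ℝ, EP) 𝓘(ℝ, EG) t.invCoord (t.fibreMap m 1)) _ _

variable [FiniteDimensional ℝ EM] [T2Space M]

theorem kernelEval_surjective [CompleteSpace EG] {m : M} (hm : m ∈ t.base) :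
    Function.Surjective (t.kernelEval hm) := by
  intro ξ
  obtain ⟨χ, hχ, h1⟩ := ContMDiffMap.exists_bump (E := EM) (t.isOpen_base.mem_nhds hm)
  obtain ⟨k, hk⟩ := t.exists_kernel_eq_incl ξ hχ
  refine ⟨k, t.coeff_eq hm ?_⟩
  rw [hk m hm, h1.eq_of_nhds]
  exact one_smul ℝ _

/-- A local section of the kernel is, after multiplication by a cutoff function, a combination of
a fixed finite family of sections, with coefficients given by its components. -/
theorem exists_smul_eq_sum [FiniteDimensional ℝ EG] (k : B.kernel)
    {χ : C^∞⟮𝓘(ℝ, EM), M; ℝ⟯} (hχ : tsupport χ ⊆ t.base) :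
    ∃ (c : Fin (Module.finrank ℝ EG) → C^∞⟮𝓘(ℝ, EM), M; ℝ⟯)
      (e : Fin (Module.finrank ℝ EG) → B.kernel),
      (χ * χ) • k = ∑ i, c i • e i ∧ ∀ x, k ∈ B.kernelVanishingAt x → ∀ i, c i x = 0 := by
  let b := Module.finBasis ℝ EG
  choose e he using fun i => t.exists_kernel_eq_incl (b i) hχ
  -- One factor χ extends the components of k by zero to smooth functions on M, the other is already
  -- contained in the sections e i; together they give χ².
  obtain ⟨c, hc⟩ : ∃ c : Fin (Module.finrank ℝ EG) → C^∞⟮𝓘(ℝ, EM), M; ℝ⟯,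
      ∀ i x, c i x = χ x * b.coord i (t.coeff k.1 x) := by
    refine ⟨fun i => ⟨fun x => χ x * b.coord i (t.coeff k.1 x), ?_⟩, fun _ _ => rfl⟩
    refine contMDiff_of_tsupport fun x hx => ?_
    have hx' : x ∈ t.base := hχ (closure_mono (Function.support_mul_subset_left _ _) hx)
    refine (χ.contMDiff x).mul ?_
    exact ContMDiffAt.comp x (LinearMap.toContinuousLinearMap (b.coord i)).contMDiff.contMDiffAt
      (t.contMDiffAt_coeff k.1 hx')
  have hcoeff : ∀ x ∈ t.base, k ∈ B.kernelVanishingAt x → t.coeff k.1 x = 0 := fun x hx h =>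
    (t.mem_vanishingAt_iff_coeff hx (kernel_mem_anchorVanishingAt k x)).1 h
  have hχ0 : ∀ x ∉ t.base, χ x = 0 := fun x hx =>
    image_eq_zero_of_notMem_tsupport fun h => hx (hχ h)
  refine ⟨c, e, ?_, ?_⟩
  · rw [← sub_eq_zero]
    refine kernel_eq_zero_of_forall_mem fun x => ?_
    by_cases hx : x ∈ t.base
    · have hce : CompleteSpace EG := FiniteDimensional.complete ℝ EG
      have hei : ∀ i, t.kernelEval hx (e i) = χ x • (b i : EG) := fun i =>
        t.coeff_eq hx ((he i x hx).trans (map_smul (t.incl x) _ _).symm)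
      rw [← t.kernelEval_eq_zero_iff hx, map_sub, map_sum, t.kernelEval_smul hx, sub_eq_zero]
      have hs : ∀ i, t.kernelEval hx (c i • e i) =
          (χ x * χ x) • (b.repr (t.coeff k.1 x) i • b i : EG) := by
        intro i
        rw [t.kernelEval_smul hx, hei, hc]
        refine (smul_smul (α := EG) (χ x * b.coord i (t.coeff k.1 x)) (χ x) (b i)).trans ?_
        rw [smul_smul, Module.Basis.coord_apply]
        congr 1
        ring
      refine Eq.trans ?_ (Finset.sum_congr rfl fun i _ => hs i).symm
      change _ = ∑ i, (χ x * χ x) • (b.repr (t.coeff k.1 x) i • b i : EG)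
      rw [← Finset.smul_sum, b.sum_repr]
      rfl
    · refine sub_mem (smul_mem_kernelVanishingAt ?_ k) (sum_mem fun i _ =>
        smul_mem_kernelVanishingAt ?_ (e i))
      · change χ x * χ x = 0
        rw [hχ0 x hx, zero_mul]
      · rw [hc, hχ0 x hx, zero_mul]
  · intro x hx i
    rw [hc]
    by_cases hxb : x ∈ t.base
    · rw [hcoeff x hxb hx, map_zero, mul_zero]
    · rw [hχ0 x hxb, zero_mul]

end LocalTrivialization

variable [FiniteDimensional ℝ EM] [T2Space M]

/-- With χ(m) = 1, write k = (1 - χ²) k + ∑ cᵢ eᵢ: all the coefficients vanish at m. -/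
theorem mem_vanishingIdeal_smul_top [FiniteDimensional ℝ EG] {m : M} {k : B.kernel}
    (hk : k ∈ B.kernelVanishingAt m) :
    k ∈ ContMDiffMap.vanishingIdeal EM m • (⊤ : Submodule C^∞⟮𝓘(ℝ, EM), M; ℝ⟯ B.kernel) := by
  obtain ⟨t, hm⟩ := B.exists_localTrivialization m
  obtain ⟨χ, hχ, h1⟩ := ContMDiffMap.exists_bump (E := EM) (t.isOpen_base.mem_nhds hm)
  obtain ⟨c, e, hce, hc⟩ := t.exists_smul_eq_sum k hχ
  have hχm : χ m = 1 := h1.eq_of_nhds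
  have hk' : k = (1 - χ * χ) • k + ∑ i, c i • e i := by
    rw [← hce, sub_smul, one_smul, sub_add_cancel]
  rw [hk']
  refine add_mem (Submodule.smul_mem_smul ?_ trivial)
    (sum_mem fun i _ => Submodule.smul_mem_smul (ContMDiffMap.mem_vanishingIdeal.2 (hc m hk i))
      trivial)
  rw [ContMDiffMap.mem_vanishingIdeal]
  change 1 - χ m * χ m = 0
  rw [hχm, one_mul, sub_self]

variable [CompleteSpace EG]

theorem lie_mem_kernelVanishingAt {m : M} {a : B.atiyahAlgebra} (ha : a ∈ B.vanishingAt m)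
    (k : B.kernel) : ⁅a, k⁆ ∈ B.kernelVanishingAt m := by
  obtain ⟨t, hm⟩ := B.exists_localTrivialization m
  have hu := t.proj_fibreMap hm 1
  have ha' : a ∈ B.anchorVanishingAt m := by
    rw [mem_anchorVanishingAt_iff hu, (mem_vanishingAt_iff hu).1 ha]
    exact map_zero _
  rw [← t.kernelEval_eq_zero_iff hm]
  refine (t.coeff_lie hm ha' (kernel_mem_anchorVanishingAt k m)).trans ?_
  rw [(t.mem_vanishingAt_iff_coeff hm ha').1 ha]
  exact zero_lie (L := GroupLieAlgebra 𝓘(ℝ, EG) G) (M := GroupLieAlgebra 𝓘(ℝ, EG) G) _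

/-- Modulo 𝒜(m), which sends 𝒦 to 𝒦(m), an element of 𝒜_m thus acts on the fibre K_m as an inner
derivation. -/
theorem exists_kernel_sub_mem_vanishingAt {m : M} {a : B.atiyahAlgebra}
    (ha : a ∈ B.anchorVanishingAt m) : ∃ l : B.kernel, a - l.1 ∈ B.vanishingAt m := by
  obtain ⟨t, hm⟩ := B.exists_localTrivialization m
  obtain ⟨l, hl⟩ := t.kernelEval_surjective hm (t.coeff a m)
  refine ⟨l, (mem_vanishingAt_iff (t.proj_fibreMap hm 1)).2 ?_⟩
  rw [sub_apply, sub_eq_zero, ← t.incl_coeff hm ha,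
    ← t.incl_coeff hm (kernel_mem_anchorVanishingAt l m)]
  exact congrArg (t.incl m) hl.symm

section Semisimple

variable [FiniteDimensional ℝ EG] [Nontrivial EG]
    [LieAlgebra.HasTrivialRadical ℝ (GroupLieAlgebra 𝓘(ℝ, EG) G)]

/-- From [a, f k] = f [a, k] + (â f) k with k_m ≠ 0, the anchor of a vanishes at m. Then a_m is the
value of some l in 𝒦 whose image in 𝔤 commutes with everything, and the centre of 𝔤 is zero. -/
theorem mem_vanishingAt_of_forall_lie_mem {m : M} {a : B.atiyahAlgebra}
    (h : ∀ k : B.kernel, ⁅a, k⁆ ∈ B.kernelVanishingAt m) : a ∈ B.vanishingAt m := by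
  obtain ⟨t, hm⟩ := B.exists_localTrivialization m
  have ha : a ∈ B.anchorVanishingAt m := by
    rw [mem_anchorVanishingAt_iff_anchor]
    intro f
    obtain ⟨ξ, hξ⟩ := exists_ne (0 : EG)
    obtain ⟨k, hk⟩ := t.kernelEval_surjective hm ξ
    have h1 := (t.kernelEval_eq_zero_iff hm).2 (h (f • k))
    rw [lie_smul_kernel_eq, map_add, t.kernelEval_smul, t.kernelEval_smul,
      (t.kernelEval_eq_zero_iff hm).2 (h k), smul_zero, zero_add, hk] at h1
    exact (smul_eq_zero.1 h1).resolve_right hξ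
  obtain ⟨l, hl⟩ := exists_kernel_sub_mem_vanishingAt ha
  have hl0 : l ∈ B.kernelVanishingAt m := by
    rw [← t.kernelEval_eq_zero_iff hm]
    have hz : t.kernelEval hm l ∈ LieAlgebra.center ℝ (GroupLieAlgebra 𝓘(ℝ, EG) G) := by
      rw [LieModule.mem_maxTrivSubmodule]
      intro η
      obtain ⟨k, rfl⟩ := t.kernelEval_surjective hm η
      have h1 : ⁅l, k⁆ ∈ B.kernelVanishingAt m := by
        have h2 := sub_mem (h k) (lie_mem_kernelVanishingAt hl k)
        rw [sub_lie, sub_sub_cancel] at h2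
        exact h2
      rw [← lie_skew, ← LieHom.map_lie, (t.kernelEval_eq_zero_iff hm).2 h1, neg_zero]
    rwa [LieAlgebra.center_eq_bot, LieSubmodule.mem_bot] at hz
  have h3 := add_mem hl (show l.1 ∈ B.vanishingAt m from hl0)
  rwa [sub_add_cancel] at h3

theorem bracketIncluded_kernelVanishingAt_iff {m : M} {S : LieSubalgebra ℝ B.atiyahAlgebra} :
    BracketIncluded S (B.kernelVanishingAt m) ↔ S ≤ B.vanishingAt m :=
  ⟨fun h a ha => mem_vanishingAt_of_forall_lie_mem (h a ha),
    fun h _ ha k => lie_mem_kernelVanishingAt (h ha) k⟩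

/-- The sections of the kernel are combinations of brackets, up to sections vanishing at `m`. -/
theorem top_le_span_lie_sup (m : M) :
    ⊤ ≤ Submodule.span C^∞⟮𝓘(ℝ, EM), M; ℝ⟯ {x : B.kernel | ∃ k l : B.kernel, ⁅k, l⁆ = x} ⊔
      ContMDiffMap.vanishingIdeal EM m • (⊤ : Submodule C^∞⟮𝓘(ℝ, EM), M; ℝ⟯ B.kernel) := by
  obtain ⟨t, hm⟩ := B.exists_localTrivialization m
  set Q := Submodule.span C^∞⟮𝓘(ℝ, EM), M; ℝ⟯ {x : B.kernel | ∃ k l : B.kernel, ⁅k, l⁆ = x}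
  have hfd : FiniteDimensional ℝ (GroupLieAlgebra 𝓘(ℝ, EG) G) := ‹FiniteDimensional ℝ EG›
  have hQ : (⊤ : Submodule ℝ (GroupLieAlgebra 𝓘(ℝ, EG) G)) ≤
      (Q.restrictScalars ℝ).map (t.kernelEval hm : B.kernel →ₗ[ℝ] GroupLieAlgebra 𝓘(ℝ, EG) G) := by
    rw [← LieSubmodule.top_toSubmodule (R := ℝ) (L := GroupLieAlgebra 𝓘(ℝ, EG) G),
      ← LieAlgebra.top_lie_top_of_hasTrivialRadical, LieSubmodule.lieIdeal_oper_eq_linear_span',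
      Submodule.span_le]
    rintro _ ⟨ξ, -, η, -, rfl⟩
    obtain ⟨k, rfl⟩ := t.kernelEval_surjective hm ξ
    obtain ⟨l, rfl⟩ := t.kernelEval_surjective hm η
    exact ⟨⁅k, l⁆, Submodule.subset_span ⟨k, l, rfl⟩, LieHom.map_lie _ k l⟩
  intro k _
  obtain ⟨q, hq, hqk⟩ := hQ (x := t.kernelEval hm k) trivial
  have h : k - q ∈ B.kernelVanishingAt m := by
    rw [← t.kernelEval_eq_zero_iff hm, map_sub, sub_eq_zero]
    exact hqk.symm
  have h2 := Submodule.add_mem_sup (show q ∈ Q from hq) (mem_vanishingIdeal_smul_top h)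
  rwa [add_sub_cancel] at h2

variable [SecondCountableTopology M] [Nontrivial EM]

/-- The conductor ideal of J has finite codimension and can have no common zero except m, so it
contains a power of 𝔪; `IsMaximalFiniteCodimIdeal.smul_mem` then gives 𝔪 𝒦 ⊆ J, and 𝒦(m) ⊆ 𝔪 𝒦. -/
theorem kernelVanishingAt_le_of_isNormalizedBy {m : M} {J : LieIdeal ℝ B.kernel}
    (hJ : IsMaximalFiniteCodimIdeal J) (hn : IsNormalizedBy J (B.anchorVanishingAt m)) :
    B.kernelVanishingAt m ≤ J.toSubmodule := by
  obtain ⟨a, h, hw⟩ := B.exists_isUnit_sum_anchor_sq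
  have hI := cofg_conductorIdeal_of_stable (C := C^∞⟮𝓘(ℝ, EM), M; ℝ⟯) (lie_smul_kernel_eq (B := B))
    smul_lie_kernel_eq a h hw (cofg_anchorVanishingAt m) (J := J.toSubmodule) hJ.prop.2 hn
  -- At x ≠ m some b in 𝒜(m) ⊆ 𝒜_m has nonzero anchor. It normalizes J, so its anchor preserves the
  -- conductor ideal, which therefore contains a function nonzero at x.
  obtain ⟨r, hr⟩ := ContMDiffMap.exists_pow_vanishingIdeal_le hI m fun x hx => by
    obtain ⟨b, hb, hbx⟩ := SetLike.not_le_iff_exists.1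
      (mt (eq_of_vanishingAt_le_anchorVanishingAt (B := B)) (Ne.symm hx))
    rw [mem_anchorVanishingAt_iff_anchor] at hbx
    push Not at hbx
    obtain ⟨f, hf⟩ := hbx
    obtain ⟨n, hn⟩ := Ideal.exists_pow_derivation_mem hI (B.anchor b) (fun g hg k => by
      have h1 := hn b (B.vanishingAt_le_anchorVanishingAt m hb) _ (hg k)
      rw [lie_smul_kernel_eq] at h1
      have h2 := J.toSubmodule.sub_mem h1 (hg ⁅b, k⁆)
      rwa [add_sub_cancel_left] at h2) f
    exact ⟨_, hn, pow_ne_zero n hf⟩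
  intro k hk
  refine Submodule.smul_induction_on (p := fun k => k ∈ J.toSubmodule)
    (mem_vanishingIdeal_smul_top hk)
    (fun f hf l _ => hJ.smul_mem kernel_lie_smul hr (top_le_span_lie_sup m) hf l)
    fun _ _ => J.toSubmodule.add_mem

/-- If k_m ≠ 0, some maximal ideal of 𝔤 misses its image. The preimage under evaluation is a maximal
finite-codimensional ideal of 𝒦, normalized by 𝒜_m because 𝒜_m acts on K_m by inner derivations. -/
theorem normalizedIntersection_le (m : M) :
    normalizedIntersection B.kernel (B.anchorVanishingAt m) ≤ B.kernelVanishingAt m := by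
  obtain ⟨t, hm⟩ := B.exists_localTrivialization m
  have hfd : FiniteDimensional ℝ (GroupLieAlgebra 𝓘(ℝ, EG) G) := ‹FiniteDimensional ℝ EG›
  intro k hk
  by_contra hkm
  rw [← t.kernelEval_eq_zero_iff hm] at hkm
  obtain ⟨J, hJ, hkJ⟩ := LieAlgebra.exists_isCoatom_notMem hkm
  have hn : IsNormalizedBy (J.comap (t.kernelEval hm)) (B.anchorVanishingAt m) := by
    intro a ha x hx
    obtain ⟨l, hl⟩ := exists_kernel_sub_mem_vanishingAt ha
    rw [LieIdeal.mem_comap] at hx ⊢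
    have h1 : ⁅a, x⁆ = ⁅a - l.1, x⁆ + ⁅l, x⁆ := by
      rw [sub_lie]
      exact (sub_add_cancel _ _).symm
    rw [h1, map_add, (t.kernelEval_eq_zero_iff hm).2 (lie_mem_kernelVanishingAt hl x), zero_add,
      LieHom.map_lie]
    exact lie_mem_right ℝ _ J _ _ hx
  have hk' : k ∈ J.comap (t.kernelEval hm) := by
    rw [normalizedIntersection, LieSubmodule.sInf_toSubmodule_eq_iInf] at hk
    simp only [Submodule.mem_iInf] at hk
    exact hk _ ⟨IsMaximalFiniteCodimIdeal.comap_of_isCoatom (t.kernelEval_surjective hm) hJ, hn⟩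
  exact hkJ hk'

theorem normalizedIntersection_anchorVanishingAt (m : M) :
    normalizedIntersection B.kernel (B.anchorVanishingAt m) = B.kernelVanishingAt m := by
  refine le_antisymm (normalizedIntersection_le m) fun k hk => ?_
  rw [normalizedIntersection, LieSubmodule.sInf_toSubmodule_eq_iInf]
  simp only [Submodule.mem_iInf]
  intro J hJ
  exact kernelVanishingAt_le_of_isNormalizedBy hJ.1 hJ.2 hk

/-- An inclusion 𝒜(m) ⊆ 𝒜(m') forces m = m', so the 𝒜(m) form an antichain. -/
theorem maximal_exists_le_vanishingAt_iff {A₀ : LieSubalgebra ℝ B.atiyahAlgebra} :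
    (∃ m : M, A₀ = B.vanishingAt m) ↔
      Maximal (fun S : LieSubalgebra ℝ B.atiyahAlgebra => ∃ m : M, S ≤ B.vanishingAt m) A₀ := by
  constructor
  · rintro ⟨m, rfl⟩
    refine ⟨⟨m, le_rfl⟩, fun S ⟨m', hm'⟩ hS => ?_⟩
    obtain rfl := eq_of_vanishingAt_le_anchorVanishingAt
      ((hS.trans hm').trans (B.vanishingAt_le_anchorVanishingAt m'))
    exact hm'
  · rintro ⟨⟨m, hm⟩, hmax⟩
    exact ⟨m, le_antisymm hm (hmax ⟨m, le_rfl⟩ hm)⟩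

end Semisimple

end SmoothPrincipalBundle
end

/-! ### The main theorem. -/

theorem mainTheorem7 {EM EG EP M G P : Type*}
    [NormedAddCommGroup EM] [NormedSpace ℝ EM] [FiniteDimensional ℝ EM] [Nontrivial EM]
    [NormedAddCommGroup EG] [NormedSpace ℝ EG] [FiniteDimensional ℝ EG] [CompleteSpace EG]
    [Nontrivial EG]
    [NormedAddCommGroup EP] [NormedSpace ℝ EP] [FiniteDimensional ℝ EP] [CompleteSpace EP]
    [TopologicalSpace M] [ChartedSpace EM M] [IsManifold 𝓘(ℝ, EM) ∞ M]
    [T2Space M] [SecondCountableTopology M]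
    [TopologicalSpace G] [ChartedSpace EG G] [Group G] [LieGroup 𝓘(ℝ, EG) ∞ G]
    [T2Space G] [SecondCountableTopology G]
    [TopologicalSpace P] [ChartedSpace EP P] [IsManifold 𝓘(ℝ, EP) ∞ P]
    [T2Space P] [SecondCountableTopology P]
    [LieAlgebra.HasTrivialRadical ℝ (GroupLieAlgebra 𝓘(ℝ, EG) G)]
    (B : SmoothPrincipalBundle EM EG EP M G P) :
    (∀ A₀ : LieSubalgebra ℝ B.atiyahAlgebra,
      (∃ m : M, A₀ = B.vanishingAt m) ↔
        Maximal (fun S : LieSubalgebra ℝ B.atiyahAlgebra =>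
          ∃ m : M, BracketIncluded S (B.kernelVanishingAt m)) A₀) ∧
    (∀ A₀ : LieSubalgebra ℝ B.atiyahAlgebra,
      (∃ m : M, A₀ = B.vanishingAt m) ↔
        Maximal (fun S : LieSubalgebra ℝ B.atiyahAlgebra =>
          ∃ T : LieSubalgebra ℝ B.atiyahAlgebra, IsMaximalFiniteCodimSubalgebra T ∧
            BracketIncluded S (normalizedIntersection B.kernel T)) A₀) ∧
    (∀ m : M,
      IsMaximalFiniteCodimSubalgebra (B.anchorVanishingAt m) ∧
      Maximal (fun S : LieSubalgebra ℝ B.atiyahAlgebra =>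
        BracketIncluded S (normalizedIntersection B.kernel (B.anchorVanishingAt m)))
        (B.vanishingAt m) ∧
      ∀ T : LieSubalgebra ℝ B.atiyahAlgebra, IsMaximalFiniteCodimSubalgebra T →
        BracketIncluded (B.vanishingAt m) (normalizedIntersection B.kernel T) →
          T = B.anchorVanishingAt m) := by
  have hcond : ∀ S : LieSubalgebra ℝ B.atiyahAlgebra,
      (∃ m : M, BracketIncluded S (B.kernelVanishingAt m)) ↔ ∃ m : M, S ≤ B.vanishingAt m :=
    fun S => exists_congr fun m => SmoothPrincipalBundle.bracketIncluded_kernelVanishingAt_iff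
  have hcond' : ∀ (S : LieSubalgebra ℝ B.atiyahAlgebra) (m : M),
      BracketIncluded S (normalizedIntersection B.kernel (B.anchorVanishingAt m)) ↔
        S ≤ B.vanishingAt m := fun S m => by
    rw [SmoothPrincipalBundle.normalizedIntersection_anchorVanishingAt,
      SmoothPrincipalBundle.bracketIncluded_kernelVanishingAt_iff]
  have hcond'' : ∀ S : LieSubalgebra ℝ B.atiyahAlgebra,
      (∃ T : LieSubalgebra ℝ B.atiyahAlgebra, IsMaximalFiniteCodimSubalgebra T ∧
        BracketIncluded S (normalizedIntersection B.kernel T)) ↔ ∃ m : M, S ≤ B.vanishingAt m := by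
    intro S
    constructor
    · rintro ⟨T, hT, hS⟩
      obtain ⟨m, rfl⟩ := SmoothPrincipalBundle.isMaximalFiniteCodimSubalgebra_iff.1 hT
      exact ⟨m, (hcond' S m).1 hS⟩
    · rintro ⟨m, hm⟩
      exact ⟨_, SmoothPrincipalBundle.isMaximalFiniteCodimSubalgebra_iff.2 ⟨m, rfl⟩,
        (hcond' S m).2 hm⟩
  refine ⟨fun A₀ => ?_, fun A₀ => ?_, fun m => ⟨?_, ?_, fun T hT h => ?_⟩⟩
  · simp only [hcond]
    exact SmoothPrincipalBundle.maximal_exists_le_vanishingAt_iff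
  · simp only [hcond'']
    exact SmoothPrincipalBundle.maximal_exists_le_vanishingAt_iff
  · exact SmoothPrincipalBundle.isMaximalFiniteCodimSubalgebra_iff.2 ⟨m, rfl⟩
  · simp only [hcond']
    exact ⟨le_rfl, fun S hS _ => hS⟩
  · obtain ⟨m', rfl⟩ := SmoothPrincipalBundle.isMaximalFiniteCodimSubalgebra_iff.1 hT
    -- The bracket condition for T = 𝒜_{m'} says 𝒜(m) ⊆ 𝒜(m'), which determines the point.
    rw [SmoothPrincipalBundle.eq_of_vanishingAt_le_anchorVanishingAt
      (((hcond' _ m').1 h).trans (B.vanishingAt_le_anchorVanishingAt m'))]
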